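/- Let $n\ge 2$, $0<\alpha<1$, $\delta>0$, and let $\Sigma$ be a compact $n$-dimensional smooth manifold with boundary $\partial\Sigma$. Let $g_s=g(\cdot,s)$, $s\in(-\delta,\delta)$, be Riemannian metrics on $\Sigma$ such that $\overline g=ds^2+g_{ab}(x,s)\,dx^a dx^b$ is a smooth Riemannian metric on $N=\Sigma\times(-\delta,\delta)$. For a function $u:\Sigma\to(-\delta,\delta)$ write $g_u(x)=g(x,u(x))$. The minimal surface equation for $u$ is, in local coordinates of $\Sigma$, $$-\frac{1}{\det(g_u)^{1/2}}\,\partial_a\!\left(\frac{\det(g_u)^{1/2}}{\sqrt{1+|\nabla u|^2_{g_u}}}\,g_u^{ab}\,\partial_b u\right)+\frac12\frac{(\partial_s g_u^{-1})(\nabla u,\nabla u)}{(1+|\nabla u|^2_{g_u})^{1/2}}+\frac12(1+|\nabla u|^2_{g_u})^{1/2}\,\mathrm{Tr}(g_u^{-1}\partial_s g_u)=0\quad\text{on }\Sigma. \qquad (1)$$ Fix norms of $C^{2,\alpha}(\Sigma)$ and of $C^{j,\alpha}(\partial\Sigma)$, $j=1,2$, defined by finitely many charts. Let $\epsilon>0$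 and $r<\delta$, put $\mathcal W_\epsilon=\{h\in C^\infty(\partial\Sigma):\|h\|_{C^{2,\alpha}(\partial\Sigma)}<\epsilon\}$, and assume that (1) is well posed for boundary values in $\mathcal W_\epsilon$ in the following sense: for every $h\in\mathcal W_\epsilon$ there is a unique solution $u_h\in C^{2,\alpha}(\Sigma)$ of (1) with $u_h|_{\partial\Sigma}=h$ and $\|u_h\|_{C^{2,\alpha}(\Sigma)}\le r$, and the map $h\mapsto u_h$ from $\mathcal W_\epsilon$ (with the norm of $C^{2,\alpha}(\partial\Sigma)$) to $C^{2,\alpha}(\Sigma)$ is Fréchet differentiable. Let $Y(h)=\{(u_h(x),x):x\in\Sigma\}$ be the minimal surface with boundary value $h$, let $\mathrm{Vol}(Y(h))$ be its volume with respect to $\overline g$, and let $\Lambda_{\overline g}(h)=\partial_\nu u_h|_{\partial\Sigma}$ be the Dirichlet-to-Neumann map, where $\nu$ is the exterior unit normal of $\Sigma$ at $x\in\partial\Sigma$ with respect to $g(\cdot,h(x))$. Then $\partial\Sigma$, the metric $\overline g|_{\partial\Sigma\times(-\delta,\delta)}$ and the volumes $\mathrm{Vol}(Y(h))$, $h\in\mathcal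 W_\epsilon$, determine $\Lambda_{\overline g}(h)$ for all $h\in\mathcal W_\epsilon$. Moreover, for every integer $k\ge0$, $\partial\Sigma$, the metric $\overline g|_{\partial\Sigma\times(-\delta,\delta)}$ and the Fréchet derivatives at $h=0$ of order at most $k+1$ of $h\mapsto\mathrm{Vol}(Y(h))$ determine the Fréchet derivatives at $h=0$ of order at most $k$ of $\Lambda_{\overline g}:\mathcal W_\epsilon\to C^{1,\alpha}(\partial\Sigma)$. Precisely: let $(\Sigma_1,\overline g_1)$ and $(\Sigma_2,\overline g_2)$ be as above with a common boundary $\partial\Sigma$ (a manifold smoothly embedded onto the boundary of each), with the same $\delta,\epsilon,r,\alpha$ and the same norms on $\partial\Sigma$, and such that $ds^2+g_1(\cdot,s)$ and $ds^2+g_2(\cdot,s)$ restrict to the same metric on $\partial\Sigma\times(-\delta,\delta)$. If $\mathrm{Vol}(Y_1(h))=\mathrm{Vol}(Y_2(h))$ for all $h\in\mathcal W_\epsilon$, then $\Lambda_{\overline g_1}(h)=\Lambda_{\overline g_2}(h)$ for all $h\in\mathcal W_\epsilon$. If $k\ge0$, if the two volume maps are $C^{k+1}$ and the two maps $\Lambda_{\overline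 g_1},\Lambda_{\overline g_2}$ are $C^k$ (into $C^{1,\alpha}(\partial\Sigma)$) in the Fréchet sense near $h=0$, and if the Fréchet derivatives at $h=0$ of the two volume maps agree for all orders at most $k+1$, then the Fréchet derivatives at $h=0$ of $\Lambda_{\overline g_1}$ and $\Lambda_{\overline g_2}$ agree for all orders at most $k$. -/

import Mathlib

open Set Topology
open scoped Manifold ContDiff ENNReal NNReal

noncomputable section

/-! ### Hölder spaces on compact manifolds -/

section Holder

variable {E : Type*} [NormedAddCommGroup E] [NormedSpace ℝ E]
  {H : Type*} [TopologicalSpace H]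

/-- A finite family of smooth charts together with compact subsets of their domains whose
interiors cover the manifold.  It is the auxiliary choice that enters the definition of the
norm of `C^{k,α}(M)` (different choices give equivalent norms). -/
structure ChartCover (I : ModelWithCorners ℝ E H) (M : Type*) [TopologicalSpace M]
    [ChartedSpace H M] where
  /-- the number of charts -/
  N : ℕ
  /-- the charts -/
  chart : Fin N → OpenPartialHomeomorph M H
  chart_mem : ∀ i, chart i ∈ IsManifold.maximalAtlas I ∞ M
  /-- the compact pieces -/
  K : Fin N → Set M
  isCompact_K : ∀ i, IsCompact (K i)
  K_subset : ∀ i, K i ⊆ (chart i).source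
  cover : ⋃ i, interior (K i) = univ

variable {I : ModelWithCorners ℝ E H} {M : Type*} [TopologicalSpace M] [ChartedSpace H M]

/-- The representation `f ∘ φ⁻¹` of a function in a chart `φ`; it is meaningful on
`(φ.extend I).target`, which is relatively open in `range I`. -/
def localRep (I : ModelWithCorners ℝ E H) (φ : OpenPartialHomeomorph M H) (f : M → ℝ) : E → ℝ :=
  f ∘ (φ.extend I).symm

/-- `∑_i ( ∑_{j ≤ k} sup_{K_i} |D^j f| + [D^k f]_{α, K_i} )`, where the `i`-th summand is computed
in the `i`-th chart, and `[·]_α` is the Hölder seminorm of exponent `α`. -/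
def holderENorm (A : ChartCover I M) (k : ℕ) (α : ℝ≥0) (f : M → ℝ) : ℝ≥0∞ :=
  ∑ i : Fin A.N,
    ((∑ j ∈ Finset.range (k + 1), ⨆ x : ((A.chart i).extend I '' A.K i : Set E),
        (‖iteratedFDerivWithin ℝ j (localRep I (A.chart i) f) (range I) (x : E)‖₊ : ℝ≥0∞)) +
      eHolderNorm α (fun x : ((A.chart i).extend I '' A.K i : Set E) =>
        iteratedFDerivWithin ℝ k (localRep I (A.chart i) f) (range I) (x : E)))

theorem contDiffWithinAt_localRep (A : ChartCover I M) {k : ℕ} {f : M → ℝ}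
    (hf : ContMDiff I 𝓘(ℝ, ℝ) k f) (i : Fin A.N) {x : E}
    (hx : x ∈ (A.chart i).extend I '' A.K i) :
    ContDiffWithinAt ℝ k (localRep I (A.chart i) f) (range I) x := by
  obtain ⟨p, hp, rfl⟩ := hx
  have hps := A.K_subset i hp
  have hmem : A.chart i ∈ IsManifold.maximalAtlas I (k : WithTop ℕ∞) M :=
    IsManifold.maximalAtlas_subset_of_le (by exact_mod_cast le_top) (A.chart_mem i)
  have h1 : ContMDiffOn 𝓘(ℝ, E) 𝓘(ℝ, ℝ) k (localRep I (A.chart i) f) (I '' (A.chart i).target) :=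
    hf.comp_contMDiffOn (contMDiffOn_extend_symm hmem)
  have h2 := contMDiffOn_iff_contDiffOn.1 h1
  have h3 : I '' (A.chart i).target = ((A.chart i).extend I).target :=
    ((A.chart i).extend_target').symm
  rw [h3] at h2
  exact (h2 _ (((A.chart i).extend I).map_source (by simpa using hps))).mono_of_mem_nhdsWithin
    ((A.chart i).extend_target_mem_nhdsWithin hps)

theorem mem_range_of_mem_image (A : ChartCover I M) (i : Fin A.N) {x : E}
    (hx : x ∈ (A.chart i).extend I '' A.K i) : x ∈ range I := by
  obtain ⟨p, _, rfl⟩ := hx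
  simp

theorem iteratedFDerivWithin_localRep_add (A : ChartCover I M) {k j : ℕ} (hj : j ≤ k)
    {f g : M → ℝ} (hf : ContMDiff I 𝓘(ℝ, ℝ) k f) (hg : ContMDiff I 𝓘(ℝ, ℝ) k g) (i : Fin A.N)
    {x : E} (hx : x ∈ (A.chart i).extend I '' A.K i) :
    iteratedFDerivWithin ℝ j (localRep I (A.chart i) (f + g)) (range I) x =
      iteratedFDerivWithin ℝ j (localRep I (A.chart i) f) (range I) x +
        iteratedFDerivWithin ℝ j (localRep I (A.chart i) g) (range I) x :=
  iteratedFDerivWithin_add_apply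
    ((contDiffWithinAt_localRep A hf i hx).of_le (by exact_mod_cast hj))
    ((contDiffWithinAt_localRep A hg i hx).of_le (by exact_mod_cast hj))
    I.uniqueDiffOn (mem_range_of_mem_image A i hx)

theorem iteratedFDerivWithin_localRep_smul (A : ChartCover I M) {k j : ℕ} (hj : j ≤ k)
    (c : ℝ) {f : M → ℝ} (hf : ContMDiff I 𝓘(ℝ, ℝ) k f) (i : Fin A.N)
    {x : E} (hx : x ∈ (A.chart i).extend I '' A.K i) :
    iteratedFDerivWithin ℝ j (localRep I (A.chart i) (c • f)) (range I) x =
      c • iteratedFDerivWithin ℝ j (localRep I (A.chart i) f) (range I) x :=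
  iteratedFDerivWithin_const_smul_apply
    ((contDiffWithinAt_localRep A hf i hx).of_le (by exact_mod_cast hj))
    I.uniqueDiffOn (mem_range_of_mem_image A i hx)

theorem holderENorm_add_le (A : ChartCover I M) (k : ℕ) (α : ℝ≥0) {f g : M → ℝ}
    (hf : ContMDiff I 𝓘(ℝ, ℝ) k f) (hg : ContMDiff I 𝓘(ℝ, ℝ) k g) :
    holderENorm A k α (f + g) ≤ holderENorm A k α f + holderENorm A k α g := by
  unfold holderENorm
  rw [← Finset.sum_add_distrib]
  refine Finset.sum_le_sum fun i _ => ?_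
  rw [add_add_add_comm]
  refine add_le_add ?_ ?_
  · rw [← Finset.sum_add_distrib]
    refine Finset.sum_le_sum fun j hj => iSup_le fun x => ?_
    rw [iteratedFDerivWithin_localRep_add A (Nat.lt_succ_iff.1 (Finset.mem_range.1 hj)) hf hg i x.2]
    refine (ENNReal.coe_le_coe.2 (nnnorm_add_le _ _)).trans ?_
    rw [ENNReal.coe_add]
    exact add_le_add
      (le_iSup (fun x : ((A.chart i).extend I '' A.K i : Set E) =>
        (‖iteratedFDerivWithin ℝ j (localRep I (A.chart i) f) (range I) (x : E)‖₊ : ℝ≥0∞)) x)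
      (le_iSup (fun x : ((A.chart i).extend I '' A.K i : Set E) =>
        (‖iteratedFDerivWithin ℝ j (localRep I (A.chart i) g) (range I) (x : E)‖₊ : ℝ≥0∞)) x)
  · refine le_trans (le_of_eq ?_) eHolderNorm_add_le
    congr 1
    funext x
    exact iteratedFDerivWithin_localRep_add A le_rfl hf hg i x.2

theorem holderENorm_smul (A : ChartCover I M) (k : ℕ) (α : ℝ≥0) (c : ℝ) {f : M → ℝ}
    (hf : ContMDiff I 𝓘(ℝ, ℝ) k f) :
    holderENorm A k α (c • f) = ‖c‖ₑ * holderENorm A k α f := by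
  unfold holderENorm
  rw [Finset.mul_sum]
  refine Finset.sum_congr rfl fun i _ => ?_
  rw [mul_add]
  congr 1
  · rw [Finset.mul_sum]
    refine Finset.sum_congr rfl fun j hj => ?_
    rw [ENNReal.mul_iSup]
    refine iSup_congr fun x => ?_
    rw [iteratedFDerivWithin_localRep_smul A (Nat.lt_succ_iff.1 (Finset.mem_range.1 hj)) c hf i x.2,
      nnnorm_smul, ENNReal.coe_mul]
    rfl
  · refine Eq.trans ?_ (eHolderNorm_smul c)
    congr 1
    funext x
    exact iteratedFDerivWithin_localRep_smul A le_rfl c hf i x.2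

theorem holderENorm_zero (A : ChartCover I M) (k : ℕ) (α : ℝ≥0) :
    holderENorm A k α (0 : M → ℝ) = 0 := by
  have h := holderENorm_smul A k α (0 : ℝ) (f := (0 : M → ℝ)) contMDiff_const
  simpa using h

theorem eq_zero_of_holderENorm (A : ChartCover I M) {k : ℕ} {α : ℝ≥0} {f : M → ℝ}
    (h : holderENorm A k α f = 0) : f = 0 := by
  funext p
  have hp : p ∈ ⋃ i, interior (A.K i) := A.cover ▸ mem_univ p
  obtain ⟨i, hi⟩ := mem_iUnion.1 hp
  have hK := interior_subset hi
  have h1 := (Finset.sum_eq_zero_iff.1 h) i (Finset.mem_univ i)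
  have h2 := (Finset.sum_eq_zero_iff.1 (add_eq_zero.1 h1).1) 0 (by simp)
  have h3 := (ENNReal.iSup_eq_zero.1 h2) ⟨_, mem_image_of_mem _ hK⟩
  have h4 : iteratedFDerivWithin ℝ 0 (localRep I (A.chart i) f) (range I)
      ((A.chart i).extend I p) = 0 := by simpa using h3
  have h5 := congrArg (fun T => T (0 : Fin 0 → E)) h4
  have h6 : (A.chart i).symm (A.chart i p) = p := (A.chart i).left_inv (A.K_subset i hK)
  simpa [iteratedFDerivWithin_zero_apply, localRep, h6] using h5

/-- The linear space `C^{k,α}(M)`. -/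
def holderSubmodule (A : ChartCover I M) (k : ℕ) (α : ℝ≥0) : Submodule ℝ (M → ℝ) where
  carrier := {f | ContMDiff I 𝓘(ℝ, ℝ) k f ∧ holderENorm A k α f < ⊤}
  add_mem' := fun hf hg => ⟨hf.1.add hg.1,
    (holderENorm_add_le A k α hf.1 hg.1).trans_lt (ENNReal.add_lt_top.2 ⟨hf.2, hg.2⟩)⟩
  zero_mem' := ⟨contMDiff_const, by rw [holderENorm_zero]; exact ENNReal.zero_lt_top⟩
  smul_mem' := fun c f hf => ⟨(contMDiff_const (I := I) (I' := 𝓘(ℝ, ℝ)) (c := c)).smul hf.1, by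
    rw [holderENorm_smul A k α c hf.1]
    exact ENNReal.mul_lt_top enorm_lt_top hf.2⟩

/-- The normed space `C^{k,α}(M)`. -/
def HolderSpace (A : ChartCover I M) (k : ℕ) (α : ℝ≥0) : Type _ := holderSubmodule A k α

namespace HolderSpace

variable {A : ChartCover I M} {k : ℕ} {α : ℝ≥0}

instance : AddCommGroup (HolderSpace A k α) :=
  inferInstanceAs (AddCommGroup (holderSubmodule A k α))

instance : Module ℝ (HolderSpace A k α) :=
  inferInstanceAs (Module ℝ (holderSubmodule A k α))

/-- The underlying function. -/
def toFun (f : HolderSpace A k α) : M → ℝ := Subtype.val f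

instance : CoeFun (HolderSpace A k α) (fun _ => M → ℝ) := ⟨toFun⟩

theorem mem (f : HolderSpace A k α) :
    ContMDiff I 𝓘(ℝ, ℝ) k f ∧ holderENorm A k α f < ⊤ :=
  Subtype.property f

instance : Norm (HolderSpace A k α) := ⟨fun f => (holderENorm A k α f).toReal⟩

theorem normCore : NormedSpace.Core ℝ (HolderSpace A k α) where
  norm_nonneg f := ENNReal.toReal_nonneg
  norm_smul c f := by
    have h := holderENorm_smul A k α c f.mem.1
    change (holderENorm A k α (c • (f : M → ℝ))).toReal = ‖c‖ * (holderENorm A k α f).toReal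
    erw [h]
    rw [ENNReal.toReal_mul, toReal_enorm]
  norm_triangle f g := by
    have h := holderENorm_add_le A k α f.mem.1 g.mem.1
    have h' := ENNReal.toReal_mono (ENNReal.add_lt_top.2 ⟨f.mem.2, g.mem.2⟩).ne h
    rw [ENNReal.toReal_add f.mem.2.ne g.mem.2.ne] at h'
    exact h'
  norm_eq_zero_iff f := by
    constructor
    · intro h
      have h1 : holderENorm A k α f = 0 := by
        rcases (ENNReal.toReal_eq_zero_iff _).1 h with h0 | h0
        · exact h0
        · exact absurd h0 f.mem.2.ne
      exact Subtype.ext (eq_zero_of_holderENorm A h1)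
    · rintro rfl
      change (holderENorm A k α (0 : M → ℝ)).toReal = 0
      rw [holderENorm_zero, ENNReal.toReal_zero]

instance : NormedAddCommGroup (HolderSpace A k α) := NormedAddCommGroup.ofCore normCore

instance : NormedSpace ℝ (HolderSpace A k α) := NormedSpace.ofCore normCore

end HolderSpace

/-- The space `C^∞(M)` equipped with the norm of `C^{2,α}(M)`. -/
def smoothSubspace (B : ChartCover I M) (α : ℝ≥0) : Submodule ℝ (HolderSpace B 2 α) where
  carrier := {h | ContMDiff I 𝓘(ℝ, ℝ) ∞ h}
  add_mem' := fun hf hg => hf.add hg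
  zero_mem' := contMDiff_const
  smul_mem' := fun c _ hf => (contMDiff_const (I := I) (I' := 𝓘(ℝ, ℝ)) (c := c)).smul hf

end Holder

/-! ### One-parameter families of metrics, minimal graphs, volumes and the normal derivative -/

section MinimalGraph

variable {m : ℕ} {S : Type*} [TopologicalSpace S] [ChartedSpace (EuclideanHalfSpace (m + 1)) S]
  [IsManifold (𝓡∂ (m + 1)) ∞ S]

variable (m S) in
/-- A family `g_s`, `|s| < δ`, of Riemannian metrics on `S` which is jointly smooth in the point and
in `s`, that is, a smooth Riemannian metric `ds² + g_s` on `S × (-δ, δ)`.  (The values for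
`|s| ≥ δ` are irrelevant.) -/
structure FermiMetric (δ : ℝ) where
  /-- the scalar product `g_s` on the tangent space at `p` -/
  val : ℝ → ∀ p : S,
    TangentSpace (𝓡∂ (m + 1)) p →L[ℝ] TangentSpace (𝓡∂ (m + 1)) p →L[ℝ] ℝ
  symm : ∀ s ∈ Ioo (-δ) δ, ∀ p v w, val s p v w = val s p w v
  pos : ∀ s ∈ Ioo (-δ) δ, ∀ p v, v ≠ 0 → 0 < val s p v v
  smooth : ContMDiffOn ((𝓡∂ (m + 1)).prod 𝓘(ℝ, ℝ))
    ((𝓡∂ (m + 1)).prod 𝓘(ℝ, EuclideanSpace ℝ (Fin (m + 1)) →L[ℝ]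
      EuclideanSpace ℝ (Fin (m + 1)) →L[ℝ] ℝ)) ∞
    (fun q : S × ℝ => Bundle.TotalSpace.mk' (EuclideanSpace ℝ (Fin (m + 1)) →L[ℝ]
      EuclideanSpace ℝ (Fin (m + 1)) →L[ℝ] ℝ)
      (E := fun p : S => TangentSpace (𝓡∂ (m + 1)) p →L[ℝ] TangentSpace (𝓡∂ (m + 1)) p →L[ℝ] ℝ)
      q.1 (val q.2 q.1))
    (univ ×ˢ Ioo (-δ) δ)

/-- The partial derivative `∂_a f` on the closed half-space `{x | 0 ≤ x 0}` (one-sided at the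
boundary). -/
def partialDeriv (a : Fin (m + 1)) (f : EuclideanSpace ℝ (Fin (m + 1)) → ℝ)
    (x : EuclideanSpace ℝ (Fin (m + 1))) : ℝ :=
  fderivWithin ℝ f (range (𝓡∂ (m + 1))) x (EuclideanSpace.single a 1)

/-- The coordinate vector field `∂_a` of a chart `φ`, at the point with coordinates `x`. -/
def coordVec (φ : OpenPartialHomeomorph S (EuclideanHalfSpace (m + 1)))
    (x : EuclideanSpace ℝ (Fin (m + 1))) (a : Fin (m + 1)) :
    TangentSpace (𝓡∂ (m + 1)) ((φ.extend (𝓡∂ (m + 1))).symm x) :=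
  mfderivWithin 𝓘(ℝ, EuclideanSpace ℝ (Fin (m + 1))) (𝓡∂ (m + 1))
    (φ.extend (𝓡∂ (m + 1))).symm (range (𝓡∂ (m + 1))) x (EuclideanSpace.single a 1)

namespace FermiMetric

variable {δ : ℝ} (g : FermiMetric m S δ)

/-- The matrix `g_{ab}(x, s)` of `g_s` in a chart. -/
def coeff (φ : OpenPartialHomeomorph S (EuclideanHalfSpace (m + 1)))
    (x : EuclideanSpace ℝ (Fin (m + 1))) (s : ℝ) : Matrix (Fin (m + 1)) (Fin (m + 1)) ℝ :=
  Matrix.of fun a b =>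
    g.val s ((φ.extend (𝓡∂ (m + 1))).symm x) (coordVec φ x a) (coordVec φ x b)

variable (φ : OpenPartialHomeomorph S (EuclideanHalfSpace (m + 1))) (u : S → ℝ)
  (x : EuclideanSpace ℝ (Fin (m + 1)))

/-- `∂_a u` in a chart. -/
def du (a : Fin (m + 1)) : ℝ := partialDeriv a (localRep (𝓡∂ (m + 1)) φ u) x

/-- The matrix `g_u = g(x, u(x))` in a chart. -/
def coeffAt : Matrix (Fin (m + 1)) (Fin (m + 1)) ℝ :=
  g.coeff φ x (localRep (𝓡∂ (m + 1)) φ u x)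

/-- The matrix `∂_s g(x, s)` at `s = u(x)`. -/
def dsCoeff : Matrix (Fin (m + 1)) (Fin (m + 1)) ℝ :=
  Matrix.of fun a b => deriv (fun s => g.coeff φ x s a b) (localRep (𝓡∂ (m + 1)) φ u x)

/-- The matrix `∂_s (g(x, s)⁻¹)` at `s = u(x)`. -/
def dsCoeffInv : Matrix (Fin (m + 1)) (Fin (m + 1)) ℝ :=
  Matrix.of fun a b => deriv (fun s => (g.coeff φ x s)⁻¹ a b) (localRep (𝓡∂ (m + 1)) φ u x)

/-- `|∇u|²_{g_u} = g_u^{ab} ∂_a u ∂_b u`. -/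
def gradSq : ℝ := ∑ a, ∑ b, (g.coeffAt φ u x)⁻¹ a b * du φ u x a * du φ u x b

/-- The `a`-th component of `g_u⁻¹ det(g_u)^{1/2} (1 + |∇u|²_{g_u})^{-1/2} ∇u`. -/
def flux (a : Fin (m + 1)) : ℝ :=
  √(g.coeffAt φ u x).det / √(1 + g.gradSq φ u x) *
    ∑ b, (g.coeffAt φ u x)⁻¹ a b * du φ u x b

/-- The lower order term
`f(u, ∇u) = ½ (1 + |∇u|²)^{-1/2} (∂_s g_u⁻¹)(∇u, ∇u) + ½ (1 + |∇u|²)^{1/2} Tr(g_u⁻¹ ∂_s g_u)`. -/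
def lowerOrder : ℝ :=
  1 / 2 * (1 / √(1 + g.gradSq φ u x)) *
      (∑ a, ∑ b, g.dsCoeffInv φ u x a b * du φ u x a * du φ u x b) +
    1 / 2 * √(1 + g.gradSq φ u x) * ((g.coeffAt φ u x)⁻¹ * g.dsCoeff φ u x).trace

/-- The left-hand side of the minimal surface equation in a chart:
`- det(g_u)^{-1/2} ∇ · (g_u⁻¹ det(g_u)^{1/2} (1 + |∇u|²_{g_u})^{-1/2} ∇u) + f(u, ∇u)`. -/
def minimalSurfaceOperator : ℝ :=
  -(1 / √(g.coeffAt φ u x).det) * (∑ a, partialDeriv a (fun y => g.flux φ u y a) x) +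
    g.lowerOrder φ u x

/-- `u` solves the minimal surface equation on `S` (expressed in every chart of the smooth
structure). -/
def SolvesMinimalSurfaceEq : Prop :=
  ∀ φ ∈ IsManifold.maximalAtlas (𝓡∂ (m + 1)) ∞ S, ∀ x ∈ (φ.extend (𝓡∂ (m + 1))).target,
    g.minimalSurfaceOperator φ u x = 0

/-- The matrix `h_{ab} = ∂_a u ∂_b u + g_{ab}(x, u(x))` of the metric which `ds² + g_s` induces on
the graph `{(u(x), x)}`, in the coordinates of the chart. -/
def graphMetric : Matrix (Fin (m + 1)) (Fin (m + 1)) ℝ :=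
  Matrix.of fun a b => du φ u x a * du φ u x b + g.coeffAt φ u x a b

/-- The volume `∫_S √(det h) dx` of the graph `{(u(x), x) : x ∈ S}`.  The manifold is cut into the
disjoint Borel pieces `K_i \ ⋃_{j < i} K_j`, each of which is integrated over in a chart; the value
does not depend on the choices. -/
def graphVolume (A : ChartCover (𝓡∂ (m + 1)) S) (u : S → ℝ) : ℝ :=
  ∑ i : Fin A.N,
    ∫ x in (A.chart i).extend (𝓡∂ (m + 1)) '' (A.K i \ ⋃ j : Fin A.N, ⋃ _ : j < i, A.K j),
      √(g.graphMetric (A.chart i) u x).det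

end FermiMetric

/-! The boundary of `S` is presented by an `m`-dimensional manifold `M` and a map `ι : M → S`. -/

variable {M : Type*} [TopologicalSpace M] [ChartedSpace (EuclideanSpace ℝ (Fin m)) M]

variable (m) in
/-- `ι : M → S` is a smooth embedding of the manifold `M` onto the boundary of `S`. -/
structure IsBoundaryEmbedding (ι : M → S) : Prop where
  contMDiff : ContMDiff (𝓡 m) (𝓡∂ (m + 1)) ∞ ι
  isEmbedding : IsEmbedding ι
  injective_mfderiv : ∀ p, Function.Injective (mfderiv (𝓡 m) (𝓡∂ (m + 1)) ι p)
  range_eq : range ι = (𝓡∂ (m + 1)).boundary S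

namespace FermiMetric

variable {δ : ℝ} (g : FermiMetric m S δ) (ι : M → S)

/-- `ν` is the exterior unit normal of `S` at the boundary point `ι p` with respect to `g_s`.
(Charts take values in `{x | 0 ≤ x 0}`, so a vector points outwards if its `0`-th coordinate is
negative.) -/
structure IsOuterUnitNormal (s : ℝ) (p : M) (ν : TangentSpace (𝓡∂ (m + 1)) (ι p)) : Prop where
  unit : g.val s (ι p) ν ν = 1
  normal : ∀ η : TangentSpace (𝓡 m) p,
    g.val s (ι p) ν (mfderiv (𝓡 m) (𝓡∂ (m + 1)) ι p η) = 0
  outer : (EuclideanSpace.proj 0 : EuclideanSpace ℝ (Fin (m + 1)) →L[ℝ] ℝ)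
    (mfderiv (𝓡∂ (m + 1)) 𝓘(ℝ, EuclideanSpace ℝ (Fin (m + 1)))
      (extChartAt (𝓡∂ (m + 1)) (ι p)) (ι p) ν) < 0

/-- The exterior unit normal at the boundary point `ι p` with respect to `g_s`. -/
def outerUnitNormal (s : ℝ) (p : M) : TangentSpace (𝓡∂ (m + 1)) (ι p) :=
  Classical.epsilon (g.IsOuterUnitNormal ι s p)

/-- The normal derivative `∂_ν u` at the boundary point `ι p`, where `ν` is the exterior unit normal
with respect to `g_{u(x)}`. -/
def normalDeriv (u : S → ℝ) (p : M) : ℝ :=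
  mfderiv (𝓡∂ (m + 1)) 𝓘(ℝ, ℝ) u (ι p) (g.outerUnitNormal ι (u (ι p)) p)

variable (A : ChartCover (𝓡∂ (m + 1)) S) (B : ChartCover (𝓡 m) M) (α : ℝ≥0)

/-- For every `h ∈ C^∞(M)` with `‖h‖_{C^{2,α}} < ε`, the function `u h` is the unique solution of
the minimal surface equation with boundary value `h` and with `‖u h‖_{C^{2,α}} ≤ r`. -/
structure IsSolutionMap (ε r : ℝ) (u : smoothSubspace B α → HolderSpace A 2 α) : Prop where
  solves : ∀ h ∈ Metric.ball (0 : smoothSubspace B α) ε, g.SolvesMinimalSurfaceEq (u h)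
  boundary : ∀ h ∈ Metric.ball (0 : smoothSubspace B α) ε, ∀ p, u h (ι p) = (h : HolderSpace B 2 α) p
  norm_le : ∀ h ∈ Metric.ball (0 : smoothSubspace B α) ε, ‖u h‖ ≤ r
  unique : ∀ h ∈ Metric.ball (0 : smoothSubspace B α) ε, ∀ v : HolderSpace A 2 α,
    g.SolvesMinimalSurfaceEq v → (∀ p, v (ι p) = (h : HolderSpace B 2 α) p) → ‖v‖ ≤ r → v = u h

variable {A B α}

/-- The map `h ↦ Vol(Y(h))`. -/
def volMap (u : smoothSubspace B α → HolderSpace A 2 α) (h : smoothSubspace B α) : ℝ :=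
  g.graphVolume A (u h)

/-- `Λ` is the Dirichlet-to-Neumann map `h ↦ ∂_ν u_h`, as a map from
`{h ∈ C^∞(M) : ‖h‖_{C^{2,α}} < ε}` to `C^{1,α}(M)` (its values elsewhere are irrelevant). -/
def IsDNMap (ε : ℝ) (u : smoothSubspace B α → HolderSpace A 2 α)
    (Λ : smoothSubspace B α → HolderSpace B 1 α) : Prop :=
  ∀ h ∈ Metric.ball (0 : smoothSubspace B α) ε, ∀ p, Λ h p = g.normalDeriv ι (u h) p

end FermiMetric

end MinimalGraph

end

set_option linter.unusedSectionVars false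

/-! The proof rests on the first variation of area. Let u = u_h solve the minimal surface equation
and let w be the derivative of h ↦ u_h in a direction η. The Euler–Lagrange operator of the area
density √det(du ⊗ du + g_u) is √det g_u times the left side of the equation, so at a solution the
variation of the density in the direction w is the divergence of w times the flux. Differentiating
u_{h+tη} = h + tη on the boundary gives w = η there; nothing else about w matters. The divergence
theorem yields dVol(h)η = ∫_{∂Σ} η N / √(1 + |dh|² + N²) dA, with N = ∂_ν u_h, where |dh|² and dA
refer to the metric γ induced on ∂Σ by g(·, h). This is `hasDerivAt_volMap`; the analytic half is
`hasDerivAt_graphVolume`, and the linear algebra that splits the gradient into tangential and normal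
parts is `conormal_flux_eq`. In the integrand everything except N is boundary data shared by the two
manifolds.

For fixed γ and dh the integrand is strictly increasing in N (`conormalDensity_lt`). If the normal
derivatives of two solutions differed at a boundary point, a nonnegative bump η near that point
would separate the derivatives of the two volumes. Hence equal volumes give equal
Dirichlet-to-Neumann maps.

For the derivatives at 0 the nonlinear relation is not differentiated repeatedly; orders of
vanishing are compared instead. Suppose that the derivatives of Λ₁ - Λ₂ at 0 of order below j ≤ k
vanish, and that the j-th one, on the diagonal (h, …, h), is positive at a point q. By Taylor's
formula along the line t h, the difference Λ₁(th) - Λ₂(th) is at least a positive multiple of t^j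
near q. The monotonicity in N is uniform for bounded N and small t
(`exists_le_conormalDensity_sub`), so testing with a bump η bounds d(Vol₁ - Vol₂)(th)η below by a
positive multiple of t^j. But this quantity is o(t^k), because the derivatives of Vol₁ - Vol₂ at 0
vanish up to order k + 1. This contradiction, together with the one obtained by exchanging the two
manifolds, shows that the j-th derivative vanishes on the diagonal, hence vanishes by symmetry and
polarization (`iteratedFDeriv_eq_zero_of_diagonal`). -/

noncomputable section

/-! ### Derivatives of charts and of their inverses, one-sided at the boundary -/

section ChartCalculus

variable {E : Type*} [NormedAddCommGroup E] [NormedSpace ℝ E]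
  {H : Type*} [TopologicalSpace H] {I : ModelWithCorners ℝ E H}
  {M : Type*} [TopologicalSpace M] [ChartedSpace H M] [IsManifold I ∞ M]
  {φ ψ : OpenPartialHomeomorph M H}

theorem extend_target_subset_range (φ : OpenPartialHomeomorph M H) :
    (φ.extend I).target ⊆ range I := φ.extend_target_subset_range

theorem extend_symm_mem_source {x : E} (hx : x ∈ (φ.extend I).target) :
    (φ.extend I).symm x ∈ φ.source := by
  simpa using (φ.extend I).map_target hx

theorem extend_target_mem_nhdsWithin_of_mem {x : E} (hx : x ∈ (φ.extend I).target) :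
    (φ.extend I).target ∈ 𝓝[range I] x := by
  have := φ.extend_target_mem_nhdsWithin (I := I) (extend_symm_mem_source hx)
  rwa [(φ.extend I).right_inv hx] at this

theorem contMDiffOn_extend_symm_target (hφ : φ ∈ IsManifold.maximalAtlas I ∞ M) :
    ContMDiffOn 𝓘(ℝ, E) I ∞ (φ.extend I).symm (φ.extend I).target := by
  have := contMDiffOn_extend_symm hφ
  rwa [← φ.extend_target'] at this

theorem contMDiffWithinAt_extend_symm (hφ : φ ∈ IsManifold.maximalAtlas I ∞ M) {x : E}
    (hx : x ∈ (φ.extend I).target) :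
    ContMDiffWithinAt 𝓘(ℝ, E) I ∞ (φ.extend I).symm (range I) x :=
  (contMDiffOn_extend_symm_target hφ x hx).mono_of_mem_nhdsWithin
    (extend_target_mem_nhdsWithin_of_mem hx)

theorem mdifferentiableWithinAt_extend_symm (hφ : φ ∈ IsManifold.maximalAtlas I ∞ M) {x : E}
    (hx : x ∈ (φ.extend I).target) :
    MDifferentiableWithinAt 𝓘(ℝ, E) I (φ.extend I).symm (range I) x :=
  (contMDiffWithinAt_extend_symm hφ hx).mdifferentiableWithinAt (by simp)

theorem mdifferentiableAt_extend (hφ : φ ∈ IsManifold.maximalAtlas I ∞ M) {p : M}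
    (hp : p ∈ φ.source) : MDifferentiableAt I 𝓘(ℝ, E) (φ.extend I) p :=
  (φ.contMDiffAt_extend hφ hp).mdifferentiableAt (by simp)

theorem uniqueMDiffWithinAt_range (x : E) (hx : x ∈ range I) :
    UniqueMDiffWithinAt 𝓘(ℝ, E) (range I) x :=
  uniqueMDiffWithinAt_iff_uniqueDiffWithinAt.2 (I.uniqueDiffOn x hx)

/-- Chain rule for the representation of a map in a chart. -/
theorem mfderivWithin_comp_extend_symm {E' H' M' : Type*} [NormedAddCommGroup E']
    [NormedSpace ℝ E'] [TopologicalSpace H'] {I' : ModelWithCorners ℝ E' H'} [TopologicalSpace M']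
    [ChartedSpace H' M'] (hφ : φ ∈ IsManifold.maximalAtlas I ∞ M) {x : E}
    (hx : x ∈ (φ.extend I).target) {f : M → M'}
    (hf : MDifferentiableAt I I' f ((φ.extend I).symm x)) :
    mfderivWithin 𝓘(ℝ, E) I' (f ∘ (φ.extend I).symm) (range I) x =
      (mfderiv I I' f ((φ.extend I).symm x)).comp
        (mfderivWithin 𝓘(ℝ, E) I (φ.extend I).symm (range I) x) :=
  mfderiv_comp_mfderivWithin x hf (mdifferentiableWithinAt_extend_symm hφ hx)
    (uniqueMDiffWithinAt_range x (extend_target_subset_range φ hx))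

/-- Chain rule for φ ∘ φ⁻¹ = id, which holds on a neighbourhood of x within the range of the model.
Derivatives within that range are determined because it has unique derivatives. -/
theorem mfderiv_extend_mfderivWithin_symm (hφ : φ ∈ IsManifold.maximalAtlas I ∞ M) {x : E}
    (hx : x ∈ (φ.extend I).target) (v : E) :
    (mfderiv I 𝓘(ℝ, E) (φ.extend I) ((φ.extend I).symm x)
      (mfderivWithin 𝓘(ℝ, E) I (φ.extend I).symm (range I) x v) : E) = v := by
  have h := mfderivWithin_comp_extend_symm hφ hx
    (mdifferentiableAt_extend hφ (extend_symm_mem_source hx))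
  have hU := uniqueMDiffWithinAt_range x (extend_target_subset_range φ hx)
  have h2 : mfderivWithin 𝓘(ℝ, E) 𝓘(ℝ, E) ((φ.extend I) ∘ (φ.extend I).symm) (range I) x =
      ContinuousLinearMap.id ℝ (TangentSpace 𝓘(ℝ, E) x) := by
    rw [← mfderivWithin_id hU]
    refine Filter.EventuallyEq.mfderivWithin_eq ?_ ?_
    · filter_upwards [extend_target_mem_nhdsWithin_of_mem hx] with y hy
      exact (φ.extend I).right_inv hy
    · exact (φ.extend I).right_inv hx
  rw [h2] at h
  exact (congrArg (fun T => T v) h).symm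

/-- In finite dimension a one-sided inverse is two-sided, so the other composition needs no second
chain rule. -/
theorem mfderivWithin_symm_mfderiv_extend [FiniteDimensional ℝ E]
    (hφ : φ ∈ IsManifold.maximalAtlas I ∞ M) {x : E}
    (hx : x ∈ (φ.extend I).target) (v : TangentSpace I ((φ.extend I).symm x)) :
    (mfderivWithin 𝓘(ℝ, E) I (φ.extend I).symm (range I) x
      (mfderiv I 𝓘(ℝ, E) (φ.extend I) ((φ.extend I).symm x) v)) = v := by
  let B : E →ₗ[ℝ] E := (mfderivWithin 𝓘(ℝ, E) I (φ.extend I).symm (range I) x).toLinearMap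
  let A : E →ₗ[ℝ] E := (mfderiv I 𝓘(ℝ, E) (φ.extend I) ((φ.extend I).symm x)).toLinearMap
  have hAB : ∀ w, A (B w) = w := mfderiv_extend_mfderivWithin_symm hφ hx
  have hB : Function.Surjective B :=
    LinearMap.injective_iff_surjective.1 (Function.LeftInverse.injective hAB)
  obtain ⟨w, hw⟩ := hB v
  change B (A v) = v
  rw [← hw, hAB]

theorem fderivWithin_localRep (hφ : φ ∈ IsManifold.maximalAtlas I ∞ M) {x : E}
    (hx : x ∈ (φ.extend I).target) {f : M → ℝ}
    (hf : MDifferentiableAt I 𝓘(ℝ, ℝ) f ((φ.extend I).symm x)) (v : E) :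
    fderivWithin ℝ (localRep I φ f) (range I) x v =
      mfderiv I 𝓘(ℝ, ℝ) f ((φ.extend I).symm x)
        (mfderivWithin 𝓘(ℝ, E) I (φ.extend I).symm (range I) x v) := by
  have h := mfderivWithin_comp_extend_symm hφ hx hf
  rw [mfderivWithin_eq_fderivWithin] at h
  exact congrArg (fun T => T v) h

theorem contDiffOn_localRep (hφ : φ ∈ IsManifold.maximalAtlas I ∞ M) {k : ℕ} {f : M → ℝ}
    (hf : ContMDiff I 𝓘(ℝ, ℝ) k f) : ContDiffOn ℝ k (localRep I φ f) (φ.extend I).target := by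
  rw [← contMDiffOn_iff_contDiffOn]
  exact hf.comp_contMDiffOn
    ((contMDiffOn_extend_symm_target hφ).of_le (by exact_mod_cast le_top))

theorem differentiableWithinAt_localRep (hφ : φ ∈ IsManifold.maximalAtlas I ∞ M) {f : M → ℝ}
    (hf : ContMDiff I 𝓘(ℝ, ℝ) 1 f) {x : E} (hx : x ∈ (φ.extend I).target) :
    DifferentiableWithinAt ℝ (localRep I φ f) (range I) x :=
  ((contDiffOn_localRep (k := 1) hφ hf x hx).differentiableWithinAt
    (by simp)).mono_of_mem_nhdsWithin
    (extend_target_mem_nhdsWithin_of_mem hx)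

/-- The set of coordinates, with respect to `φ`, of the points in the domain of a second chart is
relatively open. -/
theorem preimage_symm_mem_nhdsWithin {x : E} (hx : x ∈ (φ.extend I).target) {U : Set M}
    (hU : U ∈ 𝓝 ((φ.extend I).symm x)) : (φ.extend I).symm ⁻¹' U ∈ 𝓝[range I] x := by
  have h := φ.continuousAt_extend_symm' (I := I) hx
  exact mem_nhdsWithin_of_mem_nhds (h.preimage_mem_nhds hU)

end ChartCalculus

/-! ### Smoothness and positivity of the metric coefficients in a chart -/

section Coefficients

variable {m : ℕ} {S : Type*} [TopologicalSpace S] [ChartedSpace (EuclideanHalfSpace (m + 1)) S]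
  [IsManifold (𝓡∂ (m + 1)) ∞ S] {δ : ℝ} (g : FermiMetric m S δ)

namespace FermiMetric

/-- The pullbacks of a jointly smooth family of metrics under a smooth map are jointly smooth. -/
theorem contDiffOn_pullback {E' : Type*} [NormedAddCommGroup E'] [NormedSpace ℝ E'] {F : E' → S}
    {T : Set E'} (hT : UniqueDiffOn ℝ T) (hF : ContMDiffOn 𝓘(ℝ, E') (𝓡∂ (m + 1)) ∞ F T)
    (v w : E') :
    ContDiffOn ℝ ∞ (fun q : E' × ℝ => g.val q.2 (F q.1)
      (mfderivWithin 𝓘(ℝ, E') (𝓡∂ (m + 1)) F T q.1 v)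
      (mfderivWithin 𝓘(ℝ, E') (𝓡∂ (m + 1)) F T q.1 w)) (T ×ˢ Ioo (-δ) δ) := by
  have hfst : ContMDiffOn 𝓘(ℝ, E' × ℝ) 𝓘(ℝ, E') ∞ (Prod.fst : E' × ℝ → E') (T ×ˢ Ioo (-δ) δ) :=
    contMDiffOn_iff_contDiffOn.2 contDiff_fst.contDiffOn
  have hsnd : ContMDiffOn 𝓘(ℝ, E' × ℝ) 𝓘(ℝ, ℝ) ∞ (Prod.snd : E' × ℝ → ℝ) (T ×ˢ Ioo (-δ) δ) :=
    contMDiffOn_iff_contDiffOn.2 contDiff_snd.contDiffOn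
  have hbase : ContMDiffOn 𝓘(ℝ, E' × ℝ) ((𝓡∂ (m + 1)).prod 𝓘(ℝ, ℝ)) ∞
      (fun q : E' × ℝ => (F q.1, q.2)) (T ×ˢ Ioo (-δ) δ) :=
    (hF.comp hfst fun q hq => hq.1).prodMk hsnd
  have hval := g.smooth.comp hbase fun q hq => ⟨mem_univ _, hq.2⟩
  -- The field q ↦ dF(v) is the tangent map of F applied to a constant section, hence a smooth map
  -- into the tangent bundle.
  have hvec : ∀ v : E', ContMDiffOn 𝓘(ℝ, E' × ℝ) ((𝓡∂ (m + 1)).tangent) ∞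
      (fun q : E' × ℝ => (Bundle.TotalSpace.mk' (EuclideanSpace ℝ (Fin (m + 1)))
        (E := (TangentSpace (𝓡∂ (m + 1)) : S → Type _)) (F q.1)
        (mfderivWithin 𝓘(ℝ, E') (𝓡∂ (m + 1)) F T q.1 v))) (T ×ˢ Ioo (-δ) δ) := by
    intro v
    have hc : ContMDiff 𝓘(ℝ, E') (𝓘(ℝ, E').tangent) ∞
        (fun y : E' => (Bundle.TotalSpace.mk' E' y v : TangentBundle 𝓘(ℝ, E') E')) :=
      contMDiff_vectorSpace_iff_contDiff.2 contDiff_const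
    have ht := hF.contMDiffOn_tangentMapWithin (m := ∞) (by simp) hT.uniqueMDiffOn
    exact ht.comp (hc.comp_contMDiffOn hfst) fun q hq => hq.1
  have h := ContMDiffOn.clm_bundle_apply₂ (F₁ := EuclideanSpace ℝ (Fin (m + 1)))
    (F₂ := EuclideanSpace ℝ (Fin (m + 1))) (F₃ := ℝ) (E₃ := Bundle.Trivial S ℝ)
    hval (hvec v) (hvec w)
  intro q hq
  have h1 := h q hq
  rw [Bundle.contMDiffWithinAt_totalSpace] at h1
  exact contMDiffWithinAt_iff_contDiffWithinAt.1 h1.2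

end FermiMetric
end Coefficients

theorem uniqueDiffOn_extend_target {E : Type*} [NormedAddCommGroup E] [NormedSpace ℝ E]
    {H : Type*} [TopologicalSpace H] {I : ModelWithCorners ℝ E H} {M : Type*} [TopologicalSpace M]
    (φ : OpenPartialHomeomorph M H) : UniqueDiffOn ℝ (φ.extend I).target := by
  intro x hx
  have hxr := φ.extend_target_subset_range hx
  have h := φ.extend_target_mem_nhdsWithin (I := I) (y := (φ.extend I).symm x)
    (by simpa using (φ.extend I).map_target hx)
  rw [(φ.extend I).right_inv hx] at h
  exact (I.uniqueDiffOn x hxr).mono_nhds (nhdsWithin_le_of_mem h)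

/-- Links the two sets used for one-sided derivatives: coordinate vectors differentiate within the
range of the model, while `contDiffOn_pullback` differentiates within the set on which the inverse
chart is smooth. -/
theorem mfderivWithin_extend_symm_target {E : Type*} [NormedAddCommGroup E] [NormedSpace ℝ E]
    {H : Type*} [TopologicalSpace H] {I : ModelWithCorners ℝ E H} {M : Type*} [TopologicalSpace M]
    [ChartedSpace H M] [IsManifold I ∞ M] {φ : OpenPartialHomeomorph M H}
    (hφ : φ ∈ IsManifold.maximalAtlas I ∞ M) {x : E} (hx : x ∈ (φ.extend I).target) :
    mfderivWithin 𝓘(ℝ, E) I (φ.extend I).symm (φ.extend I).target x =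
      mfderivWithin 𝓘(ℝ, E) I (φ.extend I).symm (range I) x :=
  mfderivWithin_subset φ.extend_target_subset_range
    ((uniqueDiffOn_extend_target φ).uniqueMDiffOn x hx)
    (mdifferentiableWithinAt_extend_symm hφ hx)

section Coefficients

variable {m : ℕ} {S : Type*} [TopologicalSpace S] [ChartedSpace (EuclideanHalfSpace (m + 1)) S]
  [IsManifold (𝓡∂ (m + 1)) ∞ S] {δ : ℝ} (g : FermiMetric m S δ)
  {φ : OpenPartialHomeomorph S (EuclideanHalfSpace (m + 1))}

namespace FermiMetric

theorem contDiffOn_coeff (hφ : φ ∈ IsManifold.maximalAtlas (𝓡∂ (m + 1)) ∞ S)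
    (a b : Fin (m + 1)) :
    ContDiffOn ℝ ∞ (fun q : EuclideanSpace ℝ (Fin (m + 1)) × ℝ => g.coeff φ q.1 q.2 a b)
      ((φ.extend (𝓡∂ (m + 1))).target ×ˢ Ioo (-δ) δ) := by
  refine (g.contDiffOn_pullback (uniqueDiffOn_extend_target φ)
    (contMDiffOn_extend_symm_target hφ) (EuclideanSpace.single a 1)
    (EuclideanSpace.single b 1)).congr ?_
  intro q hq
  rw [mfderivWithin_extend_symm_target hφ hq.1]
  rfl

theorem sum_smul_coordVec (φ : OpenPartialHomeomorph S (EuclideanHalfSpace (m + 1)))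
    (x v : EuclideanSpace ℝ (Fin (m + 1))) :
    ∑ a, v a • coordVec φ x a =
      mfderivWithin 𝓘(ℝ, EuclideanSpace ℝ (Fin (m + 1))) (𝓡∂ (m + 1))
        (φ.extend (𝓡∂ (m + 1))).symm (range (𝓡∂ (m + 1))) x v := by
  have hv : v = ∑ a, v a • EuclideanSpace.single a (1 : ℝ) := by
    ext b
    simp [Finset.sum_apply, Pi.single_apply]
  conv_rhs => rw [hv]
  erw [map_sum]
  refine Finset.sum_congr rfl fun a _ => ?_
  erw [map_smul]
  rfl

theorem val_sum_coordVec (φ : OpenPartialHomeomorph S (EuclideanHalfSpace (m + 1)))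
    (x : EuclideanSpace ℝ (Fin (m + 1))) (s : ℝ) (v w : Fin (m + 1) → ℝ) :
    g.val s ((φ.extend (𝓡∂ (m + 1))).symm x) (∑ a, v a • coordVec φ x a)
      (∑ a, w a • coordVec φ x a) = v ⬝ᵥ (g.coeff φ x s).mulVec w := by
  simp only [map_sum, map_smul, FunLike.coe_sum, Finset.sum_apply, FunLike.coe_smul,
    Pi.smul_apply, smul_eq_mul, dotProduct, Matrix.mulVec, Finset.mul_sum, coeff, Matrix.of_apply]
  rw [Finset.sum_comm]
  refine Finset.sum_congr rfl fun a _ => Finset.sum_congr rfl fun b _ => ?_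
  ring

/-- Coordinate vectors are linearly independent because dφ is a left inverse of the map that sends v
to ∑ v_a ∂_a. -/
theorem coeff_posDef (hφ : φ ∈ IsManifold.maximalAtlas (𝓡∂ (m + 1)) ∞ S)
    {x : EuclideanSpace ℝ (Fin (m + 1))} (hx : x ∈ (φ.extend (𝓡∂ (m + 1))).target) {s : ℝ}
    (hs : s ∈ Ioo (-δ) δ) : (g.coeff φ x s).PosDef := by
  refine Matrix.PosDef.of_dotProduct_mulVec_pos ?_ ?_
  · ext a b
    exact g.symm s hs _ (coordVec φ x b) (coordVec φ x a)
  · intro v hv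
    rw [star_trivial, ← val_sum_coordVec]
    refine g.pos s hs _ _ fun h0 => hv ?_
    have h1 := sum_smul_coordVec φ x (WithLp.toLp 2 v)
    have h2 := mfderiv_extend_mfderivWithin_symm hφ hx (WithLp.toLp 2 v)
    rw [← h1] at h2
    erw [h0, map_zero] at h2
    exact funext fun a => (congrArg (fun T : EuclideanSpace ℝ (Fin (m + 1)) => T a) h2).symm

theorem du_eq (hφ : φ ∈ IsManifold.maximalAtlas (𝓡∂ (m + 1)) ∞ S)
    {x : EuclideanSpace ℝ (Fin (m + 1))} (hx : x ∈ (φ.extend (𝓡∂ (m + 1))).target) {u : S → ℝ}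
    (hu : MDifferentiableAt (𝓡∂ (m + 1)) 𝓘(ℝ, ℝ) u ((φ.extend (𝓡∂ (m + 1))).symm x))
    (a : Fin (m + 1)) :
    du φ u x a = mfderiv (𝓡∂ (m + 1)) 𝓘(ℝ, ℝ) u ((φ.extend (𝓡∂ (m + 1))).symm x)
      (coordVec φ x a) :=
  fderivWithin_localRep hφ hx hu _

end FermiMetric
end Coefficients

/-! ### Determinants and inverses of matrices depending on parameters -/

section MatrixCalculus

variable {n : Type*} [Fintype n] [DecidableEq n]

/-- The matrix determinant lemma for the rank-one perturbation p pᵀ. It is the reason why the area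
element of a graph factors as √det g · √(1 + |∇u|²). -/
theorem Matrix.det_vecMulVec_add {G : Matrix n n ℝ} (hG : IsUnit G.det) (p : n → ℝ) :
    (Matrix.of fun a b => p a * p b + G a b).det =
      G.det * (1 + ∑ a, ∑ b, G⁻¹ a b * p a * p b) := by
  have h := Matrix.det_add_replicateCol_mul_replicateRow (ι := Unit) hG p p
  have h1 : (Matrix.of fun a b => p a * p b + G a b) =
      G + Matrix.replicateCol Unit p * Matrix.replicateRow Unit p := by
    ext a b
    simp [Matrix.mul_apply, add_comm]
  rw [h1, h, Matrix.det_unique (n := Unit)]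
  congr 1
  simp only [Matrix.add_apply, Matrix.one_apply_eq, Matrix.mul_apply, Matrix.replicateRow_apply, Matrix.replicateCol_apply,
    Finset.sum_mul]
  congr 1
  rw [Finset.sum_comm]
  refine Finset.sum_congr rfl fun a _ => Finset.sum_congr rfl fun b _ => ?_
  ring

theorem ContDiffWithinAt.matrix_det {X : Type*} [NormedAddCommGroup X] [NormedSpace ℝ X]
    {k : WithTop ℕ∞} {A : X → Matrix n n ℝ} {s : Set X} {x : X}
    (h : ∀ a b, ContDiffWithinAt ℝ k (fun y => A y a b) s x) :
    ContDiffWithinAt ℝ k (fun y => (A y).det) s x := by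
  simp only [Matrix.det_apply]
  refine ContDiffWithinAt.sum fun σ _ => ?_
  refine ContDiffWithinAt.const_smul _ (contDiffWithinAt_prod fun i _ => h _ _)

/-- Cramer's rule: an entry of the adjugate is the determinant of the matrix with one row replaced
by a constant one. -/
theorem ContDiffWithinAt.matrix_inv {X : Type*} [NormedAddCommGroup X] [NormedSpace ℝ X]
    {k : WithTop ℕ∞} {A : X → Matrix n n ℝ} {s : Set X} {x : X}
    (h : ∀ a b, ContDiffWithinAt ℝ k (fun y => A y a b) s x) (h0 : (A x).det ≠ 0) (a b : n) :
    ContDiffWithinAt ℝ k (fun y => (A y)⁻¹ a b) s x := by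
  simp only [Matrix.inv_def, Matrix.smul_apply, smul_eq_mul, Ring.inverse_eq_inv',
    Matrix.adjugate_apply]
  refine ((ContDiffWithinAt.matrix_det h).inv h0).mul (ContDiffWithinAt.matrix_det fun c d => ?_)
  by_cases hc : c = b
  · subst hc
    simpa using contDiffWithinAt_const
  · simpa [Matrix.updateRow_ne hc] using h c d

/-- Jacobi's formula for the derivative of a determinant. -/
theorem HasDerivAt.matrix_det {A : ℝ → Matrix n n ℝ} {A' : Matrix n n ℝ} {s : ℝ}
    (h : ∀ a b, HasDerivAt (fun t => A t a b) (A' a b) s) (h0 : (A s).det ≠ 0) :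
    HasDerivAt (fun t => (A t).det) ((A s).det * ((A s)⁻¹ * A').trace) s := by
  let D : (n → n → ℝ) → ℝ := fun B => (Matrix.of B).det
  let A₀ : ℝ → n → n → ℝ := fun t a b => A t a b
  let B : n → n → ℝ := fun a b => A' a b
  have hD : ContDiff ℝ 1 D := by
    rw [contDiff_iff_contDiffAt]
    intro B
    rw [← contDiffWithinAt_univ]
    refine ContDiffWithinAt.matrix_det fun a b => ?_
    simp only [Matrix.of_apply]
    exact (contDiff_apply_apply ℝ ℝ a b).contDiffWithinAt
  have hd : HasFDerivAt D (fderiv ℝ D (A₀ s)) (A₀ s) :=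
    (hD.differentiable (by simp) _).hasFDerivAt
  have hA : HasDerivAt A₀ B s := hasDerivAt_pi.2 fun a => hasDerivAt_pi.2 fun b => h a b
  have h1 : HasDerivAt (fun t => (A t).det) (fderiv ℝ D (A₀ s) B) s :=
    HasFDerivAt.comp_hasDerivAt s hd hA
  -- The differential of the determinant in the direction A' is computed along the straight line A +
  -- t A', where det(A + tA') = det A · det(1 + t A⁻¹A') is a polynomial in t with known linear
  -- term.
  have hL : HasDerivAt (fun t : ℝ => A₀ s + t • B) B 0 := by
    have := ((hasDerivAt_id (0 : ℝ)).smul_const B).const_add (A₀ s)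
    simpa using this
  have h2 : HasDerivAt (fun t : ℝ => (A s + t • A').det) (fderiv ℝ D (A₀ s) B) 0 := by
    refine HasFDerivAt.comp_hasDerivAt (l := D) (f := fun t : ℝ => A₀ s + t • B) (0 : ℝ) ?_ hL
    have h0 : A₀ s + (0 : ℝ) • B = A₀ s := by simp
    exact h0.symm ▸ hd
  have h3 : ∀ t : ℝ, (A s + t • A').det = (A s).det * (1 + t • ((A s)⁻¹ * A')).det := by
    intro t
    rw [← Matrix.det_mul, Matrix.mul_add, Matrix.mul_one, Matrix.mul_smul, ← Matrix.mul_assoc,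
      Matrix.mul_nonsing_inv _ (isUnit_iff_ne_zero.2 h0), Matrix.one_mul]
  have h4 : HasDerivAt (fun t : ℝ => (A s + t • A').det)
      ((A s).det * ((A s)⁻¹ * A').trace) 0 := by
    obtain ⟨P, hP⟩ : ∃ P : Polynomial ℝ, ∀ t : ℝ, (1 + t • ((A s)⁻¹ * A')).det =
        1 + ((A s)⁻¹ * A').trace * t + P.eval t * t ^ 2 :=
      ⟨_, fun t => Matrix.det_one_add_smul t _⟩
    simp only [h3, hP]
    have hpoly := P.hasDerivAt (0 : ℝ)
    have := ((((hasDerivAt_id (0 : ℝ)).const_mul ((A s)⁻¹ * A').trace).const_add 1).add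
      (hpoly.mul (hasDerivAt_pow 2 (0 : ℝ)))).const_mul (A s).det
    simpa using this
  rwa [h2.unique h4] at h1

end MatrixCalculus

/-! ### The area density and its first variation -/

section Area

variable {m : ℕ} {S : Type*} [TopologicalSpace S] [ChartedSpace (EuclideanHalfSpace (m + 1)) S]
  [IsManifold (𝓡∂ (m + 1)) ∞ S] {δ : ℝ} (g : FermiMetric m S δ)
  {φ : OpenPartialHomeomorph S (EuclideanHalfSpace (m + 1))}

namespace FermiMetric

/-- The area density `√det (p ⊗ p + g(x, s))` of a graph with height `s` and slope `p`. -/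
def areaDensity (φ : OpenPartialHomeomorph S (EuclideanHalfSpace (m + 1)))
    (x : EuclideanSpace ℝ (Fin (m + 1))) (s : ℝ) (p : Fin (m + 1) → ℝ) : ℝ :=
  √(Matrix.of fun a b => p a * p b + g.coeff φ x s a b).det

/-- The derivative of the area density at `u` in the direction of a height `s'` and slope `p'`. -/
def areaVariation (φ : OpenPartialHomeomorph S (EuclideanHalfSpace (m + 1))) (u : S → ℝ)
    (x : EuclideanSpace ℝ (Fin (m + 1))) (s' : ℝ) (p' : Fin (m + 1) → ℝ) : ℝ :=
  ∑ a, g.flux φ u x a * p' a + √(g.coeffAt φ u x).det * g.lowerOrder φ u x * s'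

variable (hφ : φ ∈ IsManifold.maximalAtlas (𝓡∂ (m + 1)) ∞ S)
  {x : EuclideanSpace ℝ (Fin (m + 1))} (hx : x ∈ (φ.extend (𝓡∂ (m + 1))).target)
include hφ hx

theorem contDiffAt_coeff {s : ℝ} (hs : s ∈ Ioo (-δ) δ) (a b : Fin (m + 1)) :
    ContDiffAt ℝ ∞ (fun t => g.coeff φ x t a b) s := by
  have h := g.contDiffOn_coeff hφ a b
  have h1 : ContDiffOn ℝ ∞ (fun t => g.coeff φ x t a b) (Ioo (-δ) δ) :=
    h.comp (f := fun t : ℝ => (x, t)) (contDiff_const.prodMk contDiff_id).contDiffOn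
      fun t ht => ⟨hx, ht⟩
  exact h1.contDiffAt (Ioo_mem_nhds hs.1 hs.2)

theorem areaDensity_eq {s : ℝ} (hs : s ∈ Ioo (-δ) δ) (p : Fin (m + 1) → ℝ) :
    g.areaDensity φ x s p =
      √(g.coeff φ x s).det * √(1 + ∑ a, ∑ b, (g.coeff φ x s)⁻¹ a b * p a * p b) := by
  have hdet := (g.coeff_posDef hφ hx hs).det_pos
  rw [areaDensity, Matrix.det_vecMulVec_add (isUnit_iff_ne_zero.2 hdet.ne'),
    Real.sqrt_mul hdet.le]

theorem quadForm_inv_nonneg {s : ℝ} (hs : s ∈ Ioo (-δ) δ) (p : Fin (m + 1) → ℝ) :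
    0 ≤ ∑ a, ∑ b, (g.coeff φ x s)⁻¹ a b * p a * p b := by
  have h := (g.coeff_posDef hφ hx hs).inv.posSemidef.dotProduct_mulVec_nonneg p
  refine h.trans_eq ?_
  simp only [star_trivial, dotProduct, Matrix.mulVec, Finset.mul_sum]
  refine Finset.sum_congr rfl fun a _ => Finset.sum_congr rfl fun b _ => ?_
  ring

/-- The Euler–Lagrange computation, by the product rule for √det g · √(1 + |p|²). Varying the height
in det g gives the trace term (Jacobi), varying it in g⁻¹ gives the ∂_s g⁻¹ term, and varying the
slope gives the flux. -/
theorem hasDerivAt_areaDensity {u : S → ℝ} (hu : localRep (𝓡∂ (m + 1)) φ u x ∈ Ioo (-δ) δ)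
    {s : ℝ → ℝ} {p : ℝ → Fin (m + 1) → ℝ} {t₀ s' : ℝ} {p' : Fin (m + 1) → ℝ}
    (hs : HasDerivAt s s' t₀) (hp : ∀ a, HasDerivAt (fun t => p t a) (p' a) t₀)
    (hs₀ : s t₀ = localRep (𝓡∂ (m + 1)) φ u x) (hp₀ : p t₀ = du φ u x) :
    HasDerivAt (fun t => g.areaDensity φ x (s t) (p t)) (g.areaVariation φ u x s' p') t₀ := by
  set σ := localRep (𝓡∂ (m + 1)) φ u x with hσ
  have hpd := g.coeff_posDef hφ hx hu
  have hdet := hpd.det_pos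
  have hq := g.quadForm_inv_nonneg hφ hx hu (du φ u x)
  have hdG : HasDerivAt (fun r => (g.coeff φ x r).det)
      ((g.coeff φ x σ).det * ((g.coeff φ x σ)⁻¹ * g.dsCoeff φ u x).trace) σ := by
    refine HasDerivAt.matrix_det (fun a b => ?_) hdet.ne'
    exact ((g.contDiffAt_coeff hφ hx hu a b).differentiableAt (by simp)).hasDerivAt
  have hdA : ∀ a b, HasDerivAt (fun r => (g.coeff φ x r)⁻¹ a b) (g.dsCoeffInv φ u x a b) σ := by
    intro a b
    have h1 : ContDiffWithinAt ℝ ∞ (fun r => (g.coeff φ x r)⁻¹ a b) univ σ :=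
      ContDiffWithinAt.matrix_inv
        (fun c d => contDiffWithinAt_univ.2 (g.contDiffAt_coeff hφ hx hu c d)) hdet.ne' a b
    exact ((contDiffWithinAt_univ.1 h1).differentiableAt (by simp)).hasDerivAt
  have hdet' := (HasDerivAt.scomp_of_eq t₀ hdG hs hs₀.symm).sqrt
    (by simpa [hs₀] using hdet.ne')
  have hq' : HasDerivAt (fun t => 1 + ∑ a, ∑ b, (g.coeff φ x (s t))⁻¹ a b * p t a * p t b)
      (∑ a, ∑ b, ((s' * g.dsCoeffInv φ u x a b * du φ u x a +
        (g.coeff φ x σ)⁻¹ a b * p' a) * du φ u x b +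
        (g.coeff φ x σ)⁻¹ a b * du φ u x a * p' b)) t₀ := by
    refine HasDerivAt.const_add _ (HasDerivAt.fun_sum fun a _ => HasDerivAt.fun_sum fun b _ => ?_)
    have h1 := ((HasDerivAt.scomp_of_eq t₀ (hdA a b) hs hs₀.symm).mul (hp a)).mul (hp b)
    refine (h1.congr_deriv ?_).congr_of_eventuallyEq (Filter.Eventually.of_forall fun t => rfl)
    simp [hs₀, hp₀]
  have hprod := hdet'.mul (hq'.sqrt (by rw [hs₀, hp₀]; positivity))
  have hev : (fun t => g.areaDensity φ x (s t) (p t)) =ᶠ[𝓝 t₀]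
      (fun t => √(g.coeff φ x (s t)).det *
        √(1 + ∑ a, ∑ b, (g.coeff φ x (s t))⁻¹ a b * p t a * p t b)) := by
    have : ∀ᶠ t in 𝓝 t₀, s t ∈ Ioo (-δ) δ :=
      hs.continuousAt.eventually (by rw [hs₀]; exact Ioo_mem_nhds hu.1 hu.2)
    filter_upwards [this] with t ht using g.areaDensity_eq hφ hx ht (p t)
  refine (hprod.congr_of_eventuallyEq hev).congr_deriv ?_
  have hsymm : ∀ a b, (g.coeff φ x σ)⁻¹ a b = (g.coeff φ x σ)⁻¹ b a := fun a b => by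
    have := hpd.inv.1.apply b a
    simpa using this
  -- By symmetry of g⁻¹ the two slope terms coincide; the resulting factor 2 cancels the ½ from
  -- differentiating the square root.
  have hsum : (∑ a, ∑ b, ((s' * g.dsCoeffInv φ u x a b * du φ u x a +
        (g.coeff φ x σ)⁻¹ a b * p' a) * du φ u x b +
        (g.coeff φ x σ)⁻¹ a b * du φ u x a * p' b)) =
      s' * (∑ a, ∑ b, g.dsCoeffInv φ u x a b * du φ u x a * du φ u x b) +
        2 * ∑ a, (∑ b, (g.coeff φ x σ)⁻¹ a b * du φ u x b) * p' a := by
    have h2 : ∑ a, ∑ b, (g.coeff φ x σ)⁻¹ a b * du φ u x a * p' b =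
        ∑ a, (∑ b, (g.coeff φ x σ)⁻¹ a b * du φ u x b) * p' a := by
      rw [Finset.sum_comm]
      refine Finset.sum_congr rfl fun a _ => ?_
      rw [Finset.sum_mul]
      exact Finset.sum_congr rfl fun b _ => by rw [hsymm b a]
    rw [two_mul]
    nth_rewrite 1 [← h2]
    simp only [add_mul, Finset.sum_add_distrib, Finset.mul_sum, Finset.sum_mul]
    have h3 : ∀ a b, s' * g.dsCoeffInv φ u x a b * du φ u x a * du φ u x b =
        s' * (g.dsCoeffInv φ u x a b * du φ u x a * du φ u x b) := fun a b => by ring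
    have h4 : ∀ a b, (g.coeff φ x σ)⁻¹ a b * p' a * du φ u x b =
        (g.coeff φ x σ)⁻¹ a b * du φ u x b * p' a := fun a b => by ring
    simp only [h3, h4]
    ring
  simp only [hs₀, hp₀, Function.comp, hsum, smul_eq_mul]
  have hD : √(g.coeff φ x σ).det ≠ 0 := (Real.sqrt_pos.2 hdet).ne'
  have hN : √(1 + ∑ a, ∑ b, (g.coeff φ x σ)⁻¹ a b * du φ u x a * du φ u x b) ≠ 0 :=
    (Real.sqrt_pos.2 (by positivity)).ne'
  have hD2 : √(g.coeff φ x σ).det ^ 2 = (g.coeff φ x σ).det := Real.sq_sqrt hdet.le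
  unfold areaVariation flux lowerOrder
  have hg : g.gradSq φ u x = ∑ a, ∑ b, (g.coeff φ x σ)⁻¹ a b * du φ u x a * du φ u x b := rfl
  have hc : g.coeffAt φ u x = g.coeff φ x σ := rfl
  rw [hc, hg]
  have hfl : ∀ (c : ℝ) (v : Fin (m + 1) → ℝ), ∑ a, c * v a * p' a = c * ∑ a, v a * p' a := by
    intro c v
    rw [Finset.mul_sum]
    exact Finset.sum_congr rfl fun a _ => mul_assoc _ _ _
  rw [hfl]
  set Z := ∑ a, (∑ b, (g.coeff φ x σ)⁻¹ a b * du φ u x b) * p' a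
  set W := ∑ a, ∑ b, g.dsCoeffInv φ u x a b * du φ u x a * du φ u x b
  set N := √(1 + ∑ a, ∑ b, (g.coeff φ x σ)⁻¹ a b * du φ u x a * du φ u x b)
  set D := √(g.coeff φ x σ).det
  rw [← hD2]
  field_simp
  ring

end FermiMetric
end Area

/-! ### Change of charts -/

section Transition

variable {m : ℕ} {S : Type*} [TopologicalSpace S] [ChartedSpace (EuclideanHalfSpace (m + 1)) S]
  [IsManifold (𝓡∂ (m + 1)) ∞ S] {δ : ℝ} (g : FermiMetric m S δ)
  {φ ψ : OpenPartialHomeomorph S (EuclideanHalfSpace (m + 1))}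

theorem ContinuousLinearMap.det_eq_det_matrix {n : ℕ}
    (T : EuclideanSpace ℝ (Fin n) →L[ℝ] EuclideanSpace ℝ (Fin n)) :
    T.det = (Matrix.of fun b a => T (EuclideanSpace.single a 1) b).det := by
  rw [ContinuousLinearMap.det, ← LinearMap.det_toMatrix (EuclideanSpace.basisFun (Fin n) ℝ).toBasis]
  rfl

/-- The derivative of the change of coordinates from `φ` to `ψ`. -/
def transitionDeriv (φ ψ : OpenPartialHomeomorph S (EuclideanHalfSpace (m + 1)))
    (x : EuclideanSpace ℝ (Fin (m + 1))) :
    EuclideanSpace ℝ (Fin (m + 1)) →L[ℝ] EuclideanSpace ℝ (Fin (m + 1)) :=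
  fderivWithin ℝ (ψ.extend (𝓡∂ (m + 1)) ∘ (φ.extend (𝓡∂ (m + 1))).symm) (range (𝓡∂ (m + 1))) x

variable (hφ : φ ∈ IsManifold.maximalAtlas (𝓡∂ (m + 1)) ∞ S)
  (hψ : ψ ∈ IsManifold.maximalAtlas (𝓡∂ (m + 1)) ∞ S)
  {x : EuclideanSpace ℝ (Fin (m + 1))} (hx : x ∈ (φ.extend (𝓡∂ (m + 1))).target)
  (hxψ : (φ.extend (𝓡∂ (m + 1))).symm x ∈ ψ.source)

include hxψ in
theorem extend_symm_extend_apply :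
    (ψ.extend (𝓡∂ (m + 1))).symm (ψ.extend (𝓡∂ (m + 1)) ((φ.extend (𝓡∂ (m + 1))).symm x)) =
      (φ.extend (𝓡∂ (m + 1))).symm x :=
  (ψ.extend (𝓡∂ (m + 1))).left_inv (by simpa using hxψ)

include hxψ in
theorem extend_apply_mem_target :
    ψ.extend (𝓡∂ (m + 1)) ((φ.extend (𝓡∂ (m + 1))).symm x) ∈ (ψ.extend (𝓡∂ (m + 1))).target :=
  (ψ.extend (𝓡∂ (m + 1))).map_source (by simpa using hxψ)

include hφ hψ hx hxψ in
theorem transitionDeriv_apply (v : EuclideanSpace ℝ (Fin (m + 1))) :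
    transitionDeriv φ ψ x v = mfderiv (𝓡∂ (m + 1)) 𝓘(ℝ, EuclideanSpace ℝ (Fin (m + 1)))
      (ψ.extend (𝓡∂ (m + 1))) ((φ.extend (𝓡∂ (m + 1))).symm x)
      (mfderivWithin 𝓘(ℝ, EuclideanSpace ℝ (Fin (m + 1))) (𝓡∂ (m + 1))
        (φ.extend (𝓡∂ (m + 1))).symm (range (𝓡∂ (m + 1))) x v) := by
  have h := mfderivWithin_comp_extend_symm hφ hx (mdifferentiableAt_extend hψ hxψ)
  rw [mfderivWithin_eq_fderivWithin] at h
  exact congrArg (fun T => T v) h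

include hφ hψ hx hxψ in
theorem differentiableWithinAt_transition :
    DifferentiableWithinAt ℝ (ψ.extend (𝓡∂ (m + 1)) ∘ (φ.extend (𝓡∂ (m + 1))).symm)
      (range (𝓡∂ (m + 1))) x := by
  rw [← mdifferentiableWithinAt_iff_differentiableWithinAt]
  exact (mdifferentiableAt_extend hψ hxψ).comp_mdifferentiableWithinAt _
    (mdifferentiableWithinAt_extend_symm hφ hx)

/-- The coordinate vector `coordVec φ x a`, as an element of the model vector space. -/
def modelCoordVec (φ : OpenPartialHomeomorph S (EuclideanHalfSpace (m + 1)))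
    (x : EuclideanSpace ℝ (Fin (m + 1))) (a : Fin (m + 1)) : EuclideanSpace ℝ (Fin (m + 1)) :=
  coordVec φ x a

include hφ hψ hx hxψ in
/-- The transformation law of coordinate vectors. -/
theorem coordVec_transition (a : Fin (m + 1)) :
    modelCoordVec φ x a =
      ∑ b, (transitionDeriv φ ψ x (EuclideanSpace.single a 1)) b •
        modelCoordVec ψ (ψ.extend (𝓡∂ (m + 1)) ((φ.extend (𝓡∂ (m + 1))).symm x)) b := by
  have h1 := mfderivWithin_symm_mfderiv_extend hψ (extend_apply_mem_target hxψ) (coordVec φ x a)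
  have h2 := FermiMetric.sum_smul_coordVec ψ
    (ψ.extend (𝓡∂ (m + 1)) ((φ.extend (𝓡∂ (m + 1))).symm x))
    (transitionDeriv φ ψ x (EuclideanSpace.single a 1))
  refine Eq.trans ?_ h2.symm
  refine h1.symm.trans ?_
  rw [transitionDeriv_apply hφ hψ hx hxψ]
  -- The two base points are equal but not definitionally so, hence their tangent spaces are
  -- different types. Everything is expressed in the model space, with the base point as a variable,
  -- so that the equality of points can be substituted.
  let D : S → EuclideanSpace ℝ (Fin (m + 1)) → EuclideanSpace ℝ (Fin (m + 1)) := fun q =>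
    mfderiv (𝓡∂ (m + 1)) 𝓘(ℝ, EuclideanSpace ℝ (Fin (m + 1))) (ψ.extend (𝓡∂ (m + 1))) q
  let F : EuclideanSpace ℝ (Fin (m + 1)) → EuclideanSpace ℝ (Fin (m + 1)) :=
    mfderivWithin 𝓘(ℝ, EuclideanSpace ℝ (Fin (m + 1))) (𝓡∂ (m + 1))
      (ψ.extend (𝓡∂ (m + 1))).symm (range (𝓡∂ (m + 1)))
      (ψ.extend (𝓡∂ (m + 1)) ((φ.extend (𝓡∂ (m + 1))).symm x))
  exact congrArg (fun q => F (D q (modelCoordVec φ x a))) (extend_symm_extend_apply hxψ)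

namespace FermiMetric

include hφ hψ hx hxψ in
theorem du_transition {u : S → ℝ}
    (hu : MDifferentiableAt (𝓡∂ (m + 1)) 𝓘(ℝ, ℝ) u ((φ.extend (𝓡∂ (m + 1))).symm x))
    (a : Fin (m + 1)) :
    du φ u x a = ∑ b, (transitionDeriv φ ψ x (EuclideanSpace.single a 1)) b *
      du ψ u (ψ.extend (𝓡∂ (m + 1)) ((φ.extend (𝓡∂ (m + 1))).symm x)) b := by
  have hq := extend_symm_extend_apply hxψ
  rw [du_eq hφ hx hu]
  have h1 := coordVec_transition hφ hψ hx hxψ a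
  let L : EuclideanSpace ℝ (Fin (m + 1)) →L[ℝ] ℝ :=
    mfderiv (𝓡∂ (m + 1)) 𝓘(ℝ, ℝ) u ((φ.extend (𝓡∂ (m + 1))).symm x)
  change L (modelCoordVec φ x a) = _
  rw [h1, map_sum]
  refine Finset.sum_congr rfl fun b _ => ?_
  rw [du_eq hψ (extend_apply_mem_target hxψ) (by rwa [hq]), map_smul]
  let D : S → EuclideanSpace ℝ (Fin (m + 1)) → ℝ := fun q => mfderiv (𝓡∂ (m + 1)) 𝓘(ℝ, ℝ) u q
  exact congrArg (fun q => (transitionDeriv φ ψ x (EuclideanSpace.single a 1)) b * D q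
    (modelCoordVec ψ (ψ.extend (𝓡∂ (m + 1)) ((φ.extend (𝓡∂ (m + 1))).symm x)) b)) hq.symm

include hφ hψ hx hxψ in
theorem coeff_transition (s : ℝ) :
    g.coeff φ x s =
      (Matrix.of fun b a => transitionDeriv φ ψ x (EuclideanSpace.single a 1) b).transpose *
        g.coeff ψ (ψ.extend (𝓡∂ (m + 1)) ((φ.extend (𝓡∂ (m + 1))).symm x)) s *
        Matrix.of fun b a => transitionDeriv φ ψ x (EuclideanSpace.single a 1) b := by
  ext a b
  have h1 := coordVec_transition hφ hψ hx hxψ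
  have h2 := g.val_sum_coordVec ψ (ψ.extend (𝓡∂ (m + 1)) ((φ.extend (𝓡∂ (m + 1))).symm x)) s
    (fun c => transitionDeriv φ ψ x (EuclideanSpace.single a 1) c)
    (fun c => transitionDeriv φ ψ x (EuclideanSpace.single b 1) c)
  let D : S → EuclideanSpace ℝ (Fin (m + 1)) → EuclideanSpace ℝ (Fin (m + 1)) → ℝ :=
    fun q v w => g.val s q v w
  have h4 : g.coeff φ x s a b = D ((ψ.extend (𝓡∂ (m + 1))).symm (ψ.extend (𝓡∂ (m + 1))
      ((φ.extend (𝓡∂ (m + 1))).symm x))) (modelCoordVec φ x a) (modelCoordVec φ x b) :=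
    congrArg (fun q => D q (modelCoordVec φ x a) (modelCoordVec φ x b))
      (extend_symm_extend_apply hxψ).symm
  rw [h4, h1 a, h1 b]
  refine h2.trans ?_
  simp only [dotProduct, Matrix.mulVec, Matrix.mul_apply, Matrix.transpose_apply, Matrix.of_apply,
    Finset.mul_sum, Finset.sum_mul]
  rw [Finset.sum_comm]
  exact Finset.sum_congr rfl fun c _ => Finset.sum_congr rfl fun d _ => by ring

include hφ hψ hx hxψ in
/-- The area density transforms as a density under changes of charts. -/
theorem areaDensity_transition (s : ℝ) (q : Fin (m + 1) → ℝ) :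
    g.areaDensity φ x s (fun a => ∑ b, transitionDeriv φ ψ x (EuclideanSpace.single a 1) b * q b) =
      |(transitionDeriv φ ψ x).det| *
        g.areaDensity ψ (ψ.extend (𝓡∂ (m + 1)) ((φ.extend (𝓡∂ (m + 1))).symm x)) s q := by
  set J : Matrix (Fin (m + 1)) (Fin (m + 1)) ℝ :=
    Matrix.of fun b a => transitionDeriv φ ψ x (EuclideanSpace.single a 1) b with hJ
  have h : (Matrix.of fun a b => (∑ c, transitionDeriv φ ψ x (EuclideanSpace.single a 1) c * q c) *
      (∑ c, transitionDeriv φ ψ x (EuclideanSpace.single b 1) c * q c) + g.coeff φ x s a b) =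
      J.transpose * (Matrix.of fun a b => q a * q b +
        g.coeff ψ (ψ.extend (𝓡∂ (m + 1)) ((φ.extend (𝓡∂ (m + 1))).symm x)) s a b) * J := by
    have h1 : (Matrix.of fun a b => q a * q b +
        g.coeff ψ (ψ.extend (𝓡∂ (m + 1)) ((φ.extend (𝓡∂ (m + 1))).symm x)) s a b) =
        Matrix.vecMulVec q q +
        g.coeff ψ (ψ.extend (𝓡∂ (m + 1)) ((φ.extend (𝓡∂ (m + 1))).symm x)) s := by
      ext a b; rfl
    rw [h1, Matrix.mul_add, Matrix.add_mul, ← g.coeff_transition hφ hψ hx hxψ s]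
    ext a b
    simp only [Matrix.of_apply, Matrix.add_apply, Matrix.mul_apply, Matrix.transpose_apply,
      Matrix.vecMulVec_apply, hJ, Finset.sum_mul, Finset.mul_sum]
    congr 1
    exact Finset.sum_congr rfl fun c _ => Finset.sum_congr rfl fun d _ => by ring
  rw [areaDensity, h, Matrix.det_mul, Matrix.det_mul, Matrix.det_transpose, mul_right_comm, ← sq,
    Real.sqrt_mul (sq_nonneg _), Real.sqrt_sq_eq_abs, ContinuousLinearMap.det_eq_det_matrix]
  rfl

/-- The variation of the area density at `u` in the direction of a function. -/
def areaVar (φ : OpenPartialHomeomorph S (EuclideanHalfSpace (m + 1))) (u v : S → ℝ)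
    (x : EuclideanSpace ℝ (Fin (m + 1))) : ℝ :=
  g.areaVariation φ u x (localRep (𝓡∂ (m + 1)) φ v x) (du φ v x)

include hφ hψ hx hxψ in
-- Nothing is recomputed: the transformation law of the density is differentiated along t ↦ u + t v,
-- and the derivative is unique.
theorem areaVar_transition {u v : S → ℝ}
    (hu : MDifferentiableAt (𝓡∂ (m + 1)) 𝓘(ℝ, ℝ) u ((φ.extend (𝓡∂ (m + 1))).symm x))
    (hv : MDifferentiableAt (𝓡∂ (m + 1)) 𝓘(ℝ, ℝ) v ((φ.extend (𝓡∂ (m + 1))).symm x))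
    (huδ : u ((φ.extend (𝓡∂ (m + 1))).symm x) ∈ Ioo (-δ) δ) :
    g.areaVar φ u v x = |(transitionDeriv φ ψ x).det| *
      g.areaVar ψ u v (ψ.extend (𝓡∂ (m + 1)) ((φ.extend (𝓡∂ (m + 1))).symm x)) := by
  set y := ψ.extend (𝓡∂ (m + 1)) ((φ.extend (𝓡∂ (m + 1))).symm x) with hy
  have hys : (ψ.extend (𝓡∂ (m + 1))).symm y = (φ.extend (𝓡∂ (m + 1))).symm x :=
    extend_symm_extend_apply hxψ
  have hloc : ∀ f : S → ℝ, localRep (𝓡∂ (m + 1)) ψ f y = localRep (𝓡∂ (m + 1)) φ f x :=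
    fun f => congrArg f hys
  have hlin : ∀ c c' : ℝ, HasDerivAt (fun t : ℝ => c + t * c') c' 0 := fun c c' => by
    simpa using ((hasDerivAt_id (0 : ℝ)).mul_const c').const_add c
  have h1 := g.hasDerivAt_areaDensity hφ hx (u := u) huδ
    (hlin (localRep (𝓡∂ (m + 1)) φ u x) (localRep (𝓡∂ (m + 1)) φ v x))
    (p := fun t a => du φ u x a + t * du φ v x a) (fun a => hlin (du φ u x a) (du φ v x a))
    (by simp) (by simp)
  have h2 := g.hasDerivAt_areaDensity hψ (extend_apply_mem_target hxψ) (u := u)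
    (by rw [← hy, hloc]; exact huδ)
    (hlin (localRep (𝓡∂ (m + 1)) ψ u y) (localRep (𝓡∂ (m + 1)) ψ v y))
    (p := fun t a => du ψ u y a + t * du ψ v y a) (fun a => hlin (du ψ u y a) (du ψ v y a))
    (by simp [hy]) (by simp [hy])
  refine h1.unique ((h2.const_mul |(transitionDeriv φ ψ x).det|).congr_of_eventuallyEq
    (Filter.Eventually.of_forall fun t => ?_))
  have h3 := g.areaDensity_transition hφ hψ hx hxψ
    (localRep (𝓡∂ (m + 1)) φ u x + t * localRep (𝓡∂ (m + 1)) φ v x)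
    (fun a => du ψ u y a + t * du ψ v y a)
  simp only [hloc]
  rw [← hy] at h3 ⊢
  rw [← h3]
  congr 1
  funext a
  rw [du_transition hφ hψ hx hxψ hu, du_transition hφ hψ hx hxψ hv, Finset.mul_sum,
    ← Finset.sum_add_distrib]
  exact Finset.sum_congr rfl fun b _ => by ring

end FermiMetric
end Transition

/-! ### The measurable partition attached to a chart cover -/

section Pieces

variable {E : Type*} [NormedAddCommGroup E] [NormedSpace ℝ E]
  {H : Type*} [TopologicalSpace H] {I : ModelWithCorners ℝ E H}
  {M : Type*} [TopologicalSpace M] [ChartedSpace H M]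

namespace ChartCover

variable (A : ChartCover I M)

/-- The disjoint pieces `K_i \ ⋃_{j < i} K_j`. -/
def piece (i : Fin A.N) : Set M := A.K i \ ⋃ j : Fin A.N, ⋃ _ : j < i, A.K j

theorem piece_subset_source (i : Fin A.N) : A.piece i ⊆ (A.chart i).source :=
  sdiff_subset.trans (A.K_subset i)

/-- The least index i with p ∈ K_i works. With `disjoint_piece` this says that the pieces partition
the manifold. -/
theorem exists_mem_piece (p : M) : ∃ i, p ∈ A.piece i := by
  have hp : p ∈ ⋃ i, interior (A.K i) := A.cover ▸ mem_univ p
  obtain ⟨i, hi⟩ := mem_iUnion.1 hp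
  have hne : {i | p ∈ A.K i}.Nonempty := ⟨i, interior_subset (s := A.K i) hi⟩
  refine ⟨wellFounded_lt.min _ hne, wellFounded_lt.min_mem _ hne, ?_⟩
  simp only [mem_iUnion, not_exists]
  intro j hj hpj
  exact wellFounded_lt.not_lt_min {i | p ∈ A.K i} hpj hj

theorem disjoint_piece {i j : Fin A.N} (hij : i ≠ j) : Disjoint (A.piece i) (A.piece j) := by
  rcases lt_or_gt_of_ne hij with h | h
  · exact disjoint_left.2 fun p hp hq => hq.2 (mem_iUnion₂.2 ⟨i, h, hp.1⟩)
  · exact disjoint_left.2 fun p hp hq => hp.2 (mem_iUnion₂.2 ⟨j, h, hq.1⟩)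

theorem isCompact_image_K (i : Fin A.N) : IsCompact ((A.chart i).extend I '' A.K i) :=
  (A.isCompact_K i).image_of_continuousOn
    (((A.chart i).continuousOn_extend).mono (by simpa using A.K_subset i))

theorem image_piece_subset_target (i : Fin A.N) :
    (A.chart i).extend I '' A.piece i ⊆ ((A.chart i).extend I).target := by
  rintro _ ⟨p, hp, rfl⟩
  exact ((A.chart i).extend I).map_source (by simpa using A.piece_subset_source i hp)

theorem image_K_subset_target (i : Fin A.N) :
    (A.chart i).extend I '' A.K i ⊆ ((A.chart i).extend I).target := by
  rintro _ ⟨p, hp, rfl⟩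
  exact ((A.chart i).extend I).map_source (by simpa using A.K_subset i hp)

/-- The chart is injective on K_i, so the image of a piece is a difference of two compact sets. -/
theorem measurableSet_image_piece [MeasurableSpace E] [BorelSpace E] [T2Space M] (i : Fin A.N) :
    MeasurableSet ((A.chart i).extend I '' A.piece i) := by
  have hU : IsClosed (⋃ j : Fin A.N, ⋃ _ : j < i, A.K j) :=
    isClosed_iUnion_of_finite fun j => isClosed_iUnion_of_finite fun _ => (A.isCompact_K j).isClosed
  have h1 : A.piece i = A.K i \ (A.K i ∩ ⋃ j : Fin A.N, ⋃ _ : j < i, A.K j) := by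
    rw [piece, sdiff_self_inter]
  have hinj : InjOn ((A.chart i).extend I) (A.K i) :=
    ((A.chart i).extend I).injOn.mono (by simpa using A.K_subset i)
  rw [h1, hinj.image_sdiff_subset inter_subset_left]
  have h2 : IsCompact ((A.chart i).extend I '' (A.K i ∩ ⋃ j : Fin A.N, ⋃ _ : j < i, A.K j)) :=
    ((A.isCompact_K i).inter_right hU).image_of_continuousOn
      (((A.chart i).continuousOn_extend).mono
        (inter_subset_left.trans (by simpa using A.K_subset i)))
  exact (A.isCompact_image_K i).isClosed.measurableSet.diff h2.isClosed.measurableSet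

end ChartCover

/-- At the boundary such a set need not be open; it is the intersection of an open set with the
closed range of the model. -/
theorem measurableSet_extend_target_inter [MeasurableSpace E] [BorelSpace E]
    (φ : OpenPartialHomeomorph M H) {U : Set M} (hU : IsOpen U) :
    MeasurableSet ((φ.extend I).target ∩ (φ.extend I).symm ⁻¹' U) := by
  have h : (φ.extend I).target ∩ (φ.extend I).symm ⁻¹' U =
      I.symm ⁻¹' (φ.target ∩ φ.symm ⁻¹' U) ∩ range I := by
    rw [φ.extend_target]
    ext x
    simp only [mem_inter_iff, mem_preimage, φ.extend_coe_symm, Function.comp]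
    tauto
  rw [h]
  exact ((φ.isOpen_inter_preimage_symm hU).preimage I.continuous_symm).measurableSet.inter
    I.isClosed_range.measurableSet

theorem measurableSet_extend_target [MeasurableSpace E] [BorelSpace E]
    (φ : OpenPartialHomeomorph M H) : MeasurableSet (φ.extend I).target := by
  simpa using measurableSet_extend_target_inter (I := I) φ isOpen_univ

end Pieces

/-! ### Integrating a density supported in one chart -/

section Integration

open MeasureTheory

variable {m : ℕ} {S : Type*} [TopologicalSpace S] [ChartedSpace (EuclideanHalfSpace (m + 1)) S]
  [IsManifold (𝓡∂ (m + 1)) ∞ S] [T2Space S]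

/-- A density which is supported in the domain of one chart can be integrated in this chart. -/
theorem sum_setIntegral_piece_eq (A : ChartCover (𝓡∂ (m + 1)) S)
    {ψ : OpenPartialHomeomorph S (EuclideanHalfSpace (m + 1))}
    (hψ : ψ ∈ IsManifold.maximalAtlas (𝓡∂ (m + 1)) ∞ S)
    {ρ : Fin A.N → EuclideanSpace ℝ (Fin (m + 1)) → ℝ} {f : EuclideanSpace ℝ (Fin (m + 1)) → ℝ}
    (hcov : ∀ i, ∀ x ∈ ((A.chart i).extend (𝓡∂ (m + 1))).target,
      ((A.chart i).extend (𝓡∂ (m + 1))).symm x ∈ ψ.source →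
      ρ i x = |(transitionDeriv (A.chart i) ψ x).det| *
        f (ψ.extend (𝓡∂ (m + 1)) (((A.chart i).extend (𝓡∂ (m + 1))).symm x)))
    (hzero : ∀ i, ∀ x ∈ ((A.chart i).extend (𝓡∂ (m + 1))).target,
      ((A.chart i).extend (𝓡∂ (m + 1))).symm x ∉ ψ.source → ρ i x = 0)
    (hf : IntegrableOn f (ψ.extend (𝓡∂ (m + 1))).target) :
    ∑ i, ∫ x in (A.chart i).extend (𝓡∂ (m + 1)) '' A.piece i, ρ i x =
      ∫ y in (ψ.extend (𝓡∂ (m + 1))).target, f y := by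
  -- The part of the i-th piece, in its own coordinates, that lies in the domain of ψ. Off it ρ i
  -- vanishes.
  set D : Fin A.N → Set (EuclideanSpace ℝ (Fin (m + 1))) := fun i =>
    ((A.chart i).extend (𝓡∂ (m + 1)) '' A.piece i) ∩
      (((A.chart i).extend (𝓡∂ (m + 1))).target ∩ ((A.chart i).extend (𝓡∂ (m + 1))).symm ⁻¹' ψ.source) with hD
  have hDm : ∀ i, MeasurableSet (D i) := fun i =>
    (A.measurableSet_image_piece i).inter (measurableSet_extend_target_inter _ ψ.open_source)
  have hmemD : ∀ i, ∀ x ∈ D i, ∃ p ∈ A.piece i, p ∈ ψ.source ∧ (A.chart i).extend (𝓡∂ (m + 1)) p = x ∧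
      ((A.chart i).extend (𝓡∂ (m + 1))).symm x = p := by
    rintro i _ ⟨⟨p, hp, rfl⟩, -, hp2⟩
    have : ((A.chart i).extend (𝓡∂ (m + 1))).symm ((A.chart i).extend (𝓡∂ (m + 1)) p) = p :=
      ((A.chart i).extend (𝓡∂ (m + 1))).left_inv (by simpa using A.piece_subset_source i hp)
    exact ⟨p, hp, by rw [mem_preimage, this] at hp2; exact hp2, rfl, this⟩
  have himage : ∀ i, (ψ.extend (𝓡∂ (m + 1)) ∘ ((A.chart i).extend (𝓡∂ (m + 1))).symm) '' D i =
      ψ.extend (𝓡∂ (m + 1)) '' (A.piece i ∩ ψ.source) := by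
    intro i
    ext y
    constructor
    · rintro ⟨x, hx, rfl⟩
      obtain ⟨p, hp, hpψ, -, h2⟩ := hmemD i x hx
      exact ⟨p, ⟨hp, hpψ⟩, by rw [Function.comp, h2]⟩
    · rintro ⟨p, ⟨hp, hpψ⟩, rfl⟩
      have h2 : ((A.chart i).extend (𝓡∂ (m + 1))).symm ((A.chart i).extend (𝓡∂ (m + 1)) p) = p :=
        ((A.chart i).extend (𝓡∂ (m + 1))).left_inv (by simpa using A.piece_subset_source i hp)
      refine ⟨(A.chart i).extend (𝓡∂ (m + 1)) p, ⟨⟨p, hp, rfl⟩, A.image_piece_subset_target i ⟨p, hp, rfl⟩,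
        by rw [mem_preimage, h2]; exact hpψ⟩, ?_⟩
      simp only [Function.comp, h2]
  have hinj : ∀ i, InjOn (ψ.extend (𝓡∂ (m + 1)) ∘ ((A.chart i).extend (𝓡∂ (m + 1))).symm) (D i) := by
    intro i x hx x' hx' hxx
    obtain ⟨p, hp, hpψ, h1, h2⟩ := hmemD i x hx
    obtain ⟨p', hp', hpψ', h1', h2'⟩ := hmemD i x' hx'
    simp only [Function.comp, h2, h2'] at hxx
    rw [← h1, ← h1', (ψ.extend (𝓡∂ (m + 1))).injOn (by simpa using hpψ) (by simpa using hpψ') hxx]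
  have hstep : ∀ i, ∫ x in (A.chart i).extend (𝓡∂ (m + 1)) '' A.piece i, ρ i x =
      ∫ y in ψ.extend (𝓡∂ (m + 1)) '' (A.piece i ∩ ψ.source), f y := by
    intro i
    have h1 : ∫ x in (A.chart i).extend (𝓡∂ (m + 1)) '' A.piece i, ρ i x = ∫ x in D i, ρ i x := by
      refine setIntegral_eq_of_subset_of_forall_sdiff_eq_zero (A.measurableSet_image_piece i)
        inter_subset_left ?_
      rintro x ⟨hx, hxD⟩
      have hxt := A.image_piece_subset_target i hx
      exact hzero i x hxt fun h => hxD ⟨hx, hxt, h⟩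
    -- The change of variables only needs a derivative within the set of integration, so the
    -- one-sided derivative at boundary points suffices.
    rw [h1, ← himage i, integral_image_eq_integral_abs_det_fderiv_smul volume (hDm i)
      (f' := fun x => transitionDeriv (A.chart i) ψ x) ?_ (hinj i)]
    · refine setIntegral_congr_fun (hDm i) fun x hx => ?_
      exact hcov i x hx.2.1 hx.2.2
    · intro x hx
      exact ((differentiableWithinAt_transition (A.chart_mem i) hψ hx.2.1
        hx.2.2).hasFDerivWithinAt).mono
        (inter_subset_right.trans (inter_subset_left.trans (extend_target_subset_range _)))
  rw [Finset.sum_congr rfl fun i _ => hstep i]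
  -- The pieces partition S, so their images under ψ partition the target of ψ.
  have hunion : (ψ.extend (𝓡∂ (m + 1))).target = ⋃ i, ψ.extend (𝓡∂ (m + 1)) '' (A.piece i ∩ ψ.source) := by
    ext y
    rw [mem_iUnion]
    constructor
    · intro hy
      obtain ⟨i, hi⟩ := A.exists_mem_piece ((ψ.extend (𝓡∂ (m + 1))).symm y)
      exact ⟨i, _, ⟨hi, extend_symm_mem_source hy⟩, (ψ.extend (𝓡∂ (m + 1))).right_inv hy⟩
    · rintro ⟨i, p, ⟨-, hp⟩, rfl⟩
      exact (ψ.extend (𝓡∂ (m + 1))).map_source (by simpa using hp)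
  have hsub : ∀ i, ψ.extend (𝓡∂ (m + 1)) '' (A.piece i ∩ ψ.source) ⊆ (ψ.extend (𝓡∂ (m + 1))).target := fun i => by
    rw [hunion]; exact subset_iUnion (fun i => ψ.extend (𝓡∂ (m + 1)) '' (A.piece i ∩ ψ.source)) i
  rw [hunion, integral_iUnion_fintype]
  · intro i
    rw [← himage i]
    exact (hDm i).image_of_continuousOn_injOn (fun x hx => by
      have := (differentiableWithinAt_transition (A.chart_mem i) hψ hx.2.1
        hx.2.2).continuousWithinAt
      exact this.mono
        (inter_subset_right.trans (inter_subset_left.trans (extend_target_subset_range _))))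
      (hinj i)
  · intro i j hij
    refine disjoint_left.2 ?_
    rintro _ ⟨p, ⟨hp, hpψ⟩, rfl⟩ ⟨p', ⟨hp', hpψ'⟩, h⟩
    have : p' = p := (ψ.extend (𝓡∂ (m + 1))).injOn (by simpa using hpψ') (by simpa using hpψ) h
    exact disjoint_left.1 (A.disjoint_piece hij) hp (this ▸ hp')
  · intro i
    exact hf.mono_set (hsub i)

end Integration

/-! ### The divergence theorem on the half-space -/

section Divergence

open MeasureTheory

variable {m : ℕ}

/-- The point of the boundary of the half-space with tangential coordinates `y`. -/
def halfSpaceBoundary (y : EuclideanSpace ℝ (Fin m)) : EuclideanSpace ℝ (Fin (m + 1)) :=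
  WithLp.toLp 2 (Fin.cons 0 (WithLp.ofLp y))

theorem partialDeriv_eq_zero_of_notMem {K : Set (EuclideanSpace ℝ (Fin (m + 1)))}
    (hK : IsClosed K) {F : EuclideanSpace ℝ (Fin (m + 1)) → ℝ} (h0 : ∀ x ∉ K, F x = 0)
    {x : EuclideanSpace ℝ (Fin (m + 1))} (hx : x ∉ K) (a : Fin (m + 1)) :
    partialDeriv a F x = 0 := by
  have h1 : F =ᶠ[𝓝 x] fun _ => 0 := by
    filter_upwards [hK.isOpen_compl.mem_nhds hx] with y hy using h0 y hy
  have h2 : fderivWithin ℝ F (range (𝓡∂ (m + 1))) x =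
      fderivWithin ℝ (fun _ => (0 : ℝ)) (range (𝓡∂ (m + 1))) x :=
    (h1.filter_mono nhdsWithin_le_nhds).fderivWithin_eq h1.self_of_nhds
  rw [partialDeriv, h2]
  simp

theorem mem_range_halfSpace {x : EuclideanSpace ℝ (Fin (m + 1))} :
    x ∈ range (𝓡∂ (m + 1)) ↔ 0 ≤ x 0 := by
  rw [range_modelWithCornersEuclideanHalfSpace]; rfl

theorem mem_interior_range_halfSpace {x : EuclideanSpace ℝ (Fin (m + 1))} :
    x ∈ interior (range (𝓡∂ (m + 1))) ↔ 0 < x 0 := by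
  rw [interior_range_modelWithCornersEuclideanHalfSpace]; rfl

theorem setIntegral_toLp {n : ℕ} (T : Set (EuclideanSpace ℝ (Fin n)))
    (f : EuclideanSpace ℝ (Fin n) → ℝ) :
    ∫ z in WithLp.toLp 2 ⁻¹' T, f (WithLp.toLp 2 z) = ∫ x in T, f x :=
  (PiLp.volume_preserving_toLp (Fin n)).setIntegral_preimage_emb
    (MeasurableEquiv.toLp 2 (Fin n → ℝ)).measurableEmbedding f T

theorem integral_toLp {n : ℕ} (f : EuclideanSpace ℝ (Fin n) → ℝ) :
    ∫ z, f (WithLp.toLp 2 z) = ∫ x, f x := by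
  simpa using setIntegral_toLp univ f

/-- The divergence theorem on the closed half-space, for compactly supported vector fields. -/
theorem integral_divergence_halfSpace {F : Fin (m + 1) → EuclideanSpace ℝ (Fin (m + 1)) → ℝ}
    {K : Set (EuclideanSpace ℝ (Fin (m + 1)))} (hK : IsCompact K)
    (hF : ∀ a, ContDiffOn ℝ 1 (F a) (range (𝓡∂ (m + 1)))) (h0 : ∀ a, ∀ x ∉ K, F a x = 0) :
    ∫ x in range (𝓡∂ (m + 1)), ∑ a, partialDeriv a (F a) x =
      -∫ y : EuclideanSpace ℝ (Fin m), F 0 (halfSpaceBoundary y) := by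
  obtain ⟨R, hR⟩ : ∃ R : ℝ, 0 < R ∧ ∀ x ∈ K, ‖x‖ < R := by
    obtain ⟨R, hR⟩ := hK.isBounded.exists_norm_le
    exact ⟨max R 0 + 1, by positivity, fun x hx => (hR x hx).trans_lt
      ((le_max_left _ _).trans_lt (lt_add_one _))⟩
  have hcoord : ∀ z : Fin (m + 1) → ℝ, WithLp.toLp 2 z ∈ K → ∀ i, |z i| < R := fun z hz i =>
    (PiLp.norm_apply_le (WithLp.toLp 2 z) i).trans_lt (hR.2 _ hz)
  -- The box [0, R] × [-R, R]^m: of all its faces only x₀ = 0 can meet the support K, whose points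
  -- have norm less than R.
  let a : Fin (m + 1) → ℝ := Fin.cons 0 fun _ => -R
  let b : Fin (m + 1) → ℝ := fun _ => R
  have hab : a ≤ b := by
    intro i
    refine Fin.cases ?_ (fun j => ?_) i
    · exact hR.1.le
    · change -R ≤ R
      linarith [hR.1]
  let L : (Fin (m + 1) → ℝ) →L[ℝ] EuclideanSpace ℝ (Fin (m + 1)) :=
    (PiLp.continuousLinearEquiv 2 ℝ (fun _ : Fin (m + 1) => ℝ)).symm
  have hL : ∀ z, L z = WithLp.toLp 2 z := fun _ => rfl
  have hmaps : MapsTo (fun z : Fin (m + 1) → ℝ => WithLp.toLp 2 z) (Icc a b)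
      (range (𝓡∂ (m + 1))) := by
    intro z hz
    rw [mem_range_halfSpace]
    exact hz.1 0
  have hdivc : ContinuousOn (fun x => ∑ a, partialDeriv a (F a) x) (range (𝓡∂ (m + 1))) :=
    continuousOn_finsetSum _ fun a _ =>
      ((hF a).continuousOn_fderivWithin (𝓡∂ (m + 1)).uniqueDiffOn le_rfl).clm_apply
        continuousOn_const
  -- In the open box x₀ > 0, so the one-sided derivative is the full derivative and the exceptional
  -- set is empty.
  have hmain := integral_divergence_of_hasFDerivAt_off_countable' a b hab
    (fun i z => F i (WithLp.toLp 2 z))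
    (fun i z => (fderivWithin ℝ (F i) (range (𝓡∂ (m + 1))) (WithLp.toLp 2 z)).comp L) ∅
    countable_empty (fun i => (hF i).continuousOn.comp L.continuous.continuousOn hmaps)
    (by
      intro z hz i
      have hz0 : WithLp.toLp 2 z ∈ interior (range (𝓡∂ (m + 1))) := by
        rw [mem_interior_range_halfSpace]
        exact (hz.1 0 (mem_univ _)).1
      have hn := mem_interior_iff_mem_nhds.1 hz0
      have hd := (((hF i).differentiableOn (by simp)).differentiableAt hn).hasFDerivAt
      rw [← fderivWithin_of_mem_nhds hn] at hd
      exact HasFDerivAt.comp z hd L.hasFDerivAt)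
    (by
      have : ContinuousOn (fun z : Fin (m + 1) → ℝ =>
          ∑ a, partialDeriv a (F a) (WithLp.toLp 2 z)) (Icc a b) :=
        hdivc.comp L.continuous.continuousOn hmaps
      exact this.integrableOn_compact isCompact_Icc)
  have hlhs : ∫ x in range (𝓡∂ (m + 1)), ∑ a, partialDeriv a (F a) x =
      ∫ z in Icc a b, ∑ i, (fderivWithin ℝ (F i) (range (𝓡∂ (m + 1)))
        (WithLp.toLp 2 z)).comp L (Pi.single i 1) := by
    rw [← setIntegral_toLp]
    refine setIntegral_eq_of_subset_of_forall_sdiff_eq_zero ?_ hmaps ?_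
    · exact (𝓡∂ (m + 1)).isClosed_range.measurableSet.preimage L.continuous.measurable
    · rintro z ⟨hz, hzI⟩
      refine Finset.sum_eq_zero fun i _ => ?_
      refine partialDeriv_eq_zero_of_notMem hK.isClosed (h0 i) (fun hzK => hzI ?_) i
      have hc := hcoord z hzK
      refine ⟨fun i => ?_, fun i => (abs_lt.1 (hc i)).2.le⟩
      refine Fin.cases ?_ (fun j => ?_) i
      · exact mem_range_halfSpace.1 hz
      · exact (abs_lt.1 (hc _)).1.le
  rw [hlhs, hmain]
  have hfront : ∀ i : Fin (m + 1), ∀ y : Fin m → ℝ,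
      F i (WithLp.toLp 2 (i.insertNth (b i) y)) = 0 := by
    intro i y
    refine h0 i _ fun h => ?_
    have := hcoord _ h i
    simp [b, abs_of_pos hR.1] at this
  have hback : ∀ j : Fin m, ∀ y : Fin m → ℝ,
      F j.succ (WithLp.toLp 2 (j.succ.insertNth (a j.succ) y)) = 0 := by
    intro i y
    refine h0 _ _ fun h => ?_
    have := hcoord _ h i.succ
    simp [a, abs_of_pos hR.1] at this
  rw [Fin.sum_univ_succ]
  simp only [hfront, hback, integral_zero, sub_zero, Finset.sum_const_zero, add_zero, zero_sub]
  congr 1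
  have hz : ∫ y : EuclideanSpace ℝ (Fin m), F 0 (halfSpaceBoundary y) =
      ∫ y : Fin m → ℝ, F 0 (WithLp.toLp 2 (Fin.cons 0 y)) :=
    (integral_toLp fun y : EuclideanSpace ℝ (Fin m) => F 0 (halfSpaceBoundary y)).symm
  rw [hz, ← setIntegral_eq_integral_of_forall_compl_eq_zero (μ := volume)
    (f := fun y : Fin m → ℝ => F 0 (WithLp.toLp 2 (Fin.cons 0 y)))
    (s := Icc (a ∘ Fin.succAbove 0) (b ∘ Fin.succAbove 0))]
  · refine setIntegral_congr_fun measurableSet_Icc fun y _ => ?_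
    simp [a, Fin.insertNth_zero']
  · intro y hy
    refine h0 _ _ fun h => hy ?_
    have hc := hcoord _ h
    refine ⟨fun j => ?_, fun j => ?_⟩
    · have := (abs_lt.1 (hc j.succ)).1.le
      simpa [a] using this
    · have := (abs_lt.1 (hc j.succ)).2.le
      simpa [b] using this

end Divergence

/-! ### The flux of a solution and its divergence -/

section Flux

open MeasureTheory

variable {m : ℕ} {S : Type*} [TopologicalSpace S] [ChartedSpace (EuclideanHalfSpace (m + 1)) S]
  [IsManifold (𝓡∂ (m + 1)) ∞ S] {δ : ℝ} (g : FermiMetric m S δ)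
  {φ : OpenPartialHomeomorph S (EuclideanHalfSpace (m + 1))}

namespace FermiMetric

variable (hφ : φ ∈ IsManifold.maximalAtlas (𝓡∂ (m + 1)) ∞ S) {u : S → ℝ}
  {x : EuclideanSpace ℝ (Fin (m + 1))} (hx : x ∈ (φ.extend (𝓡∂ (m + 1))).target)

include hφ hx in
theorem contDiffWithinAt_localRep' {k : ℕ} (hu : ContMDiff (𝓡∂ (m + 1)) 𝓘(ℝ, ℝ) k u) :
    ContDiffWithinAt ℝ k (localRep (𝓡∂ (m + 1)) φ u) (range (𝓡∂ (m + 1))) x :=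
  (contDiffOn_localRep hφ hu x hx).mono_of_mem_nhdsWithin (extend_target_mem_nhdsWithin_of_mem hx)

include hφ hx in
theorem contDiffWithinAt_du {k : ℕ} (hu : ContMDiff (𝓡∂ (m + 1)) 𝓘(ℝ, ℝ) (k + 1 : ℕ) u)
    (a : Fin (m + 1)) :
    ContDiffWithinAt ℝ k (fun y => du φ u y a) (range (𝓡∂ (m + 1))) x :=
  ((contDiffWithinAt_localRep' hφ hx hu).fderivWithin_right (𝓡∂ (m + 1)).uniqueDiffOn
    (by norm_cast) (extend_target_subset_range φ hx)).clm_apply contDiffWithinAt_const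

include hφ hx in
theorem contDiffWithinAt_coeffAt {k : ℕ} (hu : ContMDiff (𝓡∂ (m + 1)) 𝓘(ℝ, ℝ) k u)
    (huδ : ∀ p, u p ∈ Ioo (-δ) δ) (a b : Fin (m + 1)) :
    ContDiffWithinAt ℝ k (fun y => g.coeffAt φ u y a b) (range (𝓡∂ (m + 1))) x := by
  have h1 : ContDiffOn ℝ k (fun y => g.coeffAt φ u y a b) (φ.extend (𝓡∂ (m + 1))).target :=
    ((g.contDiffOn_coeff hφ a b).of_le (by exact_mod_cast le_top)).comp
      (contDiffOn_id.prodMk (contDiffOn_localRep hφ hu)) fun y hy => ⟨hy, huδ _⟩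
  exact (h1 x hx).mono_of_mem_nhdsWithin (extend_target_mem_nhdsWithin_of_mem hx)

include hφ hx in
-- The first derivatives of a C² function are C¹; positivity of det g and of 1 + |∇u|² makes the
-- roots and the quotient harmless.
theorem contDiffWithinAt_flux (hu : ContMDiff (𝓡∂ (m + 1)) 𝓘(ℝ, ℝ) 2 u)
    (huδ : ∀ p, u p ∈ Ioo (-δ) δ) (a : Fin (m + 1)) :
    ContDiffWithinAt ℝ 1 (fun y => g.flux φ u y a) (range (𝓡∂ (m + 1))) x := by
  have hdet : 0 < (g.coeffAt φ u x).det := (g.coeff_posDef hφ hx (huδ _)).det_pos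
  have hq : 0 ≤ g.gradSq φ u x := g.quadForm_inv_nonneg hφ hx (huδ _) _
  have hG : ∀ a b, ContDiffWithinAt ℝ 1 (fun y => g.coeffAt φ u y a b)
      (range (𝓡∂ (m + 1))) x := fun a b => by
    exact_mod_cast g.contDiffWithinAt_coeffAt (k := 1) hφ hx (hu.of_le (by norm_num)) huδ a b
  have hA := ContDiffWithinAt.matrix_inv hG hdet.ne'
  have hd : ∀ a, ContDiffWithinAt ℝ 1 (fun y => du φ u y a) (range (𝓡∂ (m + 1))) x := fun a => by
    exact_mod_cast contDiffWithinAt_du (k := 1) hφ hx (by exact_mod_cast hu) a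
  have hgrad : ContDiffWithinAt ℝ 1 (fun y => g.gradSq φ u y) (range (𝓡∂ (m + 1))) x :=
    ContDiffWithinAt.sum fun a _ => ContDiffWithinAt.sum fun b _ =>
      ((hA a b).mul (hd a)).mul (hd b)
  have hN : √(1 + g.gradSq φ u x) ≠ 0 := (Real.sqrt_pos.2 (by positivity)).ne'
  exact (((ContDiffWithinAt.matrix_det hG).sqrt hdet.ne').div
    ((contDiffWithinAt_const.add hgrad).sqrt (by positivity)) hN).mul
    (ContDiffWithinAt.sum fun b _ => (hA a b).mul (hd b))

include hφ hx in
/-- For a solution of the minimal surface equation, the variation of the area density is a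
divergence. -/
theorem SolvesMinimalSurfaceEq.areaVar_eq {g : FermiMetric m S δ}
    (hsol : g.SolvesMinimalSurfaceEq u)
    (hu : ContMDiff (𝓡∂ (m + 1)) 𝓘(ℝ, ℝ) 2 u) (huδ : ∀ p, u p ∈ Ioo (-δ) δ) {v : S → ℝ}
    (hv : ContMDiff (𝓡∂ (m + 1)) 𝓘(ℝ, ℝ) 1 v) :
    g.areaVar φ u v x =
      ∑ a, partialDeriv a (fun y => g.flux φ u y a * localRep (𝓡∂ (m + 1)) φ v y) x := by
  have hU := (𝓡∂ (m + 1)).uniqueDiffOn x (extend_target_subset_range φ hx)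
  have hdet : 0 < (g.coeffAt φ u x).det := (g.coeff_posDef hφ hx (huδ _)).det_pos
  have heq := hsol φ hφ x hx
  have h1 : ∀ a, partialDeriv a (fun y => g.flux φ u y a * localRep (𝓡∂ (m + 1)) φ v y) x =
      g.flux φ u x a * du φ v x a +
        localRep (𝓡∂ (m + 1)) φ v x * partialDeriv a (fun y => g.flux φ u y a) x := by
    intro a
    have hf := (g.contDiffWithinAt_flux hφ hx hu huδ a).differentiableWithinAt (by simp)
    have hvd := differentiableWithinAt_localRep hφ hv hx
    rw [partialDeriv, fderivWithin_fun_mul hU hf hvd]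
    rfl
  simp only [h1, Finset.sum_add_distrib, ← Finset.mul_sum]
  rw [minimalSurfaceOperator] at heq
  -- The minimal surface equation multiplied by √det g_u.
  have h2 : √(g.coeffAt φ u x).det * g.lowerOrder φ u x =
      ∑ a, partialDeriv a (fun y => g.flux φ u y a) x := by
    have h3 : √(g.coeffAt φ u x).det ≠ 0 := (Real.sqrt_pos.2 hdet).ne'
    field_simp at heq
    linarith
  rw [areaVar, areaVariation, h2, mul_comm (localRep _ _ _ _)]

end FermiMetric

variable [CompactSpace S]

/-- The vector field `v · flux` in a chart, extended by zero. -/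
def FermiMetric.fluxField (φ : OpenPartialHomeomorph S (EuclideanHalfSpace (m + 1))) (u v : S → ℝ)
    (a : Fin (m + 1)) : EuclideanSpace ℝ (Fin (m + 1)) → ℝ :=
  (φ.extend (𝓡∂ (m + 1))).target.indicator
    fun y => g.flux φ u y a * localRep (𝓡∂ (m + 1)) φ v y

namespace FermiMetric

variable (hφ : φ ∈ IsManifold.maximalAtlas (𝓡∂ (m + 1)) ∞ S) {u v : S → ℝ}
  (hu : ContMDiff (𝓡∂ (m + 1)) 𝓘(ℝ, ℝ) 2 u) (huδ : ∀ p, u p ∈ Ioo (-δ) δ)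
  (hv : ContMDiff (𝓡∂ (m + 1)) 𝓘(ℝ, ℝ) 1 v) (hvs : tsupport v ⊆ φ.source)

include hvs in
theorem isCompact_image_tsupport : IsCompact (φ.extend (𝓡∂ (m + 1)) '' tsupport v) :=
  (isClosed_tsupport v).isCompact.image_of_continuousOn
    (φ.continuousOn_extend.mono (by simpa using hvs))

theorem fluxField_eq_zero (a : Fin (m + 1)) {x : EuclideanSpace ℝ (Fin (m + 1))}
    (hx : x ∉ φ.extend (𝓡∂ (m + 1)) '' tsupport v) : g.fluxField φ u v a x = 0 := by
  by_cases hxt : x ∈ (φ.extend (𝓡∂ (m + 1))).target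
  · rw [fluxField, indicator_of_mem hxt]
    have : localRep (𝓡∂ (m + 1)) φ v x = 0 := by
      by_contra h
      exact hx ⟨_, subset_tsupport v h, (φ.extend (𝓡∂ (m + 1))).right_inv hxt⟩
    rw [this, mul_zero]
  · exact indicator_of_notMem hxt _

theorem fluxField_eventuallyEq (a : Fin (m + 1)) {x : EuclideanSpace ℝ (Fin (m + 1))}
    (hxt : x ∈ (φ.extend (𝓡∂ (m + 1))).target) :
    g.fluxField φ u v a =ᶠ[𝓝[range (𝓡∂ (m + 1))] x]
      fun y => g.flux φ u y a * localRep (𝓡∂ (m + 1)) φ v y := by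
  filter_upwards [extend_target_mem_nhdsWithin_of_mem hxt] with y hy
  exact indicator_of_mem hy _

include hφ hu huδ hv hvs in
-- Inside the target the field is a product of C¹ functions. A point of the half-space outside the
-- target avoids the compact image of the support of v, so the field vanishes near it.
theorem contDiffOn_fluxField (a : Fin (m + 1)) :
    ContDiffOn ℝ 1 (g.fluxField φ u v a) (range (𝓡∂ (m + 1))) := by
  intro x hx
  by_cases hxt : x ∈ (φ.extend (𝓡∂ (m + 1))).target
  · refine ContDiffWithinAt.congr_of_eventuallyEq ?_ (g.fluxField_eventuallyEq a hxt)
      (indicator_of_mem hxt _)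
    exact (g.contDiffWithinAt_flux hφ hxt hu huδ a).mul
      (by exact_mod_cast contDiffWithinAt_localRep' (k := 1) hφ hxt (by exact_mod_cast hv))
  · have hxK : x ∉ φ.extend (𝓡∂ (m + 1)) '' tsupport v := by
      rintro ⟨p, hp, rfl⟩
      exact hxt ((φ.extend (𝓡∂ (m + 1))).map_source (by simpa using hvs hp))
    refine (contDiffWithinAt_const (c := (0 : ℝ))).congr_of_eventuallyEq ?_
      (g.fluxField_eq_zero a hxK)
    refine mem_nhdsWithin_of_mem_nhds ?_
    filter_upwards [(isCompact_image_tsupport hvs).isClosed.isOpen_compl.mem_nhds hxK] with y hy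
      using g.fluxField_eq_zero a hy

include hφ hu huδ hv in
theorem SolvesMinimalSurfaceEq.areaVar_eq_fluxField {g : FermiMetric m S δ}
    (hsol : g.SolvesMinimalSurfaceEq u) {x : EuclideanSpace ℝ (Fin (m + 1))}
    (hxt : x ∈ (φ.extend (𝓡∂ (m + 1))).target) :
    g.areaVar φ u v x = ∑ a, partialDeriv a (g.fluxField φ u v a) x := by
  rw [hsol.areaVar_eq hφ hxt hu huδ hv]
  refine Finset.sum_congr rfl fun a _ => ?_
  rw [partialDeriv, partialDeriv, (g.fluxField_eventuallyEq a hxt).fderivWithin_eq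
    (indicator_of_mem hxt _)]

include hφ hu huδ hv hvs in
theorem continuousOn_divergence_fluxField :
    ContinuousOn (fun x => ∑ a, partialDeriv a (g.fluxField φ u v a) x)
      (range (𝓡∂ (m + 1))) :=
  continuousOn_finsetSum _ fun a _ =>
    ((g.contDiffOn_fluxField hφ hu huδ hv hvs a).continuousOn_fderivWithin
      (𝓡∂ (m + 1)).uniqueDiffOn le_rfl).clm_apply continuousOn_const

include hφ hu huδ hv hvs in
-- On the target the integrand is the divergence of a compactly supported C¹ field, hence agrees
-- there with an integrable function.
theorem SolvesMinimalSurfaceEq.integrableOn_areaVar {g : FermiMetric m S δ}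
    (hsol : g.SolvesMinimalSurfaceEq u) :
    IntegrableOn (g.areaVar φ u v) (φ.extend (𝓡∂ (m + 1))).target := by
  have hK := isCompact_image_tsupport (φ := φ) hvs
  have h1 : IntegrableOn (fun x => ∑ a, partialDeriv a (g.fluxField φ u v a) x)
      (range (𝓡∂ (m + 1))) := by
    have hsub : φ.extend (𝓡∂ (m + 1)) '' tsupport v ⊆ range (𝓡∂ (m + 1)) := by
      rintro _ ⟨p, -, rfl⟩
      exact ⟨φ p, rfl⟩
    refine (((g.continuousOn_divergence_fluxField hφ hu huδ hv hvs).mono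
      hsub).integrableOn_compact hK).of_forall_sdiff_eq_zero
      (𝓡∂ (m + 1)).isClosed_range.measurableSet ?_
    rintro x ⟨-, hx⟩
    exact Finset.sum_eq_zero fun a _ => partialDeriv_eq_zero_of_notMem hK.isClosed
      (fun y hy => g.fluxField_eq_zero a hy) hx a
  refine (h1.mono_set (extend_target_subset_range φ)).congr_fun (fun x hx => ?_)
    (measurableSet_extend_target φ)
  exact (hsol.areaVar_eq_fluxField hφ hu huδ hv hx).symm

include hφ hu huδ hv hvs in
/-- The first variation in the direction of a function supported in one chart. -/
theorem SolvesMinimalSurfaceEq.integral_areaVar {g : FermiMetric m S δ}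
    (hsol : g.SolvesMinimalSurfaceEq u) :
    ∫ x in (φ.extend (𝓡∂ (m + 1))).target, g.areaVar φ u v x =
      -∫ y : EuclideanSpace ℝ (Fin m), g.fluxField φ u v 0 (halfSpaceBoundary y) := by
  have hK := isCompact_image_tsupport (φ := φ) hvs
  rw [← integral_divergence_halfSpace hK
    (fun a => g.contDiffOn_fluxField hφ hu huδ hv hvs a)
    (fun a x hx => g.fluxField_eq_zero a hx)]
  rw [setIntegral_congr_fun (measurableSet_extend_target φ)
    fun x hx => hsol.areaVar_eq_fluxField hφ hu huδ hv hx]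
  symm
  refine setIntegral_eq_of_subset_of_forall_sdiff_eq_zero
    (𝓡∂ (m + 1)).isClosed_range.measurableSet (extend_target_subset_range φ) ?_
  rintro x ⟨-, hx⟩
  refine Finset.sum_eq_zero fun a _ => partialDeriv_eq_zero_of_notMem hK.isClosed
    (fun y hy => g.fluxField_eq_zero a hy) ?_ a
  rintro ⟨p, hp, rfl⟩
  exact hx ((φ.extend (𝓡∂ (m + 1))).map_source (by simpa using hvs hp))

end FermiMetric

end Flux

/-! ### Values and first derivatives as bounded functionals on Hölder spaces -/

section Jets

variable {E : Type*} [NormedAddCommGroup E] [NormedSpace ℝ E]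
  {H : Type*} [TopologicalSpace H] {I : ModelWithCorners ℝ E H}
  {M : Type*} [TopologicalSpace M] [ChartedSpace H M] {A : ChartCover I M} {k : ℕ} {α : ℝ≥0}

namespace HolderSpace

theorem norm_iteratedFDerivWithin_le (f : HolderSpace A k α) (i : Fin A.N) {j : ℕ} (hj : j ≤ k)
    {x : E} (hx : x ∈ (A.chart i).extend I '' A.K i) :
    ‖iteratedFDerivWithin ℝ j (localRep I (A.chart i) f) (range I) x‖ ≤ ‖f‖ := by
  have h1 : (‖iteratedFDerivWithin ℝ j (localRep I (A.chart i) f) (range I) x‖₊ : ℝ≥0∞) ≤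
      holderENorm A k α f := by
    unfold holderENorm
    refine le_trans ?_ (Finset.single_le_sum (f := fun i : Fin A.N =>
      ((∑ j ∈ Finset.range (k + 1), ⨆ x : ((A.chart i).extend I '' A.K i : Set E),
        (‖iteratedFDerivWithin ℝ j (localRep I (A.chart i) f) (range I) (x : E)‖₊ : ℝ≥0∞)) +
      eHolderNorm α (fun x : ((A.chart i).extend I '' A.K i : Set E) =>
        iteratedFDerivWithin ℝ k (localRep I (A.chart i) f) (range I) (x : E))))
      (fun _ _ => zero_le) (Finset.mem_univ i))
    refine le_trans ?_ le_self_add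
    refine le_trans ?_ (Finset.single_le_sum (f := fun j =>
      ⨆ x : ((A.chart i).extend I '' A.K i : Set E),
        (‖iteratedFDerivWithin ℝ j (localRep I (A.chart i) f) (range I) (x : E)‖₊ : ℝ≥0∞))
      (fun _ _ => zero_le) (Finset.mem_range.2 (Nat.lt_succ_of_le hj)))
    exact le_iSup (fun x : ((A.chart i).extend I '' A.K i : Set E) =>
      (‖iteratedFDerivWithin ℝ j (localRep I (A.chart i) f) (range I) (x : E)‖₊ : ℝ≥0∞)) ⟨x, hx⟩
  have h2 := ENNReal.toReal_mono f.mem.2.ne h1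
  exact h2

/-- The zeroth-order term of the norm, in the chart whose piece contains p. This is how ‖u_h‖ ≤ r <
δ keeps the graph inside Σ × (-δ, δ). -/
theorem abs_apply_le (f : HolderSpace A k α) (p : M) : |f p| ≤ ‖f‖ := by
  obtain ⟨i, hi⟩ := A.exists_mem_piece p
  have h := f.norm_iteratedFDerivWithin_le i (Nat.zero_le k) ⟨p, hi.1, rfl⟩
  rw [norm_iteratedFDerivWithin_zero, localRep, Function.comp,
    ((A.chart i).extend I).left_inv (by simpa using A.K_subset i hi.1)] at h
  exact h

theorem norm_fderivWithin_le (f : HolderSpace A k α) (hk : 1 ≤ k) (i : Fin A.N)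
    {x : E} (hx : x ∈ (A.chart i).extend I '' A.K i) :
    ‖fderivWithin ℝ (localRep I (A.chart i) f) (range I) x‖ ≤ ‖f‖ := by
  rw [← norm_iteratedFDerivWithin_one _ (I.uniqueDiffOn x (mem_range_of_mem_image A i hx))]
  exact f.norm_iteratedFDerivWithin_le i hk hx

/-- Evaluation at a point. -/
def evalCLM (p : M) : HolderSpace A k α →L[ℝ] ℝ :=
  LinearMap.mkContinuous
    { toFun := fun f => f p
      map_add' := fun _ _ => rfl
      map_smul' := fun _ _ => rfl } 1
    fun f => by rw [one_mul]; exact f.abs_apply_le p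

@[simp] theorem evalCLM_apply (p : M) (f : HolderSpace A k α) : evalCLM p f = f p := rfl

theorem localRep_add (i : Fin A.N) (f f' : HolderSpace A k α) :
    localRep I (A.chart i) (f + f' : HolderSpace A k α) =
      localRep I (A.chart i) f + localRep I (A.chart i) f' := rfl

theorem localRep_smul (i : Fin A.N) (c : ℝ) (f : HolderSpace A k α) :
    localRep I (A.chart i) (c • f : HolderSpace A k α) = c • localRep I (A.chart i) f := rfl

/-- The derivative, in the chart of index `i`, at a point of the compact piece of this index. -/
def fderivCLM (hk : 1 ≤ k) (i : Fin A.N) {x : E} (hx : x ∈ (A.chart i).extend I '' A.K i) :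
    HolderSpace A k α →L[ℝ] (E →L[ℝ] ℝ) :=
  have hd : ∀ f : HolderSpace A k α,
      DifferentiableWithinAt ℝ (localRep I (A.chart i) f) (range I) x := fun f =>
    (contDiffWithinAt_localRep A f.mem.1 i hx).differentiableWithinAt
      (by exact_mod_cast (Nat.one_le_iff_ne_zero.1 hk))
  have hU := I.uniqueDiffOn x (mem_range_of_mem_image A i hx)
  LinearMap.mkContinuous
    { toFun := fun f => fderivWithin ℝ (localRep I (A.chart i) f) (range I) x
      map_add' := fun f f' => by
        rw [localRep_add]
        exact fderivWithin_add hU (hd f) (hd f')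
      map_smul' := fun c f => by
        rw [localRep_smul]
        exact fderivWithin_const_smul hU (hd f) c } 1
    fun f => by rw [one_mul]; exact f.norm_fderivWithin_le hk i hx

theorem fderivCLM_apply (hk : 1 ≤ k) (i : Fin A.N) {x : E}
    (hx : x ∈ (A.chart i).extend I '' A.K i) (f : HolderSpace A k α) :
    fderivCLM hk i hx f = fderivWithin ℝ (localRep I (A.chart i) f) (range I) x := rfl

end HolderSpace

end Jets

/-! ### The first variation of area as a boundary integral -/

section FirstVariation

open MeasureTheory

variable {m : ℕ} {S : Type*} [TopologicalSpace S] [ChartedSpace (EuclideanHalfSpace (m + 1)) S]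
  [IsManifold (𝓡∂ (m + 1)) ∞ S] {δ : ℝ} (g : FermiMetric m S δ)

namespace FermiMetric

theorem areaVar_eq_zero_of_notMem_tsupport
    (φ : OpenPartialHomeomorph S (EuclideanHalfSpace (m + 1))) {u v : S → ℝ}
    {x : EuclideanSpace ℝ (Fin (m + 1))} (hx : x ∈ (φ.extend (𝓡∂ (m + 1))).target)
    (hv : (φ.extend (𝓡∂ (m + 1))).symm x ∉ tsupport v) : g.areaVar φ u v x = 0 := by
  have hev : localRep (𝓡∂ (m + 1)) φ v =ᶠ[𝓝[range (𝓡∂ (m + 1))] x] fun _ => 0 := by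
    filter_upwards [preimage_symm_mem_nhdsWithin hx
      ((isClosed_tsupport v).isOpen_compl.mem_nhds hv)] with y hy
    exact image_eq_zero_of_notMem_tsupport (f := v) hy
  have h0 : localRep (𝓡∂ (m + 1)) φ v x = 0 :=
    image_eq_zero_of_notMem_tsupport (f := v) hv
  have h1 : ∀ a, du φ v x a = 0 := fun a => by
    rw [du, partialDeriv, hev.fderivWithin_eq h0]
    simp
  simp [areaVar, areaVariation, h0, h1]

theorem areaVar_sum {φ : OpenPartialHomeomorph S (EuclideanHalfSpace (m + 1))}
    (hφ : φ ∈ IsManifold.maximalAtlas (𝓡∂ (m + 1)) ∞ S) (u : S → ℝ) {J : Type*} [Fintype J]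
    {v : J → S → ℝ} (hv : ∀ j, ContMDiff (𝓡∂ (m + 1)) 𝓘(ℝ, ℝ) 1 (v j))
    {x : EuclideanSpace ℝ (Fin (m + 1))} (hx : x ∈ (φ.extend (𝓡∂ (m + 1))).target) :
    g.areaVar φ u (fun p => ∑ j, v j p) x = ∑ j, g.areaVar φ u (v j) x := by
  have h1 : ∀ a, du φ (fun p => ∑ j, v j p) x a = ∑ j, du φ (v j) x a := by
    intro a
    have h2 : localRep (𝓡∂ (m + 1)) φ (fun p => ∑ j, v j p) =
        fun y => ∑ j, localRep (𝓡∂ (m + 1)) φ (v j) y := rfl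
    rw [du, partialDeriv, h2, fderivWithin_fun_sum
      ((𝓡∂ (m + 1)).uniqueDiffOn x (extend_target_subset_range φ hx))
      fun j _ => differentiableWithinAt_localRep hφ (hv j) hx]
    simp [du, partialDeriv]
  simp only [areaVar, areaVariation, h1, Finset.sum_add_distrib]
  congr 1
  · simp only [Finset.mul_sum]
    exact Finset.sum_comm
  · rw [← Finset.mul_sum]
    rfl

variable {u : S → ℝ} (hu : ContMDiff (𝓡∂ (m + 1)) 𝓘(ℝ, ℝ) 2 u)
  (huδ : ∀ p, u p ∈ Ioo (-δ) δ)

include hu huδ in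
-- Read off from the divergence form: the flux is C¹, so its divergence is continuous and the
-- coefficients ∂_s g and ∂_s g⁻¹ need no separate treatment.
theorem SolvesMinimalSurfaceEq.continuousOn_areaVar {g : FermiMetric m S δ}
    (hsol : g.SolvesMinimalSurfaceEq u) {φ : OpenPartialHomeomorph S (EuclideanHalfSpace (m + 1))}
    (hφ : φ ∈ IsManifold.maximalAtlas (𝓡∂ (m + 1)) ∞ S) {v : S → ℝ}
    (hv : ContMDiff (𝓡∂ (m + 1)) 𝓘(ℝ, ℝ) 1 v) :
    ContinuousOn (g.areaVar φ u v) (φ.extend (𝓡∂ (m + 1))).target := by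
  have h : ContinuousOn (fun x => ∑ a, partialDeriv a
      (fun y => g.flux φ u y a * localRep (𝓡∂ (m + 1)) φ v y) x)
      (φ.extend (𝓡∂ (m + 1))).target := by
    refine continuousOn_finsetSum _ fun a _ => ?_
    intro x hx
    have h1 : ContDiffWithinAt ℝ 1 (fun y => g.flux φ u y a * localRep (𝓡∂ (m + 1)) φ v y)
        (range (𝓡∂ (m + 1))) x :=
      (g.contDiffWithinAt_flux hφ hx hu huδ a).mul
        (by exact_mod_cast contDiffWithinAt_localRep' (k := 1) hφ hx (by exact_mod_cast hv))
    have h2 := h1.fderivWithin_right (m := 0) (𝓡∂ (m + 1)).uniqueDiffOn (by simp)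
      (extend_target_subset_range φ hx)
    exact (h2.continuousWithinAt.clm_apply continuousWithinAt_const).mono
      (extend_target_subset_range φ)
  exact h.congr fun x hx => hsol.areaVar_eq hφ hx hu huδ hv

variable [T2Space S] [CompactSpace S] (A : ChartCover (𝓡∂ (m + 1)) S)

include hu huδ in
-- The integrals over the pieces collapse to a single integral in φ because the variation is a
-- density (`areaVar_transition`); then the divergence theorem applies.
theorem SolvesMinimalSurfaceEq.sum_integral_areaVar_of_tsupport {g : FermiMetric m S δ}
    (hsol : g.SolvesMinimalSurfaceEq u) {φ : OpenPartialHomeomorph S (EuclideanHalfSpace (m + 1))}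
    (hφ : φ ∈ IsManifold.maximalAtlas (𝓡∂ (m + 1)) ∞ S) {v : S → ℝ}
    (hv : ContMDiff (𝓡∂ (m + 1)) 𝓘(ℝ, ℝ) 1 v) (hvs : tsupport v ⊆ φ.source) :
    ∑ i, ∫ x in (A.chart i).extend (𝓡∂ (m + 1)) '' A.piece i, g.areaVar (A.chart i) u v x =
      -∫ y : EuclideanSpace ℝ (Fin m), g.fluxField φ u v 0 (halfSpaceBoundary y) := by
  rw [← hsol.integral_areaVar hφ hu huδ hv hvs]
  refine sum_setIntegral_piece_eq A hφ ?_ ?_ (hsol.integrableOn_areaVar hφ hu huδ hv hvs)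
  · intro i x hx hxφ
    exact g.areaVar_transition (A.chart_mem i) hφ hx hxφ (hu.mdifferentiable (by simp) _)
      (hv.mdifferentiable (by simp) _) (huδ _)
  · intro i x hx hxφ
    exact g.areaVar_eq_zero_of_notMem_tsupport _ hx fun h => hxφ (hvs h)

include hu huδ in
/-- The first variation of the area at a solution of the minimal surface equation is a boundary
integral, which is localized by a partition of unity. -/
theorem SolvesMinimalSurfaceEq.sum_integral_areaVar {g : FermiMetric m S δ}
    (hsol : g.SolvesMinimalSurfaceEq u) {w : S → ℝ} (hw : ContMDiff (𝓡∂ (m + 1)) 𝓘(ℝ, ℝ) 1 w)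
    (χ : SmoothPartitionOfUnity (Fin A.N) (𝓡∂ (m + 1)) S univ)
    (hχ : χ.IsSubordinate fun i => (A.chart i).source) :
    ∑ i, ∫ x in (A.chart i).extend (𝓡∂ (m + 1)) '' A.piece i, g.areaVar (A.chart i) u w x =
      ∑ j, -∫ y : EuclideanSpace ℝ (Fin m),
        g.fluxField (A.chart j) u (fun p => χ j p * w p) 0 (halfSpaceBoundary y) := by
  have hv : ∀ j, ContMDiff (𝓡∂ (m + 1)) 𝓘(ℝ, ℝ) 1 (fun p => χ j p * w p) := fun j =>
    ((χ j).contMDiff.of_le (by exact_mod_cast le_top)).mul hw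
  have hvs : ∀ j, tsupport (fun p => χ j p * w p) ⊆ (A.chart j).source := fun j =>
    (tsupport_mul_subset_left (f := χ j) (g := w)).trans (hχ j)
  have hsum : w = fun p => ∑ j, χ j p * w p := by
    funext p
    rw [← Finset.sum_mul, ← finsum_eq_sum_of_fintype, χ.sum_eq_one (mem_univ p), one_mul]
  rw [← Finset.sum_congr rfl fun j _ =>
    hsol.sum_integral_areaVar_of_tsupport hu huδ A (A.chart_mem j) (hv j) (hvs j),
    Finset.sum_comm]
  refine Finset.sum_congr rfl fun i _ => ?_
  rw [← integral_finsetSum]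
  · refine setIntegral_congr_fun (A.measurableSet_image_piece i) fun x hx => ?_
    conv_lhs => rw [hsum]
    exact g.areaVar_sum (A.chart_mem i) u hv (A.image_piece_subset_target i hx)
  · intro j _
    refine IntegrableOn.mono_set ?_ (image_mono sdiff_subset)
    exact ((hsol.continuousOn_areaVar hu huδ (A.chart_mem i) (hv j)).mono
      (A.image_K_subset_target i)).integrableOn_compact (A.isCompact_image_K i)

end FermiMetric

end FirstVariation

/-! ### Differentiating the volume under the integral sign -/

section VolumeDerivative

open MeasureTheory

variable {m : ℕ} {S : Type*} [TopologicalSpace S] [ChartedSpace (EuclideanHalfSpace (m + 1)) S]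
  [IsManifold (𝓡∂ (m + 1)) ∞ S] {δ : ℝ} (g : FermiMetric m S δ)

/-- Differentiation under the integral sign, with a Lipschitz bound at the base point only. -/
theorem hasDerivAt_integral_of_dominated_at {β : Type*} [MeasurableSpace β] {μ : Measure β}
    {F : ℝ → β → ℝ} {F' : β → ℝ} {bound : β → ℝ} {t₀ : ℝ} {s : Set ℝ} (hs : s ∈ 𝓝 t₀)
    (hF_meas : ∀ t ∈ s, AEStronglyMeasurable (F t) μ) (hF_int : Integrable (F t₀) μ)
    (hF'_meas : AEStronglyMeasurable F' μ)
    (h_lip : ∀ᵐ a ∂μ, ∀ t ∈ s, ‖F t a - F t₀ a‖ ≤ bound a * ‖t - t₀‖)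
    (bound_integrable : Integrable bound μ)
    (h_diff : ∀ᵐ a ∂μ, HasDerivAt (F · a) (F' a) t₀) :
    HasDerivAt (fun t => ∫ a, F t a ∂μ) (∫ a, F' a ∂μ) t₀ := by
  -- Identifies a number with multiplication by it, to pass between real and Fréchet derivatives.
  set L : ℝ →L[ℝ] ℝ →L[ℝ] ℝ := ContinuousLinearMap.smulRightL ℝ ℝ ℝ 1
  have hm : AEStronglyMeasurable (L ∘ F') μ := L.continuous.comp_aestronglyMeasurable hF'_meas
  obtain ⟨hF'_int, key⟩ := hasFDerivAt_integral_of_dominated_loc_of_lip' hs hF_meas hF_int hm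
    h_lip bound_integrable (h_diff.mono fun a ha => ha.hasFDerivAt)
  have hint : Integrable F' μ := by
    rw [← integrable_norm_iff hm] at hF'_int
    exact (integrable_norm_iff hF'_meas).1 (by simpa [L, Function.comp_def] using hF'_int)
  rw [hasDerivAt_iff_hasFDerivAt]
  have := L.integral_comp_comm hint
  simp only [Function.comp_def] at key
  rw [this] at key
  exact key

namespace FermiMetric

section
variable {φ : OpenPartialHomeomorph S (EuclideanHalfSpace (m + 1))}
  (hφ : φ ∈ IsManifold.maximalAtlas (𝓡∂ (m + 1)) ∞ S)

include hφ in
theorem contDiffWithinAt_areaDensity {x : EuclideanSpace ℝ (Fin (m + 1))}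
    (hx : x ∈ (φ.extend (𝓡∂ (m + 1))).target) {s : ℝ} (hs : s ∈ Ioo (-δ) δ)
    (p : Fin (m + 1) → ℝ) :
    ContDiffWithinAt ℝ 1
      (fun q : EuclideanSpace ℝ (Fin (m + 1)) × ℝ × (Fin (m + 1) → ℝ) =>
        g.areaDensity φ q.1 q.2.1 q.2.2) (range (𝓡∂ (m + 1)) ×ˢ univ) (x, s, p) := by
  have hG : ∀ a b, ContDiffWithinAt ℝ 1
      (fun q : EuclideanSpace ℝ (Fin (m + 1)) × ℝ × (Fin (m + 1) → ℝ) =>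
        g.coeff φ q.1 q.2.1 a b) (range (𝓡∂ (m + 1)) ×ˢ univ) (x, s, p) := by
    intro a b
    have h1 : ContDiffWithinAt ℝ 1 (fun q : EuclideanSpace ℝ (Fin (m + 1)) × ℝ =>
        g.coeff φ q.1 q.2 a b) ((φ.extend (𝓡∂ (m + 1))).target ×ˢ Ioo (-δ) δ) (x, s) :=
      (g.contDiffOn_coeff hφ a b (x, s) ⟨hx, hs⟩).of_le (by exact_mod_cast le_top)
    have h2 : ContDiffWithinAt ℝ 1
        (fun q : EuclideanSpace ℝ (Fin (m + 1)) × ℝ × (Fin (m + 1) → ℝ) => (q.1, q.2.1))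
        ((φ.extend (𝓡∂ (m + 1))).target ×ˢ (Ioo (-δ) δ ×ˢ univ)) (x, s, p) :=
      (contDiff_fst.prodMk (contDiff_fst.comp contDiff_snd)).contDiffWithinAt
    refine (ContDiffWithinAt.comp (x, s, p)
      (f := fun q : EuclideanSpace ℝ (Fin (m + 1)) × ℝ × (Fin (m + 1) → ℝ) => (q.1, q.2.1))
      h1 h2 fun q hq => ⟨hq.1, hq.2.1⟩).mono_of_mem_nhdsWithin ?_
    rw [nhdsWithin_prod_eq]
    refine Filter.prod_mem_prod (extend_target_mem_nhdsWithin_of_mem hx) ?_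
    rw [nhdsWithin_univ]
    exact prod_mem_nhds (Ioo_mem_nhds hs.1 hs.2) Filter.univ_mem
  have hM : ∀ a b, ContDiffWithinAt ℝ 1
      (fun q : EuclideanSpace ℝ (Fin (m + 1)) × ℝ × (Fin (m + 1) → ℝ) =>
        (Matrix.of fun a b => q.2.2 a * q.2.2 b + g.coeff φ q.1 q.2.1 a b) a b)
      (range (𝓡∂ (m + 1)) ×ˢ univ) (x, s, p) := by
    intro a b
    have hp : ∀ a, ContDiffWithinAt ℝ 1
        (fun q : EuclideanSpace ℝ (Fin (m + 1)) × ℝ × (Fin (m + 1) → ℝ) => q.2.2 a)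
        (range (𝓡∂ (m + 1)) ×ˢ univ) (x, s, p) := fun a =>
      ((contDiff_apply ℝ ℝ a).comp (contDiff_snd.comp contDiff_snd)).contDiffWithinAt
    exact ((hp a).mul (hp b)).add (hG a b)
  refine (ContDiffWithinAt.matrix_det hM).sqrt ?_
  have hdet := (g.coeff_posDef hφ hx hs).det_pos
  have hq := g.quadForm_inv_nonneg hφ hx hs p
  have h := Matrix.det_vecMulVec_add (isUnit_iff_ne_zero.2 hdet.ne') p
  simp only
  rw [h]
  positivity

include hφ in
-- A C¹ function on a convex domain is locally Lipschitz, and compactness of the set of points,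
-- heights and slopes makes the constant uniform. The bound r < δ keeps the heights where g_s is a
-- metric.
theorem exists_lipschitz_areaDensity {K : Set (EuclideanSpace ℝ (Fin (m + 1)))} (hK : IsCompact K)
    (hKφ : K ⊆ (φ.extend (𝓡∂ (m + 1))).target) {r : ℝ} (hr : r < δ) (R : ℝ) :
    ∃ C : ℝ≥0, LipschitzOnWith C
      (fun q : EuclideanSpace ℝ (Fin (m + 1)) × ℝ × (Fin (m + 1) → ℝ) =>
        g.areaDensity φ q.1 q.2.1 q.2.2) (K ×ˢ (Icc (-r) r ×ˢ Metric.closedBall 0 R)) := by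
  refine LocallyLipschitzOn.exists_lipschitzOnWith_of_compact
    (hK.prod (isCompact_Icc.prod (isCompact_closedBall 0 R))) ?_
  rintro ⟨x, s, p⟩ ⟨hx, hs, -⟩
  have hs' : s ∈ Ioo (-δ) δ := ⟨by linarith [hs.1], by linarith [hs.2]⟩
  obtain ⟨C, t, ht, hL⟩ := (g.contDiffWithinAt_areaDensity hφ (hKφ hx) hs'
    p).exists_lipschitzOnWith ((𝓡∂ (m + 1)).convex_range.prod convex_univ)
  refine ⟨C, t, nhdsWithin_mono _ ?_ ht, hL⟩
  exact prod_mono (hKφ.trans (extend_target_subset_range φ)) (subset_univ _)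

include hφ in
theorem continuousOn_areaDensity_comp {u : S → ℝ} (hu : ContMDiff (𝓡∂ (m + 1)) 𝓘(ℝ, ℝ) 2 u)
    (huδ : ∀ p, u p ∈ Ioo (-δ) δ) :
    ContinuousOn (fun x => g.areaDensity φ x (localRep (𝓡∂ (m + 1)) φ u x) (du φ u x))
      (φ.extend (𝓡∂ (m + 1))).target := by
  intro x hx
  have h1 := (g.contDiffWithinAt_areaDensity hφ hx (huδ ((φ.extend (𝓡∂ (m + 1))).symm x))
    (du φ u x)).continuousWithinAt
  have h2 : ContinuousWithinAt (fun x => (x, localRep (𝓡∂ (m + 1)) φ u x, du φ u x))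
      (φ.extend (𝓡∂ (m + 1))).target x := by
    refine continuousWithinAt_id.prodMk (ContinuousWithinAt.prodMk ?_ ?_)
    · exact ((contDiffWithinAt_localRep' (k := 2) hφ hx
        (by exact_mod_cast hu)).continuousWithinAt).mono (extend_target_subset_range φ)
    · exact continuousWithinAt_pi.2 fun a => ((contDiffWithinAt_du (k := 1) hφ hx
        (by exact_mod_cast hu) a).continuousWithinAt).mono (extend_target_subset_range φ)
  exact h1.comp (f := fun x => (x, localRep (𝓡∂ (m + 1)) φ u x, du φ u x)) h2
    fun y hy => ⟨extend_target_subset_range φ hy, mem_univ _⟩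

end

variable [T2Space S] [CompactSpace S] {A : ChartCover (𝓡∂ (m + 1)) S} {α : ℝ≥0}

/-- The derivative of the volume of the graph along a path of functions which starts at a solution
of the minimal surface equation. -/
theorem SolvesMinimalSurfaceEq.hasDerivAt_graphVolume {g : FermiMetric m S δ}
    {U : ℝ → HolderSpace A 2 α} {w : HolderSpace A 2 α} (hU : HasDerivAt U w 0)
    (hsol : g.SolvesMinimalSurfaceEq (U 0)) {r : ℝ} (hr : r < δ) (hUr : ∀ᶠ t in 𝓝 0, ‖U t‖ ≤ r) :
    HasDerivAt (fun t => g.graphVolume A (U t))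
      (∑ i, ∫ x in (A.chart i).extend (𝓡∂ (m + 1)) '' A.piece i,
        g.areaVar (A.chart i) (U 0) w x) 0 := by
  refine HasDerivAt.fun_sum fun i _ => ?_
  have hbound : ∀ f : HolderSpace A 2 α, ‖f‖ ≤ r → ∀ p, f p ∈ Icc (-r) r := fun f hf p =>
    abs_le.1 ((f.abs_apply_le p).trans hf)
  have hbound' : ∀ f : HolderSpace A 2 α, ‖f‖ ≤ r → ∀ p, f p ∈ Ioo (-δ) δ := fun f hf p =>
    ⟨by linarith [(hbound f hf p).1], by linarith [(hbound f hf p).2]⟩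
  have hU0 := hUr.self_of_nhds
  -- The path is only known to be differentiable at 0, so only ‖U t - U 0‖ ≤ C₀ |t| is available.
  -- This is why the domination compares with the base point alone.
  obtain ⟨C₀, hC₀⟩ := hU.differentiableAt.isBigO_sub.bound
  obtain ⟨C, hC⟩ := g.exists_lipschitz_areaDensity (A.chart_mem i) (A.isCompact_image_K i)
    (A.image_K_subset_target i) hr r
  have hsub : (A.chart i).extend (𝓡∂ (m + 1)) '' A.piece i ⊆
      (A.chart i).extend (𝓡∂ (m + 1)) '' A.K i := image_mono sdiff_subset
  have hDm := A.measurableSet_image_piece i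
  have hfin : volume ((A.chart i).extend (𝓡∂ (m + 1)) '' A.piece i) < ⊤ :=
    (measure_mono hsub).trans_lt (A.isCompact_image_K i).measure_lt_top
  have hcont : ∀ f : HolderSpace A 2 α, ‖f‖ ≤ r → ContinuousOn
      (fun x => g.areaDensity (A.chart i) x (localRep (𝓡∂ (m + 1)) (A.chart i) f x)
        (du (A.chart i) f x)) ((A.chart i).extend (𝓡∂ (m + 1)) '' A.K i) := fun f hf =>
    (g.continuousOn_areaDensity_comp (A.chart_mem i) f.mem.1 (hbound' f hf)).mono
      (A.image_K_subset_target i)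
  have hdu : ∀ f : HolderSpace A 2 α, ∀ x ∈ (A.chart i).extend (𝓡∂ (m + 1)) '' A.K i,
      ‖du (A.chart i) f x‖ ≤ ‖f‖ := by
    intro f x hx
    refine (pi_norm_le_iff_of_nonneg (norm_nonneg _)).2 fun a => ?_
    refine (ContinuousLinearMap.le_opNorm _ _).trans ?_
    rw [PiLp.norm_single, norm_one, mul_one]
    exact f.norm_fderivWithin_le (by norm_num) i hx
  have hdusub : ∀ f f' : HolderSpace A 2 α, ∀ x ∈ (A.chart i).extend (𝓡∂ (m + 1)) '' A.K i,
      du (A.chart i) f x - du (A.chart i) f' x = du (A.chart i) (f - f' : HolderSpace A 2 α) x := by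
    intro f f' x hx
    funext a
    have := map_sub (HolderSpace.fderivCLM (A := A) (α := α) (one_le_two) i hx) f f'
    simp only [HolderSpace.fderivCLM_apply] at this
    rw [du, partialDeriv, this]
    rfl
  have hev : ∀ᶠ t in 𝓝 (0 : ℝ), ‖U t‖ ≤ r ∧ ‖U t - U 0‖ ≤ C₀ * ‖t - 0‖ := hUr.and hC₀
  obtain ⟨s, hs, hsU⟩ := hev.exists_mem
  have hrestrict : ∀ f : EuclideanSpace ℝ (Fin (m + 1)) → ℝ,
      ContinuousOn f ((A.chart i).extend (𝓡∂ (m + 1)) '' A.K i) →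
      IntegrableOn f ((A.chart i).extend (𝓡∂ (m + 1)) '' A.piece i) := fun f hf =>
    (hf.integrableOn_compact (A.isCompact_image_K i)).mono_set hsub
  -- The dominating function is constant: the Lipschitz constant of the density times that of the
  -- path at 0.
  refine hasDerivAt_integral_of_dominated_at (bound := fun _ => C * C₀) hs ?_ ?_ ?_ ?_ ?_ ?_
  · intro t ht
    exact (hrestrict _ (hcont _ (hsU t ht).1)).aestronglyMeasurable
  · exact hrestrict _ (hcont _ hU0)
  · exact (hrestrict _ ((hsol.continuousOn_areaVar (U 0).mem.1 (hbound' _ hU0) (A.chart_mem i)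
      (w.mem.1.of_le (by norm_num))).mono (A.image_K_subset_target i))).aestronglyMeasurable
  · filter_upwards [ae_restrict_mem hDm] with x hx t ht
    have hxK := hsub hx
    have hmem : ∀ f : HolderSpace A 2 α, ‖f‖ ≤ r →
        (x, localRep (𝓡∂ (m + 1)) (A.chart i) f x, du (A.chart i) f x) ∈
          ((A.chart i).extend (𝓡∂ (m + 1)) '' A.K i) ×ˢ
            (Icc (-r) r ×ˢ Metric.closedBall (0 : Fin (m + 1) → ℝ) r) := fun f hf =>
      ⟨hxK, hbound f hf _, mem_closedBall_zero_iff.2 ((hdu f x hxK).trans hf)⟩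
    have h1 := hC.dist_le_mul _ (hmem _ (hsU t ht).1) _ (hmem _ hU0)
    rw [Real.dist_eq] at h1
    refine h1.trans ?_
    rw [mul_assoc]
    refine mul_le_mul_of_nonneg_left (le_trans ?_ (hsU t ht).2) C.2
    refine max_le (by simp) (max_le ?_ ?_)
    · rw [Real.dist_eq]
      exact (U t - U 0).abs_apply_le _
    · rw [dist_eq_norm, hdusub _ _ x hxK]
      exact hdu _ x hxK
  · exact integrableOn_const hfin.ne
  · filter_upwards [ae_restrict_mem hDm] with x hx
    have hxK := hsub hx
    refine g.hasDerivAt_areaDensity (A.chart_mem i) (A.image_K_subset_target i hxK) (u := U 0)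
      (hbound' _ hU0 _) (s := fun t => localRep (𝓡∂ (m + 1)) (A.chart i) (U t) x)
      (p := fun t => du (A.chart i) (U t) x) ?_ (fun a => ?_) rfl rfl
    · exact (HolderSpace.evalCLM (((A.chart i).extend (𝓡∂ (m + 1))).symm x)).hasFDerivAt.comp_hasDerivAt
        (0 : ℝ) hU
    · have h1 := (HolderSpace.fderivCLM (A := A) (α := α) (one_le_two) i
        hxK).hasFDerivAt.comp_hasDerivAt (0 : ℝ) hU
      exact h1.clm_apply (hasDerivAt_const (0 : ℝ) (EuclideanSpace.single a (1 : ℝ))) |>.congr_deriv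
        (by simp [du, partialDeriv, HolderSpace.fderivCLM_apply])

end FermiMetric

end VolumeDerivative

/-! ### Linear algebra of the conormal component of the flux -/

section ConormalAlgebra

open Matrix

variable {m : ℕ}

/-- The block matrix `diag(1, γ)`. -/
def consDiag (γ : Matrix (Fin m) (Fin m) ℝ) : Matrix (Fin (m + 1)) (Fin (m + 1)) ℝ :=
  Matrix.of (Fin.cons (Fin.cons 1 0) fun a => Fin.cons 0 (γ a))

theorem det_consDiag (γ : Matrix (Fin m) (Fin m) ℝ) : (consDiag γ).det = γ.det := by
  rw [Matrix.det_succ_row_zero, Fin.sum_univ_succ]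
  simp only [consDiag, of_apply, Fin.cons_zero, Fin.cons_succ, Pi.zero_apply, mul_zero, zero_mul,
    Finset.sum_const_zero, add_zero, Fin.val_zero, pow_zero, one_mul]
  rfl

theorem consDiag_mul (γ γ' : Matrix (Fin m) (Fin m) ℝ) :
    consDiag γ * consDiag γ' = consDiag (γ * γ') := by
  ext i j
  refine Fin.cases ?_ (fun a => ?_) i <;> refine Fin.cases ?_ (fun b => ?_) j <;>
    simp [consDiag, Matrix.mul_apply, Fin.sum_univ_succ]

theorem consDiag_one : consDiag (1 : Matrix (Fin m) (Fin m) ℝ) = 1 := by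
  ext i j
  refine Fin.cases ?_ (fun a => ?_) i <;> refine Fin.cases ?_ (fun b => ?_) j <;>
    simp [consDiag, Matrix.one_apply, (Fin.succ_ne_zero _).symm]

theorem det_of_row_zero {P : Matrix (Fin (m + 1)) (Fin (m + 1)) ℝ}
    (h : ∀ a : Fin m, P 0 a.succ = 0) :
    P.det = P 0 0 * (P.submatrix Fin.succ Fin.succ).det := by
  rw [Matrix.det_succ_row_zero, Fin.sum_univ_succ]
  simp [h]

/-- The conormal component of the flux, expressed by the normal derivative and the tangential
derivatives, in an arbitrary frame of the boundary. -/
theorem conormal_flux_eq {G : Matrix (Fin (m + 1)) (Fin (m + 1)) ℝ} (hG : G.PosDef)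
    {γ : Matrix (Fin m) (Fin m) ℝ} (hγ : 0 < γ.det) {n p : Fin (m + 1) → ℝ}
    {c : Fin m → Fin (m + 1) → ℝ} (hn : n ⬝ᵥ G *ᵥ n = 1) (hnc : ∀ a, n ⬝ᵥ G *ᵥ c a = 0)
    (hcc : ∀ a b, c a ⬝ᵥ G *ᵥ c b = γ a b) (hc0 : ∀ a, c a 0 = 0) (hn0 : n 0 ≤ 0) :
    |(Matrix.of fun b a : Fin m => c a b.succ).det| *
        (√G.det / √(1 + ∑ a, ∑ b, G⁻¹ a b * p a * p b) * ∑ b, G⁻¹ 0 b * p b) =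
      -(√γ.det * ((n ⬝ᵥ p) /
        √(1 + ∑ a, ∑ b, γ⁻¹ a b * (c a ⬝ᵥ p) * (c b ⬝ᵥ p) + (n ⬝ᵥ p) ^ 2))) := by
  have hsymm : Gᵀ = G := by
    have := hG.1.eq
    rwa [conjTranspose_eq_transpose_of_trivial] at this
  let P : Matrix (Fin (m + 1)) (Fin (m + 1)) ℝ := (Matrix.of (Fin.cons n c))ᵀ
  have hP0 : ∀ i, P i 0 = n i := fun i => rfl
  have hPs : ∀ i a, P i (Fin.succ a) = c a i := fun i a => rfl
  have hcn : ∀ a, c a ⬝ᵥ G *ᵥ n = 0 := fun a => by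
    rw [dotProduct_mulVec, ← mulVec_transpose, hsymm, dotProduct_comm]
    exact hnc a
  have hPGP : Pᵀ * G * P = consDiag γ := by
    have hentry : ∀ i j, (Pᵀ * G * P) i j = (fun k => P k i) ⬝ᵥ G *ᵥ (fun k => P k j) := by
      intro i j
      rw [Matrix.mul_assoc]
      rfl
    ext i j
    rw [hentry]
    refine Fin.cases ?_ (fun a => ?_) i <;> refine Fin.cases ?_ (fun b => ?_) j
    · exact hn
    · exact hnc b
    · exact hcn a
    · exact hcc a b
  have hdetP : P.det = n 0 * (Matrix.of fun b a : Fin m => c a b.succ).det :=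
    det_of_row_zero (P := P) fun a => hc0 a
  set κ := (Matrix.of fun b a : Fin m => c a b.succ).det
  -- Determinant of PᵀGP = diag(1, γ). Since det γ > 0, it also forces the frame to be invertible.
  have hdet : (n 0 * κ) ^ 2 * G.det = γ.det := by
    have := congrArg Matrix.det hPGP
    rw [det_mul, det_mul, det_transpose, det_consDiag, hdetP] at this
    rw [← this]; ring
  have hPu : IsUnit P.det := by
    rw [isUnit_iff_ne_zero, hdetP]
    intro h0
    rw [h0] at hdet
    simp at hdet
    exact hγ.ne hdet
  have hGu : IsUnit G.det := isUnit_iff_ne_zero.2 hG.det_pos.ne'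
  have hγu : IsUnit γ.det := isUnit_iff_ne_zero.2 hγ.ne'
  have hinv : G⁻¹ = P * consDiag γ⁻¹ * Pᵀ := by
    refine Matrix.inv_eq_left_inv ?_
    have h1 : P * consDiag γ⁻¹ * Pᵀ * G * P = P := by
      rw [Matrix.mul_assoc P, Matrix.mul_assoc P, Matrix.mul_assoc P, Matrix.mul_assoc (consDiag _),
        Matrix.mul_assoc (consDiag _), hPGP, consDiag_mul, nonsing_inv_mul _ hγu, consDiag_one,
        Matrix.mul_one]
    have h2 := congrArg (· * P⁻¹) h1
    simp only [Matrix.mul_assoc, mul_nonsing_inv _ hPu, Matrix.mul_one] at h2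
    simpa [Matrix.mul_assoc] using h2
  have hz0 : (Pᵀ *ᵥ p) 0 = n ⬝ᵥ p := rfl
  have hzs : ∀ a : Fin m, (Pᵀ *ᵥ p) a.succ = c a ⬝ᵥ p := fun a => rfl
  have hDz0 : ∀ z : Fin (m + 1) → ℝ, (consDiag γ⁻¹ *ᵥ z) 0 = z 0 := by
    intro z
    simp [consDiag, mulVec, dotProduct, Fin.sum_univ_succ]
  have hDzs : ∀ (z : Fin (m + 1) → ℝ) (a : Fin m),
      (consDiag γ⁻¹ *ᵥ z) a.succ = ∑ b, γ⁻¹ a b * z b.succ := by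
    intro z a
    simp [consDiag, mulVec, dotProduct, Fin.sum_univ_succ]
  have hGp : G⁻¹ *ᵥ p = P *ᵥ (consDiag γ⁻¹ *ᵥ (Pᵀ *ᵥ p)) := by
    rw [hinv, ← mulVec_mulVec, ← mulVec_mulVec]
  -- From G⁻¹ = P diag(1, γ⁻¹) Pᵀ and the shape of the first row of P, only the normal component
  -- survives.
  have hrow : ∑ b, G⁻¹ 0 b * p b = n 0 * (n ⬝ᵥ p) := by
    change (G⁻¹ *ᵥ p) 0 = _
    rw [hGp]
    change ∑ i, P 0 i * _ = _
    rw [Fin.sum_univ_succ]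
    simp only [hP0, hPs, hc0, zero_mul, Finset.sum_const_zero, add_zero]
    rw [hDz0, hz0]
  have hquad : ∑ a, ∑ b, G⁻¹ a b * p a * p b =
      ∑ a, ∑ b, γ⁻¹ a b * (c a ⬝ᵥ p) * (c b ⬝ᵥ p) + (n ⬝ᵥ p) ^ 2 := by
    have h1 : ∑ a, ∑ b, G⁻¹ a b * p a * p b = p ⬝ᵥ G⁻¹ *ᵥ p := by
      simp only [dotProduct, mulVec, Finset.mul_sum]
      exact Finset.sum_congr rfl fun a _ => Finset.sum_congr rfl fun b _ => by ring
    have h2 : p ⬝ᵥ G⁻¹ *ᵥ p = (Pᵀ *ᵥ p) ⬝ᵥ (consDiag γ⁻¹ *ᵥ (Pᵀ *ᵥ p)) := by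
      rw [hGp, dotProduct_mulVec, ← mulVec_transpose]
    rw [h1, h2, dotProduct, Fin.sum_univ_succ]
    simp only [hDz0, hDzs, hz0, hzs]
    rw [add_comm, sq]
    congr 1
    refine Finset.sum_congr rfl fun a _ => ?_
    rw [Finset.mul_sum]
    exact Finset.sum_congr rfl fun b _ => by ring
  rw [hrow, hquad, ← add_assoc]
  -- The square root of the determinant identity; the minus sign comes from n 0 ≤ 0, that is, from
  -- the normal pointing outwards.
  have hs : √γ.det = |κ| * √G.det * (-n 0) := by
    rw [← hdet, Real.sqrt_mul (sq_nonneg _), Real.sqrt_sq_eq_abs, abs_mul, abs_of_nonpos hn0]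
    ring
  rw [hs]
  ring

/-- The conormal vector of a positive definite matrix. -/
theorem exists_conormal {G : Matrix (Fin (m + 1)) (Fin (m + 1)) ℝ} (hG : G.PosDef) :
    ∃ n : Fin (m + 1) → ℝ, n 0 < 0 ∧ n ⬝ᵥ G *ᵥ n = 1 ∧
      ∀ c : Fin (m + 1) → ℝ, c 0 = 0 → n ⬝ᵥ G *ᵥ c = 0 := by
  have hsymm : Gᵀ = G := by
    have := hG.1.eq
    rwa [conjTranspose_eq_transpose_of_trivial] at this
  have hGu : IsUnit G.det := isUnit_iff_ne_zero.2 hG.det_pos.ne'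
  have h00 : 0 < G⁻¹ 0 0 := hG.inv.diag_pos
  set ρ := √(G⁻¹ 0 0)
  have hρ : 0 < ρ := Real.sqrt_pos.2 h00
  have hρ2 : ρ * ρ = G⁻¹ 0 0 := Real.mul_self_sqrt h00.le
  let e : Fin (m + 1) → ℝ := Pi.single 0 1
  have hGe : G *ᵥ (G⁻¹ *ᵥ e) = e := by
    rw [mulVec_mulVec, mul_nonsing_inv _ hGu, one_mulVec]
  have hkey : ∀ c : Fin (m + 1) → ℝ, (G⁻¹ *ᵥ e) ⬝ᵥ G *ᵥ c = c 0 := by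
    intro c
    rw [dotProduct_mulVec, ← mulVec_transpose, hsymm, hGe]
    simp [e]
  have he0 : (G⁻¹ *ᵥ e) 0 = G⁻¹ 0 0 := by simp [e]
  -- The gradient G⁻¹e₀ of the coordinate x₀ is G-orthogonal to {c 0 = 0} and has squared length
  -- (G⁻¹)₀₀ = ρ²; it is normalized and reversed.
  refine ⟨-ρ⁻¹ • (G⁻¹ *ᵥ e), ?_, ?_, ?_⟩
  · rw [Pi.smul_apply, he0, smul_eq_mul]
    have := mul_pos (inv_pos.2 hρ) h00
    linarith
  · rw [smul_dotProduct, hkey, Pi.smul_apply, he0, smul_eq_mul, smul_eq_mul, ← hρ2]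
    field_simp
  · intro c hc
    rw [smul_dotProduct, hkey, hc, smul_zero]

end ConormalAlgebra

/-! ### Boundary points and inward vectors are independent of the chart -/

section BoundaryPoints

variable {m : ℕ} {S : Type*} [TopologicalSpace S] [ChartedSpace (EuclideanHalfSpace (m + 1)) S]
  [IsManifold (𝓡∂ (m + 1)) ∞ S] {φ ψ : OpenPartialHomeomorph S (EuclideanHalfSpace (m + 1))}

theorem extend_apply_zero_nonneg (φ : OpenPartialHomeomorph S (EuclideanHalfSpace (m + 1)))
    (p : S) : 0 ≤ φ.extend (𝓡∂ (m + 1)) p 0 :=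
  mem_range_halfSpace.1 ⟨φ p, rfl⟩

theorem exists_mem_target_of_mem_source
    {p : S} (hp : p ∈ φ.source) : ∃ x ∈ (φ.extend (𝓡∂ (m + 1))).target,
      (φ.extend (𝓡∂ (m + 1))).symm x = p :=
  ⟨_, (φ.extend (𝓡∂ (m + 1))).map_source (by simpa using hp),
    (φ.extend (𝓡∂ (m + 1))).left_inv (by simpa using hp)⟩

/-- The vector of components of a tangent vector in a chart. -/
def components (φ : OpenPartialHomeomorph S (EuclideanHalfSpace (m + 1))) {p : S}
    (V : TangentSpace (𝓡∂ (m + 1)) p) : EuclideanSpace ℝ (Fin (m + 1)) :=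
  mfderiv (𝓡∂ (m + 1)) 𝓘(ℝ, EuclideanSpace ℝ (Fin (m + 1))) (φ.extend (𝓡∂ (m + 1))) p V

theorem exists_components_eq (hφ : φ ∈ IsManifold.maximalAtlas (𝓡∂ (m + 1)) ∞ S) {p : S}
    (hp : p ∈ φ.source) (v : EuclideanSpace ℝ (Fin (m + 1))) :
    ∃ V : TangentSpace (𝓡∂ (m + 1)) p, components φ V = v := by
  obtain ⟨x, hx, rfl⟩ := exists_mem_target_of_mem_source hp
  exact ⟨_, mfderiv_extend_mfderivWithin_symm hφ hx v⟩

theorem sum_components_smul_coordVec (hφ : φ ∈ IsManifold.maximalAtlas (𝓡∂ (m + 1)) ∞ S)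
    {x : EuclideanSpace ℝ (Fin (m + 1))} (hx : x ∈ (φ.extend (𝓡∂ (m + 1))).target)
    (V : TangentSpace (𝓡∂ (m + 1)) ((φ.extend (𝓡∂ (m + 1))).symm x)) :
    ∑ a, components φ V a • coordVec φ x a = V :=
  (FermiMetric.sum_smul_coordVec φ x (components φ V)).trans
    (mfderivWithin_symm_mfderiv_extend hφ hx V)

theorem FermiMetric.val_eq_dotProduct {δ : ℝ} (g : FermiMetric m S δ)
    (hφ : φ ∈ IsManifold.maximalAtlas (𝓡∂ (m + 1)) ∞ S) {p : S} (hp : p ∈ φ.source) (s : ℝ)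
    (V W : TangentSpace (𝓡∂ (m + 1)) p) :
    g.val s p V W = (fun i => components φ V i) ⬝ᵥ
      (g.coeff φ (φ.extend (𝓡∂ (m + 1)) p) s).mulVec (fun i => components φ W i) := by
  obtain ⟨x, hx, rfl⟩ := exists_mem_target_of_mem_source hp
  rw [(φ.extend (𝓡∂ (m + 1))).right_inv hx, ← g.val_sum_coordVec,
    sum_components_smul_coordVec hφ hx, sum_components_smul_coordVec hφ hx]

theorem mfderiv_eq_dotProduct (hφ : φ ∈ IsManifold.maximalAtlas (𝓡∂ (m + 1)) ∞ S) {p : S}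
    (hp : p ∈ φ.source) {u : S → ℝ} (hu : MDifferentiableAt (𝓡∂ (m + 1)) 𝓘(ℝ, ℝ) u p)
    (V : TangentSpace (𝓡∂ (m + 1)) p) :
    mfderiv (𝓡∂ (m + 1)) 𝓘(ℝ, ℝ) u p V = (fun i => components φ V i) ⬝ᵥ
      FermiMetric.du φ u (φ.extend (𝓡∂ (m + 1)) p) := by
  obtain ⟨x, hx, rfl⟩ := exists_mem_target_of_mem_source hp
  rw [(φ.extend (𝓡∂ (m + 1))).right_inv hx]
  conv_lhs => rw [← sum_components_smul_coordVec hφ hx V]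
  erw [map_sum]
  refine Finset.sum_congr rfl fun a _ => ?_
  rw [FermiMetric.du_eq hφ hx hu]
  erw [map_smul]
  rfl

/-- At a point which a chart `ψ` maps to the boundary of the half-space, a vector which points into
the half-space in one chart does so in the chart `ψ`. -/
theorem components_zero_nonneg (hφ : φ ∈ IsManifold.maximalAtlas (𝓡∂ (m + 1)) ∞ S)
    (hψ : ψ ∈ IsManifold.maximalAtlas (𝓡∂ (m + 1)) ∞ S) {p : S} (hp : p ∈ φ.source)
    (hpψ : p ∈ ψ.source) (h0 : ψ.extend (𝓡∂ (m + 1)) p 0 = 0)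
    (V : TangentSpace (𝓡∂ (m + 1)) p)
    (hV : 0 ≤ φ.extend (𝓡∂ (m + 1)) p 0 + components φ V 0) : 0 ≤ components ψ V 0 := by
  obtain ⟨x, hx, rfl⟩ := exists_mem_target_of_mem_source hp
  rw [(φ.extend (𝓡∂ (m + 1))).right_inv hx] at hV
  have h1 := transitionDeriv_apply hφ hψ hx hpψ (components φ V)
  have h2 : mfderivWithin 𝓘(ℝ, EuclideanSpace ℝ (Fin (m + 1))) (𝓡∂ (m + 1))
        (φ.extend (𝓡∂ (m + 1))).symm (range (𝓡∂ (m + 1))) x (components φ V) = V :=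
    mfderivWithin_symm_mfderiv_extend hφ hx V
  rw [h2] at h1
  have h3 : components ψ V = transitionDeriv φ ψ x (components φ V) := h1.symm
  rw [h3]
  have hd := (differentiableWithinAt_transition hφ hψ hx hpψ).hasFDerivWithinAt
  let P : EuclideanSpace ℝ (Fin (m + 1)) →L[ℝ] ℝ := EuclideanSpace.proj 0
  have hd0 := P.hasFDerivAt.comp_hasFDerivWithinAt x hd
  -- The 0-th coordinate of ψ is nonnegative and vanishes at this point, so it has a minimum there
  -- and its derivative is nonnegative in every direction that stays in the half-space.
  have hmin : IsLocalMinOn (P ∘ (ψ.extend (𝓡∂ (m + 1)) ∘ (φ.extend (𝓡∂ (m + 1))).symm))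
      (range (𝓡∂ (m + 1))) x := by
    refine Filter.Eventually.of_forall fun y => ?_
    change ψ.extend (𝓡∂ (m + 1)) ((φ.extend (𝓡∂ (m + 1))).symm x) 0 ≤ _
    rw [h0]
    exact extend_apply_zero_nonneg ψ _
  refine hmin.hasFDerivWithinAt_nonneg hd0 (mem_posTangentConeAt_of_segment_subset ?_)
  refine (𝓡∂ (m + 1)).convex_range.segment_subset (extend_target_subset_range φ hx) ?_
  rw [mem_range_halfSpace]
  exact hV

/-- If p were interior in φ, a small positive multiple of any tangent vector would be admissible in
φ. The vector with ψ-components -e₀ then contradicts `components_zero_nonneg`. -/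
theorem extend_apply_zero_eq_zero (hφ : φ ∈ IsManifold.maximalAtlas (𝓡∂ (m + 1)) ∞ S)
    (hψ : ψ ∈ IsManifold.maximalAtlas (𝓡∂ (m + 1)) ∞ S) {p : S} (hp : p ∈ φ.source)
    (hpψ : p ∈ ψ.source) (h0 : ψ.extend (𝓡∂ (m + 1)) p 0 = 0) :
    φ.extend (𝓡∂ (m + 1)) p 0 = 0 := by
  by_contra hne
  have hpos : 0 < φ.extend (𝓡∂ (m + 1)) p 0 :=
    lt_of_le_of_ne (extend_apply_zero_nonneg φ p) (Ne.symm hne)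
  obtain ⟨V, hV⟩ := exists_components_eq hψ hpψ (-EuclideanSpace.single 0 1)
  set c := components φ V 0
  obtain ⟨t, ht, htc⟩ : ∃ t : ℝ, 0 < t ∧ 0 ≤ φ.extend (𝓡∂ (m + 1)) p 0 + t * c := by
    refine ⟨φ.extend (𝓡∂ (m + 1)) p 0 / (|c| + 1), by positivity, ?_⟩
    have h1 : -(|c| + 1) ≤ c := by linarith [neg_abs_le c]
    have h2 : φ.extend (𝓡∂ (m + 1)) p 0 / (|c| + 1) * -(|c| + 1) ≤
      φ.extend (𝓡∂ (m + 1)) p 0 / (|c| + 1) * c :=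
      mul_le_mul_of_nonneg_left h1 (by positivity)
    have h3 : φ.extend (𝓡∂ (m + 1)) p 0 / (|c| + 1) * -(|c| + 1) =
      -φ.extend (𝓡∂ (m + 1)) p 0 := by
      field_simp
    linarith
  have hs : ∀ θ : OpenPartialHomeomorph S (EuclideanHalfSpace (m + 1)),
      components θ (t • V) = t • components θ V := fun θ => map_smul _ t V
  have h1 := components_zero_nonneg hφ hψ hp hpψ h0 (t • V) (by rw [hs]; exact htc)
  rw [hs, hV] at h1
  simp at h1
  linarith

/-- The boundary is defined through the preferred chart at p; comparison with that chart in both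
directions transfers the criterion to any chart of the atlas. -/
theorem extend_apply_zero_eq_zero_iff (hφ : φ ∈ IsManifold.maximalAtlas (𝓡∂ (m + 1)) ∞ S) {p : S}
    (hp : p ∈ φ.source) :
    φ.extend (𝓡∂ (m + 1)) p 0 = 0 ↔ p ∈ (𝓡∂ (m + 1)).boundary S := by
  have h1 : p ∈ (𝓡∂ (m + 1)).boundary S ↔
      (chartAt (EuclideanHalfSpace (m + 1)) p).extend (𝓡∂ (m + 1)) p 0 = 0 := by
    change (𝓡∂ (m + 1)).IsBoundaryPoint p ↔ _
    rw [ModelWithCorners.isBoundaryPoint_iff, frontier_range_modelWithCornersEuclideanHalfSpace]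
    exact ⟨fun h => Eq.symm h, fun h => Eq.symm h⟩
  have hc := IsManifold.chart_mem_maximalAtlas (I := 𝓡∂ (m + 1)) (n := ∞) p
  have hcs := mem_chart_source (EuclideanHalfSpace (m + 1)) p
  rw [h1]
  exact ⟨fun h => extend_apply_zero_eq_zero hc hφ hcs hp h,
    fun h => extend_apply_zero_eq_zero hφ hc hp hcs h⟩

/-- The coordinates of a boundary point without the `0`-th one. -/
def boundaryCoord : EuclideanSpace ℝ (Fin (m + 1)) →L[ℝ] EuclideanSpace ℝ (Fin m) :=
  LinearMap.toContinuousLinearMap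
    { toFun := fun x => WithLp.toLp 2 fun i : Fin m => x i.succ
      map_add' := fun _ _ => rfl
      map_smul' := fun _ _ => rfl }

theorem boundaryCoord_halfSpaceBoundary (y : EuclideanSpace ℝ (Fin m)) :
    boundaryCoord (halfSpaceBoundary y) = y := rfl

theorem halfSpaceBoundary_boundaryCoord {x : EuclideanSpace ℝ (Fin (m + 1))} (hx : x 0 = 0) :
    halfSpaceBoundary (boundaryCoord x) = x := by
  ext i
  refine Fin.cases ?_ (fun j => ?_) i
  · exact hx.symm
  · rfl

end BoundaryPoints

/-! ### Existence and sign of the exterior unit normal -/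

section OuterNormal

variable {m : ℕ} {S : Type*} [TopologicalSpace S] [ChartedSpace (EuclideanHalfSpace (m + 1)) S]
  [IsManifold (𝓡∂ (m + 1)) ∞ S] {φ : OpenPartialHomeomorph S (EuclideanHalfSpace (m + 1))}
  {M : Type*} [TopologicalSpace M] [ChartedSpace (EuclideanSpace ℝ (Fin m)) M]
  [IsManifold (𝓡 m) ∞ M] {ι : M → S} (hι : IsBoundaryEmbedding m ι)
  {δ : ℝ} (g : FermiMetric m S δ)

include hι in
theorem IsBoundaryEmbedding.extend_apply_zero
    (hφ : φ ∈ IsManifold.maximalAtlas (𝓡∂ (m + 1)) ∞ S) {q : M} (hq : ι q ∈ φ.source) :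
    φ.extend (𝓡∂ (m + 1)) (ι q) 0 = 0 :=
  (extend_apply_zero_eq_zero_iff hφ hq).2 (hι.range_eq ▸ mem_range_self q)

include hι in
theorem IsBoundaryEmbedding.mdifferentiableAt (q : M) :
    MDifferentiableAt (𝓡 m) (𝓡∂ (m + 1)) ι q :=
  (hι.contMDiff q).mdifferentiableAt (by simp)

include hι in
/-- Vectors which are tangent to the boundary have vanishing `0`-th component. -/
theorem IsBoundaryEmbedding.components_zero
    (hφ : φ ∈ IsManifold.maximalAtlas (𝓡∂ (m + 1)) ∞ S) {q : M} (hq : ι q ∈ φ.source)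
    (η : TangentSpace (𝓡 m) q) :
    components φ (mfderiv (𝓡 m) (𝓡∂ (m + 1)) ι q η) 0 = 0 := by
  have hφd := mdifferentiableAt_extend hφ hq
  have hιd := hι.mdifferentiableAt q
  let P : EuclideanSpace ℝ (Fin (m + 1)) →L[ℝ] ℝ := EuclideanSpace.proj 0
  have hP : MDifferentiableAt 𝓘(ℝ, EuclideanSpace ℝ (Fin (m + 1))) 𝓘(ℝ, ℝ) P
      (φ.extend (𝓡∂ (m + 1)) (ι q)) := P.differentiableAt.mdifferentiableAt
  have h1 := mfderiv_comp q (hP.comp (ι q) hφd) hιd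
  have h2 := mfderiv_comp (ι q) hP hφd
  -- The 0-th coordinate vanishes identically along the boundary, so its derivative along ι is zero.
  have hev : ((P ∘ φ.extend (𝓡∂ (m + 1))) ∘ ι) =ᶠ[𝓝 q] fun _ => (0 : ℝ) := by
    filter_upwards [hι.contMDiff.continuous.continuousAt.preimage_mem_nhds
      (φ.open_source.mem_nhds hq)] with q' hq'
    exact hι.extend_apply_zero hφ hq'
  rw [hev.mfderiv_eq, mfderiv_const, h2] at h1
  have h3 := congrArg (fun T => T η) h1
  rw [mfderiv_eq_fderiv, P.fderiv] at h3
  exact h3.symm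

include hι in
/-- The exterior unit normal exists. -/
theorem FermiMetric.isOuterUnitNormal_outerUnitNormal {s : ℝ} (hs : s ∈ Ioo (-δ) δ) (q : M) :
    g.IsOuterUnitNormal ι s q (g.outerUnitNormal ι s q) := by
  -- The normal is a choice, so one vector with the three properties is enough; `exists_conormal`
  -- provides it in the preferred chart.
  refine Classical.epsilon_spec ?_
  have hc := IsManifold.chart_mem_maximalAtlas (I := 𝓡∂ (m + 1)) (n := ∞) (ι q)
  have hcs := mem_chart_source (EuclideanHalfSpace (m + 1)) (ι q)
  have hx : (chartAt (EuclideanHalfSpace (m + 1)) (ι q)).extend (𝓡∂ (m + 1)) (ι q) ∈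
      ((chartAt (EuclideanHalfSpace (m + 1)) (ι q)).extend (𝓡∂ (m + 1))).target :=
    PartialEquiv.map_source _ (by simp)
  obtain ⟨n, hn0, hn1, hnc⟩ := exists_conormal (g.coeff_posDef hc hx hs)
  obtain ⟨V, hV⟩ := exists_components_eq hc hcs (WithLp.toLp 2 n)
  refine ⟨V, ?_, fun η => ?_, ?_⟩
  · rw [g.val_eq_dotProduct hc hcs, hV]
    exact hn1
  · rw [g.val_eq_dotProduct hc hcs, hV]
    exact hnc _ (hι.components_zero hc hcs η)
  · change components (chartAt (EuclideanHalfSpace (m + 1)) (ι q)) V 0 < 0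
    rw [hV]
    exact hn0

include hι in
-- The definition of "outer" looks only at the preferred chart. Applying `components_zero_nonneg` to
-- -ν carries the sign to every chart; the weak inequality suffices for `conormal_flux_eq`.
theorem FermiMetric.components_outerUnitNormal_zero_nonpos {s : ℝ} (hs : s ∈ Ioo (-δ) δ) {q : M}
    (hφ : φ ∈ IsManifold.maximalAtlas (𝓡∂ (m + 1)) ∞ S) (hq : ι q ∈ φ.source) :
    components φ (g.outerUnitNormal ι s q) 0 ≤ 0 := by
  have hc := IsManifold.chart_mem_maximalAtlas (I := 𝓡∂ (m + 1)) (n := ∞) (ι q)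
  have hcs := mem_chart_source (EuclideanHalfSpace (m + 1)) (ι q)
  have h1 : components (chartAt (EuclideanHalfSpace (m + 1)) (ι q))
      (g.outerUnitNormal ι s q) 0 < 0 := (g.isOuterUnitNormal_outerUnitNormal hι hs q).outer
  have hneg : ∀ θ : OpenPartialHomeomorph S (EuclideanHalfSpace (m + 1)),
      components θ (-g.outerUnitNormal ι s q) = -components θ (g.outerUnitNormal ι s q) :=
    fun θ => map_neg _ _
  have h2 := components_zero_nonneg hc hφ hcs hq (hι.extend_apply_zero hφ hq)
    (-g.outerUnitNormal ι s q) (by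
      rw [hι.extend_apply_zero hc hcs, hneg, PiLp.neg_apply]
      linarith)
  rw [hneg, PiLp.neg_apply] at h2
  linarith

end OuterNormal

/-! ### The conormal flux expressed by boundary data and the normal derivative -/

section BoundaryData

open MeasureTheory

variable {m : ℕ} {S : Type*} [TopologicalSpace S] [ChartedSpace (EuclideanHalfSpace (m + 1)) S]
  [IsManifold (𝓡∂ (m + 1)) ∞ S] {M : Type*} [TopologicalSpace M]
  [ChartedSpace (EuclideanSpace ℝ (Fin m)) M] [IsManifold (𝓡 m) ∞ M]

/-- The image under `ι` of the coordinate vector field `∂_a` of a chart of `M`. -/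
def boundaryVec (ι : M → S) (ψ : OpenPartialHomeomorph M (EuclideanSpace ℝ (Fin m)))
    (y : EuclideanSpace ℝ (Fin m)) (a : Fin m) :
    TangentSpace (𝓡∂ (m + 1)) (ι ((ψ.extend (𝓡 m)).symm y)) :=
  mfderiv (𝓡 m) (𝓡∂ (m + 1)) ι ((ψ.extend (𝓡 m)).symm y)
    (mfderivWithin 𝓘(ℝ, EuclideanSpace ℝ (Fin m)) (𝓡 m) (ψ.extend (𝓡 m)).symm (range (𝓡 m)) y
      (EuclideanSpace.single a 1))

/-- `∂_a h` in a chart of `M`. -/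
def tangentialDu (ψ : OpenPartialHomeomorph M (EuclideanSpace ℝ (Fin m))) (h : M → ℝ)
    (y : EuclideanSpace ℝ (Fin m)) (a : Fin m) : ℝ :=
  fderivWithin ℝ (localRep (𝓡 m) ψ h) (range (𝓡 m)) y (EuclideanSpace.single a 1)

/-- The density `√det γ N / √(1 + |d|²_γ + N²)`. -/
def conormalDensity (γ : Matrix (Fin m) (Fin m) ℝ) (d : Fin m → ℝ) (N : ℝ) : ℝ :=
  √γ.det * (N / √(1 + ∑ a, ∑ b, γ⁻¹ a b * d a * d b + N ^ 2))

/-- The expression of the boundary coordinates of a chart of `S` in a chart of `M`. -/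
def boundaryTransition (φ : OpenPartialHomeomorph S (EuclideanHalfSpace (m + 1))) (ι : M → S)
    (ψ : OpenPartialHomeomorph M (EuclideanSpace ℝ (Fin m))) (y : EuclideanSpace ℝ (Fin m)) :
    EuclideanSpace ℝ (Fin m) :=
  boundaryCoord (φ.extend (𝓡∂ (m + 1)) (ι ((ψ.extend (𝓡 m)).symm y)))

namespace FermiMetric

variable {δ : ℝ} (g : FermiMetric m S δ)

/-- The matrix of the metric `ι^* g_s` in a chart of `M`. -/
def boundaryCoeff (ι : M → S) (ψ : OpenPartialHomeomorph M (EuclideanSpace ℝ (Fin m)))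
    (y : EuclideanSpace ℝ (Fin m)) (s : ℝ) : Matrix (Fin m) (Fin m) ℝ :=
  Matrix.of fun a b =>
    g.val s (ι ((ψ.extend (𝓡 m)).symm y)) (boundaryVec ι ψ y a) (boundaryVec ι ψ y b)

/-- The conormal component of the flux of `u` at the boundary, in a chart of `M`. -/
def boundaryDensity (ι : M → S) (ψ : OpenPartialHomeomorph M (EuclideanSpace ℝ (Fin m)))
    (u : S → ℝ) (y : EuclideanSpace ℝ (Fin m)) : ℝ :=
  conormalDensity (g.boundaryCoeff ι ψ y (u (ι ((ψ.extend (𝓡 m)).symm y))))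
    (tangentialDu ψ (u ∘ ι) y) (g.normalDeriv ι u ((ψ.extend (𝓡 m)).symm y))

end FermiMetric

variable {ι : M → S} (hι : IsBoundaryEmbedding m ι)
  {φ : OpenPartialHomeomorph S (EuclideanHalfSpace (m + 1))}
  (hφ : φ ∈ IsManifold.maximalAtlas (𝓡∂ (m + 1)) ∞ S)
  {ψ : OpenPartialHomeomorph M (EuclideanSpace ℝ (Fin m))}
  (hψ : ψ ∈ IsManifold.maximalAtlas (𝓡 m) ∞ M)
  {y : EuclideanSpace ℝ (Fin m)} (hy : y ∈ (ψ.extend (𝓡 m)).target)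
  {δ : ℝ} (g : FermiMetric m S δ)

theorem isOpen_extend_target_model (ψ : OpenPartialHomeomorph M (EuclideanSpace ℝ (Fin m))) :
    IsOpen (ψ.extend (𝓡 m)).target := by
  simpa using ψ.open_target

include hι hψ in
theorem IsBoundaryEmbedding.contMDiffOn_comp_extend_symm :
    ContMDiffOn 𝓘(ℝ, EuclideanSpace ℝ (Fin m)) (𝓡∂ (m + 1)) ∞ (ι ∘ (ψ.extend (𝓡 m)).symm)
      (ψ.extend (𝓡 m)).target :=
  hι.contMDiff.comp_contMDiffOn (contMDiffOn_extend_symm_target hψ)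

include hι hψ in
theorem IsBoundaryEmbedding.boundaryVec_eq {y : EuclideanSpace ℝ (Fin m)}
    (hy : y ∈ (ψ.extend (𝓡 m)).target) (a : Fin m) :
    boundaryVec ι ψ y a = mfderivWithin 𝓘(ℝ, EuclideanSpace ℝ (Fin m)) (𝓡∂ (m + 1))
      (ι ∘ (ψ.extend (𝓡 m)).symm) (ψ.extend (𝓡 m)).target y (EuclideanSpace.single a 1) := by
  have h1 := mfderivWithin_comp_extend_symm hψ hy (hι.mdifferentiableAt _)
  have h2 : mfderivWithin 𝓘(ℝ, EuclideanSpace ℝ (Fin m)) (𝓡∂ (m + 1))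
      (ι ∘ (ψ.extend (𝓡 m)).symm) (ψ.extend (𝓡 m)).target y =
      mfderivWithin 𝓘(ℝ, EuclideanSpace ℝ (Fin m)) (𝓡∂ (m + 1))
      (ι ∘ (ψ.extend (𝓡 m)).symm) (range (𝓡 m)) y :=
    mfderivWithin_subset (extend_target_subset_range ψ)
      ((uniqueDiffOn_extend_target ψ).uniqueMDiffOn y hy)
      ((hι.mdifferentiableAt _).comp_mdifferentiableWithinAt _
        (mdifferentiableWithinAt_extend_symm hψ hy))
  rw [h2, h1]
  rfl

include hι hψ in
theorem FermiMetric.contDiffOn_boundaryCoeff (a b : Fin m) :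
    ContDiffOn ℝ ∞ (fun q : EuclideanSpace ℝ (Fin m) × ℝ => g.boundaryCoeff ι ψ q.1 q.2 a b)
      ((ψ.extend (𝓡 m)).target ×ˢ Ioo (-δ) δ) := by
  refine (g.contDiffOn_pullback (uniqueDiffOn_extend_target ψ)
    (hι.contMDiffOn_comp_extend_symm hψ) (EuclideanSpace.single a 1)
    (EuclideanSpace.single b 1)).congr ?_
  intro q hq
  rw [← hι.boundaryVec_eq hψ hq.1, ← hι.boundaryVec_eq hψ hq.1]
  rfl

theorem sum_smul_boundaryVec (ι : M → S)
    (ψ : OpenPartialHomeomorph M (EuclideanSpace ℝ (Fin m))) (y v : EuclideanSpace ℝ (Fin m)) :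
    ∑ a, v a • boundaryVec ι ψ y a = mfderiv (𝓡 m) (𝓡∂ (m + 1)) ι ((ψ.extend (𝓡 m)).symm y)
      (mfderivWithin 𝓘(ℝ, EuclideanSpace ℝ (Fin m)) (𝓡 m) (ψ.extend (𝓡 m)).symm
        (range (𝓡 m)) y v) := by
  have hv : v = ∑ a, v a • EuclideanSpace.single a (1 : ℝ) := by
    ext b
    simp [Pi.single_apply]
  conv_rhs => rw [hv]
  erw [map_sum, map_sum]
  refine Finset.sum_congr rfl fun a _ => ?_
  erw [map_smul, map_smul]
  rfl

include hι hψ hy in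
-- Because ι is an immersion, its coordinate vectors are linearly independent.
theorem FermiMetric.boundaryCoeff_posDef {s : ℝ} (hs : s ∈ Ioo (-δ) δ) :
    (g.boundaryCoeff ι ψ y s).PosDef := by
  refine Matrix.PosDef.of_dotProduct_mulVec_pos ?_ ?_
  · ext a b
    exact g.symm s hs _ (boundaryVec ι ψ y b) (boundaryVec ι ψ y a)
  · intro v hv
    have h1 : star v ⬝ᵥ (g.boundaryCoeff ι ψ y s).mulVec v =
        g.val s _ (∑ a, v a • boundaryVec ι ψ y a) (∑ a, v a • boundaryVec ι ψ y a) := by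
      simp only [map_sum, map_smul, sum_apply, smul_apply,
        smul_eq_mul, dotProduct, Matrix.mulVec, Finset.mul_sum, boundaryCoeff, Matrix.of_apply,
        star_trivial]
      rw [Finset.sum_comm]
      refine Finset.sum_congr rfl fun a _ => Finset.sum_congr rfl fun b _ => ?_
      ring
    rw [h1]
    refine g.pos s hs _ _ fun h0 => hv ?_
    have h2 := sum_smul_boundaryVec ι ψ y (WithLp.toLp 2 v)
    have h3 : mfderiv (𝓡 m) (𝓡∂ (m + 1)) ι ((ψ.extend (𝓡 m)).symm y)
      (mfderivWithin 𝓘(ℝ, EuclideanSpace ℝ (Fin m)) (𝓡 m) (ψ.extend (𝓡 m)).symm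
        (range (𝓡 m)) y (WithLp.toLp 2 v)) = 0 := h2.symm.trans h0
    have h4 := hι.injective_mfderiv _ (h3.trans (map_zero _).symm)
    have h5 := mfderiv_extend_mfderivWithin_symm hψ hy (WithLp.toLp 2 v)
    erw [h4, map_zero] at h5
    exact funext fun a => (congrArg (fun T : EuclideanSpace ℝ (Fin m) => T a) h5).symm

include hι hψ hy in
-- Tangential derivatives of u depend only on its boundary values.
theorem mfderiv_boundaryVec {u : S → ℝ} (hu : ContMDiff (𝓡∂ (m + 1)) 𝓘(ℝ, ℝ) 1 u) (a : Fin m) :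
    mfderiv (𝓡∂ (m + 1)) 𝓘(ℝ, ℝ) u (ι ((ψ.extend (𝓡 m)).symm y)) (boundaryVec ι ψ y a) =
      tangentialDu ψ (u ∘ ι) y a := by
  have hud := (hu (ι ((ψ.extend (𝓡 m)).symm y))).mdifferentiableAt (by simp)
  have hιd := hι.mdifferentiableAt ((ψ.extend (𝓡 m)).symm y)
  rw [tangentialDu, fderivWithin_localRep hψ hy (hud.comp _ hιd), mfderiv_comp _ hud hιd]
  rfl

include hι hφ hψ in
theorem contDiffOn_boundaryTransition :
    ContDiffOn ℝ ∞ (boundaryTransition φ ι ψ)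
      ((ψ.extend (𝓡 m)).target ∩ (ι ∘ (ψ.extend (𝓡 m)).symm) ⁻¹' φ.source) := by
  refine boundaryCoord.contDiff.comp_contDiffOn ?_
  rw [← contMDiffOn_iff_contDiffOn]
  exact (φ.contMDiffOn_extend hφ).comp
    ((hι.contMDiffOn_comp_extend_symm hψ).mono inter_subset_left) fun y hy => hy.2

include hι in
theorem isOpen_boundaryTransition_domain :
    IsOpen ((ψ.extend (𝓡 m)).target ∩ (ι ∘ (ψ.extend (𝓡 m)).symm) ⁻¹' φ.source) :=
  (hι.contMDiff.continuous.comp_continuousOn ψ.continuousOn_extend_symm).isOpen_inter_preimage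
    (isOpen_extend_target_model ψ) φ.open_source

include hι hφ hψ in
theorem differentiableAt_boundaryTransition
    (hy : y ∈ (ψ.extend (𝓡 m)).target ∩ (ι ∘ (ψ.extend (𝓡 m)).symm) ⁻¹' φ.source) :
    DifferentiableAt ℝ (boundaryTransition φ ι ψ) y :=
  ((contDiffOn_boundaryTransition hι hφ hψ).differentiableOn (by simp) y hy).differentiableAt
    ((isOpen_boundaryTransition_domain hι).mem_nhds hy)

include hι hφ hψ in
-- Identifies the Jacobian of the boundary coordinates with the matrix whose determinant appears in
-- `conormal_flux_eq`.
theorem fderiv_boundaryTransition_apply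
    (hy : y ∈ (ψ.extend (𝓡 m)).target ∩ (ι ∘ (ψ.extend (𝓡 m)).symm) ⁻¹' φ.source) (a b : Fin m) :
    fderiv ℝ (boundaryTransition φ ι ψ) y (EuclideanSpace.single a 1) b =
      components φ (boundaryVec ι ψ y a) b.succ := by
  have hφd : MDifferentiableAt (𝓡∂ (m + 1)) 𝓘(ℝ, EuclideanSpace ℝ (Fin (m + 1)))
    (φ.extend (𝓡∂ (m + 1))) (ι ((ψ.extend (𝓡 m)).symm y)) := mdifferentiableAt_extend hφ hy.2
  have hιd := hι.mdifferentiableAt ((ψ.extend (𝓡 m)).symm y)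
  have h1 := mfderivWithin_comp_extend_symm hψ hy.1
    (MDifferentiableAt.comp ((ψ.extend (𝓡 m)).symm y) hφd hιd)
  rw [mfderiv_comp _ hφd hιd, mfderivWithin_eq_fderivWithin] at h1
  have hd : DifferentiableWithinAt ℝ ((φ.extend (𝓡∂ (m + 1)) ∘ ι) ∘ (ψ.extend (𝓡 m)).symm)
      (range (𝓡 m)) y :=
    mdifferentiableWithinAt_iff_differentiableWithinAt.1
      ((MDifferentiableAt.comp ((ψ.extend (𝓡 m)).symm y) hφd hιd).comp_mdifferentiableWithinAt _
        (mdifferentiableWithinAt_extend_symm hψ hy.1))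
  have h2 : fderivWithin ℝ (boundaryTransition φ ι ψ) (range (𝓡 m)) y =
      boundaryCoord.comp (fderivWithin ℝ
        ((φ.extend (𝓡∂ (m + 1)) ∘ ι) ∘ (ψ.extend (𝓡 m)).symm) (range (𝓡 m)) y) := by
    have h3 := fderiv_comp_fderivWithin y (boundaryCoord (m := m)).differentiableAt hd
      ((𝓡 m).uniqueDiffOn y (extend_target_subset_range ψ hy.1))
    rwa [boundaryCoord.fderiv] at h3
  rw [h1] at h2
  rw [← fderivWithin_univ, ← (𝓡 m).range_eq_univ, h2]
  rfl

include hι hφ hψ in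
-- `conormal_flux_eq` for the frame formed by ν and the vectors ι_*∂_a. The right side no longer
-- involves the chart φ of S, so contributions from different charts can be added.
theorem FermiMetric.abs_det_mul_flux
    (hy : y ∈ (ψ.extend (𝓡 m)).target ∩ (ι ∘ (ψ.extend (𝓡 m)).symm) ⁻¹' φ.source) {u : S → ℝ}
    (hu : ContMDiff (𝓡∂ (m + 1)) 𝓘(ℝ, ℝ) 1 u) (huδ : ∀ p, u p ∈ Ioo (-δ) δ) :
    |(fderiv ℝ (boundaryTransition φ ι ψ) y).det| *
        g.flux φ u (φ.extend (𝓡∂ (m + 1)) (ι ((ψ.extend (𝓡 m)).symm y))) 0 =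
      -g.boundaryDensity ι ψ u y := by
  set q := (ψ.extend (𝓡 m)).symm y with hq
  have hqφ : ι q ∈ φ.source := hy.2
  have hx : φ.extend (𝓡∂ (m + 1)) (ι q) ∈ (φ.extend (𝓡∂ (m + 1))).target :=
    PartialEquiv.map_source _ (by simpa using hqφ)
  have hud := (hu (ι q)).mdifferentiableAt (by simp)
  have hrep : localRep (𝓡∂ (m + 1)) φ u (φ.extend (𝓡∂ (m + 1)) (ι q)) = u (ι q) := by
    rw [localRep, Function.comp_apply, PartialEquiv.left_inv _ (by simpa using hqφ)]
  have hν := g.isOuterUnitNormal_outerUnitNormal hι (huδ (ι q)) q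
  have key := conormal_flux_eq (g.coeff_posDef hφ hx (huδ (ι q)))
    (g.boundaryCoeff_posDef hι hψ hy.1 (huδ (ι q))).det_pos
    (n := fun i => components φ (g.outerUnitNormal ι (u (ι q)) q) i)
    (p := du φ u (φ.extend (𝓡∂ (m + 1)) (ι q)))
    (c := fun a i => components φ (boundaryVec ι ψ y a) i)
    (by rw [← g.val_eq_dotProduct hφ hqφ]; exact hν.unit)
    (fun a => by
      rw [← g.val_eq_dotProduct hφ hqφ]
      exact hν.normal _)
    (fun a b => by
      rw [← g.val_eq_dotProduct hφ hqφ]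
      rfl)
    (fun a => hι.components_zero hφ hqφ _)
    (g.components_outerUnitNormal_zero_nonpos hι (huδ (ι q)) hφ hqφ)
  rw [boundaryDensity, conormalDensity, ContinuousLinearMap.det_eq_det_matrix]
  have hN : g.normalDeriv ι u q = (fun i => components φ (g.outerUnitNormal ι (u (ι q)) q) i) ⬝ᵥ
      du φ u (φ.extend (𝓡∂ (m + 1)) (ι q)) := mfderiv_eq_dotProduct hφ hqφ hud _
  have hd : ∀ a, tangentialDu ψ (u ∘ ι) y a =
      (fun i => components φ (boundaryVec ι ψ y a) i) ⬝ᵥ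
        du φ u (φ.extend (𝓡∂ (m + 1)) (ι q)) := fun a => by
    rw [← mfderiv_boundaryVec hι hψ hy.1 hu]
    exact mfderiv_eq_dotProduct hφ hqφ hud _
  simp only [fderiv_boundaryTransition_apply hι hφ hψ hy, hd]
  rw [← hq, hN, flux, gradSq, coeffAt, hrep]
  exact key

include hι hφ in
theorem halfSpaceBoundary_boundaryTransition (hq : ι ((ψ.extend (𝓡 m)).symm y) ∈ φ.source) :
    halfSpaceBoundary (boundaryTransition φ ι ψ y) =
      φ.extend (𝓡∂ (m + 1)) (ι ((ψ.extend (𝓡 m)).symm y)) :=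
  halfSpaceBoundary_boundaryCoord (hι.extend_apply_zero hφ hq)

include hι hφ in
theorem injOn_boundaryTransition :
    InjOn (boundaryTransition φ ι ψ)
      ((ψ.extend (𝓡 m)).target ∩ (ι ∘ (ψ.extend (𝓡 m)).symm) ⁻¹' φ.source) := by
  intro y hy y' hy' h
  have h1 := congrArg halfSpaceBoundary h
  rw [halfSpaceBoundary_boundaryTransition hι hφ hy.2,
    halfSpaceBoundary_boundaryTransition hι hφ hy'.2] at h1
  have h2 := (φ.extend (𝓡∂ (m + 1))).injOn (by simpa using hy.2) (by simpa using hy'.2) h1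
  exact (ψ.extend (𝓡 m)).symm.injOn hy.1 hy'.1 (hι.isEmbedding.injective h2)

include hι hφ hψ in
/-- The boundary integral of the conormal component of the flux, in a chart of the boundary. -/
theorem FermiMetric.neg_integral_fluxField {u v : S → ℝ}
    (hu : ContMDiff (𝓡∂ (m + 1)) 𝓘(ℝ, ℝ) 1 u) (huδ : ∀ p, u p ∈ Ioo (-δ) δ)
    (hvφ : ∀ p, v p ≠ 0 → p ∈ φ.source) (hvψ : ∀ q, v (ι q) ≠ 0 → q ∈ ψ.source) :
    -∫ z, g.fluxField φ u v 0 (halfSpaceBoundary z) =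
      ∫ y in (ψ.extend (𝓡 m)).target,
        g.boundaryDensity ι ψ u y * v (ι ((ψ.extend (𝓡 m)).symm y)) := by
  set T := (ψ.extend (𝓡 m)).target ∩ (ι ∘ (ψ.extend (𝓡 m)).symm) ⁻¹' φ.source with hT
  have hTo : IsOpen T := isOpen_boundaryTransition_domain hι
  -- Where the integrand is nonzero, the point lies on the boundary of S in the domain of φ, so it
  -- is some ι q, and q lies in the domain of ψ by the support condition on v.
  have h1 : ∫ z, g.fluxField φ u v 0 (halfSpaceBoundary z) =
      ∫ z in boundaryTransition φ ι ψ '' T, g.fluxField φ u v 0 (halfSpaceBoundary z) := by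
    symm
    refine setIntegral_eq_integral_of_forall_compl_eq_zero fun z hz => ?_
    by_contra hne
    have hzt : halfSpaceBoundary z ∈ (φ.extend (𝓡∂ (m + 1))).target := by
      by_contra h
      exact hne (indicator_of_notMem h _)
    rw [fluxField, indicator_of_mem hzt] at hne
    have hvz : v ((φ.extend (𝓡∂ (m + 1))).symm (halfSpaceBoundary z)) ≠ 0 :=
      right_ne_zero_of_mul hne
    have hp := extend_symm_mem_source hzt
    have hb : (φ.extend (𝓡∂ (m + 1))).symm (halfSpaceBoundary z) ∈ range ι := by
      rw [hι.range_eq, ← extend_apply_zero_eq_zero_iff hφ hp, PartialEquiv.right_inv _ hzt]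
      rfl
    obtain ⟨q, hq⟩ := hb
    rw [← hq] at hvz hp
    have hqψ := hvψ q hvz
    have hqq : (ψ.extend (𝓡 m)).symm (ψ.extend (𝓡 m) q) = q :=
      PartialEquiv.left_inv _ (by simpa using hqψ)
    refine hz ⟨ψ.extend (𝓡 m) q, ⟨PartialEquiv.map_source _ (by simpa using hqψ), ?_⟩, ?_⟩
    · change ι ((ψ.extend (𝓡 m)).symm (ψ.extend (𝓡 m) q)) ∈ φ.source
      rwa [hqq]
    · rw [boundaryTransition, hqq, hq, PartialEquiv.right_inv _ hzt,
        boundaryCoord_halfSpaceBoundary]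
  rw [h1, integral_image_eq_integral_abs_det_fderiv_smul volume hTo.measurableSet
    (fun y hy => (differentiableAt_boundaryTransition hι hφ hψ hy).hasFDerivAt.hasFDerivWithinAt)
    (injOn_boundaryTransition hι hφ), ← integral_neg]
  have h2 : ∫ y in T, g.boundaryDensity ι ψ u y * v (ι ((ψ.extend (𝓡 m)).symm y)) =
      ∫ y in (ψ.extend (𝓡 m)).target,
        g.boundaryDensity ι ψ u y * v (ι ((ψ.extend (𝓡 m)).symm y)) := by
    symm
    refine setIntegral_eq_of_subset_of_forall_sdiff_eq_zero
      (isOpen_extend_target_model ψ).measurableSet inter_subset_left fun y hy => ?_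
    by_contra hne
    exact hy.2 ⟨hy.1, hvφ _ (right_ne_zero_of_mul hne)⟩
  rw [← h2]
  refine setIntegral_congr_fun hTo.measurableSet fun y hy => ?_
  have hyφ : ι ((ψ.extend (𝓡 m)).symm y) ∈ φ.source := hy.2
  have hx : φ.extend (𝓡∂ (m + 1)) (ι ((ψ.extend (𝓡 m)).symm y)) ∈
    (φ.extend (𝓡∂ (m + 1))).target := PartialEquiv.map_source _ (by simpa using hyφ)
  change -(|(fderiv ℝ (boundaryTransition φ ι ψ) y).det| • _) = _
  rw [halfSpaceBoundary_boundaryTransition hι hφ hy.2, fluxField, indicator_of_mem hx,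
    smul_eq_mul, ← mul_assoc, g.abs_det_mul_flux hι hφ hψ hy hu huδ, localRep,
    Function.comp_apply, PartialEquiv.left_inv _ (by simpa using hyφ), neg_mul, neg_neg]

include hι hψ in
-- Nothing is known about how the chosen normals vary with the point, so continuity is read off from
-- the flux side of `abs_det_mul_flux`.
theorem FermiMetric.continuousOn_boundaryDensity {u : S → ℝ}
    (hu : ContMDiff (𝓡∂ (m + 1)) 𝓘(ℝ, ℝ) 2 u) (huδ : ∀ p, u p ∈ Ioo (-δ) δ) :
    ContinuousOn (g.boundaryDensity ι ψ u) (ψ.extend (𝓡 m)).target := by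
  intro y hy
  refine ContinuousAt.continuousWithinAt ?_
  set φ := chartAt (EuclideanHalfSpace (m + 1)) (ι ((ψ.extend (𝓡 m)).symm y))
  have hφ : φ ∈ IsManifold.maximalAtlas (𝓡∂ (m + 1)) ∞ S := IsManifold.chart_mem_maximalAtlas _
  have hyφ : ι ((ψ.extend (𝓡 m)).symm y) ∈ φ.source := mem_chart_source _ _
  have hx : φ.extend (𝓡∂ (m + 1)) (ι ((ψ.extend (𝓡 m)).symm y)) ∈
    (φ.extend (𝓡∂ (m + 1))).target := PartialEquiv.map_source _ (by simpa using hyφ)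
  have hyT : y ∈ (ψ.extend (𝓡 m)).target ∩ (ι ∘ (ψ.extend (𝓡 m)).symm) ⁻¹' φ.source := ⟨hy, hyφ⟩
  have hTn := (isOpen_boundaryTransition_domain (φ := φ) (ψ := ψ) hι).mem_nhds hyT
  have hev : (fun z => -(|(fderiv ℝ (boundaryTransition φ ι ψ) z).det| *
      g.flux φ u (φ.extend (𝓡∂ (m + 1)) (ι ((ψ.extend (𝓡 m)).symm z))) 0)) =ᶠ[𝓝 y]
      g.boundaryDensity ι ψ u := by
    filter_upwards [hTn] with z hz
    rw [g.abs_det_mul_flux hι hφ hψ hz (hu.of_le (by norm_num)) huδ, neg_neg]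
  refine ContinuousAt.congr ?_ hev
  have h1 : ContinuousAt (fderiv ℝ (boundaryTransition φ ι ψ)) y :=
    ((contDiffOn_boundaryTransition hι hφ hψ).contDiffAt hTn).continuousAt_fderiv (by simp)
  have h2 : ContinuousAt (fun z => (fderiv ℝ (boundaryTransition φ ι ψ) z).det) y :=
    ContinuousLinearMap.continuous_det.continuousAt.comp h1
  have h3 : ContinuousAt
      (fun z => φ.extend (𝓡∂ (m + 1)) (ι ((ψ.extend (𝓡 m)).symm z))) y :=
    ContinuousAt.comp (f := fun z => ι ((ψ.extend (𝓡 m)).symm z)) (φ.continuousAt_extend hyφ)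
      (ContinuousAt.comp (g := ι) hι.contMDiff.continuous.continuousAt
        (ψ.continuousAt_extend_symm' hy))
  have h4 : ContinuousAt (fun z =>
      g.flux φ u (φ.extend (𝓡∂ (m + 1)) (ι ((ψ.extend (𝓡 m)).symm z))) 0) y :=
    (g.contDiffWithinAt_flux hφ hx hu huδ 0).continuousWithinAt.tendsto.comp
      (tendsto_nhdsWithin_iff.2 ⟨h3, Filter.Eventually.of_forall fun z => ⟨_, rfl⟩⟩)
  exact (h2.abs.mul h4).neg

end BoundaryData

/-! ### Smooth functions and bumps in the Hölder spaces of the boundary -/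

section SmoothFunctions

variable {n : ℕ} {M : Type*} [TopologicalSpace M]
  [ChartedSpace (EuclideanSpace ℝ (Fin n)) M] [IsManifold (𝓡 n) ∞ M]

theorem ChartCover.compactSpace {E H : Type*} [NormedAddCommGroup E] [NormedSpace ℝ E]
    [TopologicalSpace H] {I : ModelWithCorners ℝ E H} {M : Type*} [TopologicalSpace M]
    [ChartedSpace H M] (B : ChartCover I M) : CompactSpace M := by
  refine ⟨(isCompact_iUnion fun i => B.isCompact_K i).of_isClosed_subset isClosed_univ ?_⟩
  rw [← B.cover]
  exact iUnion_mono fun i => interior_subset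

/-- Smooth functions have finite Hölder norms. -/
theorem holderENorm_lt_top (B : ChartCover (𝓡 n) M) (k : ℕ) {α : ℝ≥0} (hα : α ≤ 1) {f : M → ℝ}
    (hf : ContMDiff (𝓡 n) 𝓘(ℝ, ℝ) ∞ f) : holderENorm B k α f < ⊤ := by
  refine ENNReal.sum_lt_top.2 fun i _ => ?_
  set F := localRep (𝓡 n) (B.chart i) f
  set T := ((B.chart i).extend (𝓡 n)).target
  set K := (B.chart i).extend (𝓡 n) '' B.K i
  have hT : IsOpen T := isOpen_extend_target_model _
  have hKT : K ⊆ T := by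
    rintro _ ⟨p, hp, rfl⟩
    exact PartialEquiv.map_source _ (by simpa using B.K_subset i hp)
  have hKc : IsCompact K := (B.isCompact_K i).image_of_continuousOn
    ((B.chart i).continuousOn_extend.mono (by simpa using B.K_subset i))
  have hF : ∀ j : ℕ, ContDiffOn ℝ j F T := fun j =>
    contDiffOn_localRep (B.chart_mem i) (hf.of_le (by exact_mod_cast le_top))
  have heq : ∀ j, ∀ x ∈ T, iteratedFDerivWithin ℝ j F (range (𝓡 n)) x =
      iteratedFDerivWithin ℝ j F T x := fun j x hx => by
    rw [(𝓡 n).range_eq_univ, iteratedFDerivWithin_univ, iteratedFDerivWithin_of_isOpen j hT hx]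
  refine ENNReal.add_lt_top.2 ⟨ENNReal.sum_lt_top.2 fun j _ => ?_, ?_⟩
  · have hc : ContinuousOn (iteratedFDerivWithin ℝ j F T) K :=
      ((hF j).continuousOn_iteratedFDerivWithin le_rfl hT.uniqueDiffOn).mono hKT
    obtain ⟨C, hC⟩ := hKc.exists_bound_of_continuousOn hc
    refine lt_of_le_of_lt (iSup_le fun x => ?_) (ENNReal.coe_lt_top (r := C.toNNReal))
    rw [heq j x (hKT x.2), ENNReal.coe_le_coe, ← NNReal.coe_le_coe, coe_nnnorm]
    exact (hC x x.2).trans (Real.le_coe_toNNReal C)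
  · have h1 : ContDiffOn ℝ 1 (iteratedFDerivWithin ℝ k F T) T := by
      refine fun x hx => (hF (k + 1) x hx).iteratedFDerivWithin_right hT.uniqueDiffOn ?_ hx
      push_cast
      rw [add_comm]
    -- The k-th derivative of F is C¹, hence Lipschitz on the compact set K; on a bounded set this
    -- implies Hölder continuity of every exponent α ≤ 1.
    have h2 : LocallyLipschitzOn K (iteratedFDerivWithin ℝ k F T) := by
      intro x hx
      obtain ⟨C, t, ht, hL⟩ := (h1.contDiffAt (hT.mem_nhds (hKT hx))).exists_lipschitzOnWith
      exact ⟨C, t, mem_nhdsWithin_of_mem_nhds ht, hL⟩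
    obtain ⟨C, hC⟩ := h2.exists_lipschitzOnWith_of_compact hKc
    rw [eHolderNorm_lt_top]
    have h3 : HolderWith C 1 (fun x : K => iteratedFDerivWithin ℝ k F (range (𝓡 n)) (x : _)) := by
      rw [holderWith_one]
      intro x y
      beta_reduce
      rw [heq k x (hKT x.2), heq k y (hKT y.2)]
      exact hC x.2 y.2
    have : BoundedSpace K := boundedSpace_val_set_iff.2 hKc.isBounded
    exact h3.memHolder.of_le hα

/-- A smooth function as an element of the Hölder space. -/
def smoothSubspace.mk (B : ChartCover (𝓡 n) M) {α : ℝ≥0} (hα : α ≤ 1) {f : M → ℝ}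
    (hf : ContMDiff (𝓡 n) 𝓘(ℝ, ℝ) ∞ f) : smoothSubspace B α :=
  ⟨(⟨f, hf.of_le (WithTop.coe_le_coe.2 (le_top : ((2 : ℕ) : ℕ∞) ≤ ⊤)), holderENorm_lt_top B 2 hα hf⟩ :
    holderSubmodule B 2 α), hf⟩

theorem smoothSubspace.exists_bump [T2Space M] (B : ChartCover (𝓡 n) M) {α : ℝ≥0} (hα : α ≤ 1)
    {q : M} {V : Set M} (hV : V ∈ 𝓝 q) :
    ∃ η : smoothSubspace B α, (∀ p, 0 ≤ (η : HolderSpace B 2 α) p) ∧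
      0 < (η : HolderSpace B 2 α) q ∧ tsupport (η : HolderSpace B 2 α) ⊆ V := by
  obtain ⟨f, -, hf⟩ := (SmoothBumpFunction.nhds_basis_tsupport (I := 𝓡 n) q).mem_iff.1 hV
  exact ⟨smoothSubspace.mk B hα f.contMDiff, fun p => f.nonneg, by
    change 0 < f q
    rw [f.eq_one]; exact one_pos, hf⟩

open MeasureTheory in
theorem integrableOn_mul_comp_extend_symm [CompactSpace M]
    {ψ : OpenPartialHomeomorph M (EuclideanSpace ℝ (Fin n))} {J : EuclideanSpace ℝ (Fin n) → ℝ}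
    (hJ : ContinuousOn J (ψ.extend (𝓡 n)).target) {f : M → ℝ} (hf : Continuous f)
    (hs : tsupport f ⊆ ψ.source) :
    IntegrableOn (fun y => J y * f ((ψ.extend (𝓡 n)).symm y)) (ψ.extend (𝓡 n)).target := by
  have hK : IsCompact (ψ.extend (𝓡 n) '' tsupport f) :=
    (isClosed_tsupport f).isCompact.image_of_continuousOn
      (ψ.continuousOn_extend.mono (by simpa using hs))
  have hKT : ψ.extend (𝓡 n) '' tsupport f ⊆ (ψ.extend (𝓡 n)).target := by
    rintro _ ⟨p, hp, rfl⟩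
    exact PartialEquiv.map_source _ (by simpa using hs hp)
  have hc : ContinuousOn (fun y => J y * f ((ψ.extend (𝓡 n)).symm y)) (ψ.extend (𝓡 n)).target :=
    hJ.mul (hf.comp_continuousOn ψ.continuousOn_extend_symm)
  refine ((hc.mono hKT).integrableOn_compact hK).of_forall_sdiff_eq_zero
    (isOpen_extend_target_model ψ).measurableSet ?_
  rintro y ⟨hy, hyK⟩
  by_contra hne
  exact hyK ⟨_, subset_tsupport f (right_ne_zero_of_mul hne), PartialEquiv.right_inv _ hy⟩

end SmoothFunctions

/-! ### The derivative of the volume with respect to the boundary values -/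

section FirstVariation

open MeasureTheory

variable {m : ℕ} {S : Type*} [TopologicalSpace S] [ChartedSpace (EuclideanHalfSpace (m + 1)) S]
  [IsManifold (𝓡∂ (m + 1)) ∞ S] [T2Space S] [CompactSpace S] {M : Type*} [TopologicalSpace M]
  [ChartedSpace (EuclideanSpace ℝ (Fin m)) M] [IsManifold (𝓡 m) ∞ M]
  {ι : M → S} (hι : IsBoundaryEmbedding m ι)
  {ψ : OpenPartialHomeomorph M (EuclideanSpace ℝ (Fin m))}
  (hψ : ψ ∈ IsManifold.maximalAtlas (𝓡 m) ∞ M)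
  {δ ε r : ℝ} {g : FermiMetric m S δ} {A : ChartCover (𝓡∂ (m + 1)) S} {B : ChartCover (𝓡 m) M}
  {α : ℝ≥0} {u : smoothSubspace B α → HolderSpace A 2 α}

namespace FermiMetric.IsSolutionMap

variable (hu : g.IsSolutionMap ι A B α ε r u)

include hu in
theorem mem_Ioo (hr : r < δ) {h : smoothSubspace B α} (hh : h ∈ Metric.ball 0 ε) (p : S) :
    u h p ∈ Ioo (-δ) δ :=
  abs_lt.1 (((u h).abs_apply_le p).trans_lt ((hu.norm_le h hh).trans_lt hr))

include hu in
theorem comp_eq {h : smoothSubspace B α} (hh : h ∈ Metric.ball 0 ε) :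
    (u h).toFun ∘ ι = (h : HolderSpace B 2 α).toFun :=
  funext fun p => hu.boundary h hh p

theorem eventually_mem_ball {h : smoothSubspace B α} (hh : h ∈ Metric.ball 0 ε)
    (η : smoothSubspace B α) : ∀ᶠ t : ℝ in 𝓝 0, h + t • η ∈ Metric.ball 0 ε := by
  have hc : Continuous fun t : ℝ => h + t • η := by fun_prop
  refine hc.continuousAt.preimage_mem_nhds (Metric.isOpen_ball.mem_nhds ?_)
  simpa using hh

include hι hψ hu in
/-- The first variation of the volume with respect to the boundary values. -/
theorem hasDerivAt_volMap [T2Space M] (hdu : DifferentiableOn ℝ u (Metric.ball 0 ε)) (hr : r < δ)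
    {h : smoothSubspace B α} (hh : h ∈ Metric.ball 0 ε) {η : smoothSubspace B α}
    (hη : tsupport (η : HolderSpace B 2 α) ⊆ ψ.source) :
    HasDerivAt (fun t : ℝ => g.volMap u (h + t • η))
      (∫ y in (ψ.extend (𝓡 m)).target, g.boundaryDensity ι ψ (u h) y *
        (η : HolderSpace B 2 α) ((ψ.extend (𝓡 m)).symm y)) 0 := by
  have : CompactSpace M := B.compactSpace
  have hline : HasDerivAt (fun t : ℝ => h + t • η) η 0 := by
    simpa using ((hasDerivAt_id (0 : ℝ)).smul_const η).const_add h
  have hdu' : HasFDerivAt u (fderiv ℝ u h) (h + (0 : ℝ) • η) := by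
    rw [zero_smul, add_zero]
    exact ((hdu h hh).differentiableAt (Metric.isOpen_ball.mem_nhds hh)).hasFDerivAt
  set w := fderiv ℝ u h η with hw
  have hU : HasDerivAt (fun t : ℝ => u (h + t • η)) w 0 := hdu'.comp_hasDerivAt 0 hline
  have hball := eventually_mem_ball hh η
  have hU0 : u (h + (0 : ℝ) • η) = u h := by rw [zero_smul, add_zero]
  -- Differentiates u_{h+tη} ∘ ι = h + tη at t = 0.
  have hwι : ∀ p, w (ι p) = (η : HolderSpace B 2 α) p := by
    intro p
    have h1 : HasDerivAt (fun t : ℝ => u (h + t • η) (ι p)) (w (ι p)) 0 :=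
      (HolderSpace.evalCLM (ι p)).hasFDerivAt.comp_hasDerivAt 0 hU
    have h2 : HasDerivAt (fun t : ℝ => ((h + t • η : smoothSubspace B α) : HolderSpace B 2 α) p)
        ((η : HolderSpace B 2 α) p) 0 :=
      ((HolderSpace.evalCLM p).comp (smoothSubspace B α).subtypeL).hasFDerivAt.comp_hasDerivAt 0
        hline
    refine h1.unique (h2.congr_of_eventuallyEq ?_)
    filter_upwards [hball] with t ht using hu.boundary _ ht p
  have hsol := hu.solves h hh
  have huδ := hu.mem_Ioo hr hh
  obtain ⟨χ, hχ⟩ := SmoothPartitionOfUnity.exists_isSubordinate (𝓡∂ (m + 1)) (isClosed_univ (X := S))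
    (fun i : Fin A.N => (A.chart i).source) (fun i => (A.chart i).open_source) (by
      rw [← A.cover]
      exact iUnion_mono fun i => interior_subset.trans (A.K_subset i))
  have key := FermiMetric.SolvesMinimalSurfaceEq.hasDerivAt_graphVolume hU
    (by rw [hU0]; exact hsol) hr (by filter_upwards [hball] with t ht using hu.norm_le _ ht)
  have hw1 : ContMDiff (𝓡∂ (m + 1)) 𝓘(ℝ, ℝ) 1 w.toFun := w.mem.1.of_le (by norm_num)
  rw [hU0, hsol.sum_integral_areaVar (u h).mem.1 huδ A hw1 χ hχ] at key
  refine HasDerivAt.congr_deriv key ?_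
  have hwψ : ∀ j, ∀ q, χ j (ι q) * w (ι q) ≠ 0 → q ∈ ψ.source := fun j q hq => by
    rw [hwι] at hq
    exact hη (subset_tsupport _ (right_ne_zero_of_mul hq))
  have h1 : ∀ j, -∫ z, g.fluxField (A.chart j) (u h) (fun p => χ j p * w p) 0
      (halfSpaceBoundary z) = ∫ y in (ψ.extend (𝓡 m)).target, g.boundaryDensity ι ψ (u h) y *
        (χ j (ι ((ψ.extend (𝓡 m)).symm y)) * w (ι ((ψ.extend (𝓡 m)).symm y))) := fun j =>
    g.neg_integral_fluxField hι (A.chart_mem j) hψ ((u h).mem.1.of_le (by norm_num)) huδ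
      (fun p hp => hχ j (subset_tsupport _ (left_ne_zero_of_mul hp))) (hwψ j)
  -- All terms are now integrals in the single boundary chart ψ, where the partition functions χ_j
  -- add up to 1.
  rw [Finset.sum_congr rfl fun j _ => h1 j]
  simp only [hwι]
  have hηc : Continuous (η : HolderSpace B 2 α) := (η : HolderSpace B 2 α).mem.1.continuous
  rw [← integral_finsetSum]
  · refine integral_congr_ae (Filter.Eventually.of_forall fun y => ?_)
    have hχ1 := χ.sum_eq_one (mem_univ (ι ((ψ.extend (𝓡 m)).symm y)))
    rw [finsum_eq_sum_of_fintype] at hχ1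
    beta_reduce
    rw [← Finset.mul_sum, ← Finset.sum_mul, hχ1, one_mul]
  · intro j _
    exact integrableOn_mul_comp_extend_symm (f := fun p => χ j (ι p) * (η : HolderSpace B 2 α) p)
      (g.continuousOn_boundaryDensity hι hψ (u h).mem.1 huδ)
      (((χ j).contMDiff.continuous.comp hι.contMDiff.continuous).mul hηc)
      ((tsupport_mul_subset_right (f := fun p => χ j (ι p)) (g := (η : HolderSpace B 2 α))).trans hη)

end FermiMetric.IsSolutionMap

end FirstVariation

/-! ### Symmetry of iterated derivatives, polarization and Taylor expansion along lines -/

section HigherDerivatives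

variable {E F : Type*} [NormedAddCommGroup E] [NormedSpace ℝ E] [NormedAddCommGroup F]
  [NormedSpace ℝ F]

theorem iteratedFDeriv_succ_cons {f : E → F} {x : E} {n : ℕ} (hf : ContDiffAt ℝ (n + 1) f x)
    (w : E) (v : Fin n → E) :
    iteratedFDeriv ℝ (n + 1) f x (Fin.cons w v) =
      fderiv ℝ (fun y => iteratedFDeriv ℝ n f y v) x w := by
  have hd : DifferentiableAt ℝ (iteratedFDeriv ℝ n f) x :=
    hf.differentiableAt_iteratedFDeriv (by exact_mod_cast lt_add_one n)
  rw [hd.iteratedFDeriv_succ_apply_left']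
  simp

/-- The iterated derivatives of a `C^n` function are symmetric. -/
theorem ContDiffAt.iteratedFDeriv_comp_perm_real {f : E → F} {x : E} {n : ℕ}
    (hf : ContDiffAt ℝ n f x) (σ : Equiv.Perm (Fin n)) (v : Fin n → E) :
    iteratedFDeriv ℝ n f x (v ∘ σ) = iteratedFDeriv ℝ n f x v := by
  induction n generalizing x with
  | zero => rw [Subsingleton.elim (v ∘ σ) v]
  | succ n ih =>
    have hf' : ContDiffAt ℝ (n + 1) f x := by exact_mod_cast hf
    -- Such σ permutes the arguments of the inner n-th derivative; the induction hypothesis holds at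
    -- all nearby points and can therefore be differentiated.
    have hfix : ∀ (σ : Equiv.Perm (Fin (n + 1))), σ 0 = 0 → ∀ v : Fin (n + 1) → E,
        iteratedFDeriv ℝ (n + 1) f x (v ∘ σ) = iteratedFDeriv ℝ (n + 1) f x v := by
      intro σ hσ v
      obtain ⟨e, rfl⟩ : ∃ e : Equiv.Perm (Fin n), σ = Equiv.Perm.decomposeFin.symm (0, e) := by
        refine ⟨(Equiv.Perm.decomposeFin σ).2, ?_⟩
        rw [Equiv.eq_symm_apply]
        refine Prod.ext ?_ rfl
        have h := Equiv.Perm.decomposeFin_symm_apply_zero (Equiv.Perm.decomposeFin σ).1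
          (Equiv.Perm.decomposeFin σ).2
        rw [Prod.mk.eta, Equiv.symm_apply_apply, hσ] at h
        exact h.symm
      have h1 : v = Fin.cons (v 0) (Fin.tail v) := (Fin.cons_self_tail v).symm
      have h2 : v ∘ Equiv.Perm.decomposeFin.symm (0, e) = Fin.cons (v 0) (Fin.tail v ∘ e) := by
        funext i
        refine Fin.cases ?_ (fun j => ?_) i
        · simp
        · simp [Fin.tail]
      rw [h2]
      conv_rhs => rw [h1]
      rw [iteratedFDeriv_succ_cons hf', iteratedFDeriv_succ_cons hf']
      have hev : (fun y => iteratedFDeriv ℝ n f y (Fin.tail v ∘ e)) =ᶠ[𝓝 x]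
          fun y => iteratedFDeriv ℝ n f y (Fin.tail v) := by
        filter_upwards [(hf'.of_le (by norm_num) : ContDiffAt ℝ n f x).eventually (by simp)]
          with y hy using ih hy e _
      rw [hev.fderiv_eq]
    -- Exchanging 0 and 1 is the symmetry of second derivatives; the general transposition (0 p) is
    -- conjugate to it by (1 p), which fixes 0.
    have hswap : ∀ p : Fin (n + 1), ∀ v : Fin (n + 1) → E,
        iteratedFDeriv ℝ (n + 1) f x (v ∘ Equiv.swap 0 p) = iteratedFDeriv ℝ (n + 1) f x v := by
      rcases n with _ | n
      · intro p v
        rw [Fin.fin_one_eq_zero p, Equiv.swap_self]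
        rfl
      have h01 : ∀ v : Fin (n + 2) → E, iteratedFDeriv ℝ (n + 2) f x (v ∘ Equiv.swap 0 1) =
          iteratedFDeriv ℝ (n + 2) f x v := by
        intro v
        have hsm : ∀ w : Fin n → E, ContDiffAt ℝ 2 (fun y => iteratedFDeriv ℝ n f y w) x := by
          intro w
          have h := hf'.iteratedFDeriv_right (i := n) (m := 2) (by push_cast; ring_nf; rfl)
          exact (ContinuousMultilinearMap.apply ℝ (fun _ : Fin n => E) F w).contDiff.contDiffAt.comp
            x h
        have hform : ∀ (a b : E) (w : Fin n → E),
            iteratedFDeriv ℝ (n + 2) f x (Fin.cons a (Fin.cons b w)) =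
              fderiv ℝ (fderiv ℝ (fun y => iteratedFDeriv ℝ n f y w)) x a b := by
          intro a b w
          rw [iteratedFDeriv_succ_cons hf']
          have hev : (fun y => iteratedFDeriv ℝ (n + 1) f y (Fin.cons b w)) =ᶠ[𝓝 x]
              fun y => fderiv ℝ (fun z => iteratedFDeriv ℝ n f z w) y b := by
            filter_upwards [(hf'.of_le (by norm_num) :
              ContDiffAt ℝ (n + 1 : ℕ) f x).eventually (by simp)] with y hy
            exact iteratedFDeriv_succ_cons (by exact_mod_cast hy) b w
          rw [hev.fderiv_eq]
          have hφ1 : DifferentiableAt ℝ (fderiv ℝ (fun y => iteratedFDeriv ℝ n f y w)) x :=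
            ((hsm w).fderiv_right (m := 1) (by norm_num)).differentiableAt (by norm_num)
          rw [(hφ1.hasFDerivAt.clm_apply (hasFDerivAt_const b x)).fderiv]
          simp
        have hsymm : ∀ (a b : E) (w : Fin n → E),
            iteratedFDeriv ℝ (n + 2) f x (Fin.cons a (Fin.cons b w)) =
              iteratedFDeriv ℝ (n + 2) f x (Fin.cons b (Fin.cons a w)) := by
          intro a b w
          rw [hform, hform]
          exact (hsm w).isSymmSndFDerivAt (by simp) a b
        have hv : v = Fin.cons (v 0) (Fin.cons (v 1) (Fin.tail (Fin.tail v))) := by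
          funext i
          refine Fin.cases rfl (fun j => Fin.cases rfl (fun k => rfl) j) i
        have hv' : v ∘ Equiv.swap 0 1 = Fin.cons (v 1) (Fin.cons (v 0) (Fin.tail (Fin.tail v))) := by
          funext i
          refine Fin.cases ?_ (fun j => Fin.cases ?_ (fun k => ?_) j) i
          · simp
          · simp
          · have h0 : k.succ.succ ≠ (0 : Fin (n + 2)) := Fin.succ_ne_zero _
            have h1 : k.succ.succ ≠ (1 : Fin (n + 2)) := fun h =>
              Fin.succ_ne_zero k (Fin.succ_injective _ h)
            rw [Function.comp_apply, Equiv.swap_apply_of_ne_of_ne h0 h1]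
            rfl
        rw [hv', hsymm, ← hv]
      intro p v
      rcases eq_or_ne p 0 with rfl | hp
      · rw [Equiv.swap_self]
        rfl
      have hτ0 : Equiv.swap 1 p 0 = 0 := Equiv.swap_apply_of_ne_of_ne (by simp) hp.symm
      have hcomm : Equiv.swap 0 p * Equiv.swap 1 p = Equiv.swap 1 p * Equiv.swap 0 1 := by
        rw [Equiv.mul_swap_eq_swap_mul (Equiv.swap 1 p) 0 1, hτ0, Equiv.swap_apply_left]
      rw [← hfix _ hτ0 (v ∘ Equiv.swap 0 p), Function.comp_assoc, ← Equiv.Perm.coe_mul, hcomm,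
        Equiv.Perm.coe_mul, ← Function.comp_assoc, h01, hfix _ hτ0]
    -- The second factor fixes 0.
    have hdec : σ = Equiv.swap 0 (σ 0) * (Equiv.swap 0 (σ 0) * σ) := by
      rw [← mul_assoc, Equiv.swap_mul_self, one_mul]
    rw [hdec, Equiv.Perm.coe_mul, ← Function.comp_assoc, hfix _ (by simp), hswap]

/-- The iterated derivative of a `C^n` function is determined by its values on the diagonal. -/
theorem ContDiffAt.iteratedFDeriv_eq_zero_of_diagonal {f : E → F} {x : E} {n : ℕ}
    (hf : ContDiffAt ℝ n f x) (h : ∀ v, iteratedFDeriv ℝ n f x (fun _ => v) = 0) :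
    iteratedFDeriv ℝ n f x = 0 := by
  ext v
  -- Polarization: the n-th derivative of the zero function v ↦ T(v, …, v) is the sum of T over all
  -- permutations of the arguments, which is n! T by symmetry.
  have h1 := (iteratedFDeriv ℝ n f x).iteratedFDeriv_comp_diagonal 0 v
  have h2 : (fun v => iteratedFDeriv ℝ n f x fun _ => v) = fun _ => (0 : F) := funext h
  rw [h2] at h1
  have h3 : ∀ σ : Equiv.Perm (Fin n), iteratedFDeriv ℝ n f x (fun i => v (σ i)) =
      iteratedFDeriv ℝ n f x v := fun σ => hf.iteratedFDeriv_comp_perm_real σ v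
  have h4 : iteratedFDeriv ℝ n (fun _ : E => (0 : F)) 0 v = 0 := by
    have : iteratedFDeriv ℝ n (fun _ : E => (0 : F)) = 0 := iteratedFDeriv_fun_zero
    rw [this]
    rfl
  rw [h4] at h1
  simp only [h3, Finset.sum_const, Finset.card_univ] at h1
  rw [← Nat.cast_smul_eq_nsmul ℝ] at h1
  rcases smul_eq_zero.1 h1.symm with h5 | h5
  · exact absurd h5 (by exact_mod_cast Fintype.card_ne_zero)
  · exact h5

/-- A Taylor expansion for functions with a prescribed sequence of derivatives, all of which but the
last one vanish at `0`. -/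
theorem isLittleO_of_hasDerivAt_sequence {n : ℕ} {G : ℕ → ℝ → F}
    (hG : ∀ i < n, ∀ᶠ t in 𝓝 0, HasDerivAt (G i) (G (i + 1) t) t) (h0 : ∀ i < n, G i 0 = 0)
    (hn : ContinuousAt (G n) 0) :
    (fun t : ℝ => G 0 t - (t ^ n / n.factorial) • G n 0) =o[𝓝 0] fun t => t ^ n := by
  induction n generalizing G with
  | zero =>
    simp only [pow_zero, Nat.factorial_zero, Nat.cast_one, div_one, one_smul]
    rw [Asymptotics.isLittleO_one_iff]
    have h : Filter.Tendsto (G 0) (𝓝 0) (𝓝 (G 0 0)) := hn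
    simpa using h.sub_const (G 0 0)
  | succ n ih =>
    -- The shifted sequence gives the expansion of the derivative G 1; integrating it raises the
    -- order by one.
    have h1 := ih (G := fun i => G (i + 1)) (fun i hi => hG (i + 1) (by omega))
      (fun i hi => h0 (i + 1) (by omega)) hn
    obtain ⟨ρ, hρ, hball⟩ := Metric.eventually_nhds_iff_ball.1 (hG 0 (by omega))
    have hderiv : ∀ t ∈ Metric.ball (0 : ℝ) ρ, HasDerivWithinAt
        (fun t : ℝ => G 0 t - (t ^ (n + 1) / (n + 1).factorial) • G (n + 1) 0)
        (G 1 t - (t ^ n / n.factorial) • G (n + 1) 0) (Metric.ball 0 ρ) t := by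
      intro t ht
      have h2 : HasDerivAt (fun t : ℝ => t ^ (n + 1) / ((n + 1).factorial : ℝ))
          (t ^ n / n.factorial) t := by
        refine ((hasDerivAt_pow (n + 1) t).div_const _).congr_deriv ?_
        rw [Nat.factorial_succ]
        have := Nat.factorial_pos n
        push_cast
        field_simp
      exact ((hball t ht).sub (h2.smul_const _)).hasDerivWithinAt
    have h3 := (convex_ball (0 : ℝ) ρ).isLittleO_pow_succ_real (Metric.mem_ball_self hρ) hderiv
      (n := n) (by
        rw [nhdsWithin_eq_nhds.2 (Metric.ball_mem_nhds _ hρ)]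
        simpa using h1)
    rw [nhdsWithin_eq_nhds.2 (Metric.ball_mem_nhds _ hρ)] at h3
    simpa [h0 0 (by omega)] using h3

/-- A Taylor expansion along a line. -/
theorem ContDiffAt.isLittleO_line {f : E → F} {n : ℕ} (hf : ContDiffAt ℝ n f 0) (h : E)
    (h0 : ∀ i < n, iteratedFDeriv ℝ i f 0 (fun _ => h) = 0) :
    (fun t : ℝ => f (t • h) - (t ^ n / n.factorial) • iteratedFDeriv ℝ n f 0 (fun _ => h)) =o[𝓝 0]
      fun t => t ^ n := by
  have hline : Filter.Tendsto (fun t : ℝ => t • h) (𝓝 0) (𝓝 0) := by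
    have : Continuous fun t : ℝ => t • h := by fun_prop
    simpa using this.tendsto 0
  have key := isLittleO_of_hasDerivAt_sequence (n := n)
    (G := fun i t => iteratedFDeriv ℝ i f (t • h) fun _ => h) ?_ (by simpa using h0) ?_
  · simpa using key
  · intro i hi
    filter_upwards [hline.eventually (hf.eventually (by simp))] with t ht
    have hd : DifferentiableAt ℝ (iteratedFDeriv ℝ i f) (t • h) :=
      ht.differentiableAt_iteratedFDeriv (by exact_mod_cast hi)
    have h1 := (hd.hasFDerivAt.comp_hasDerivAt t
      (f := fun t : ℝ => t • h) ((hasDerivAt_id t).smul_const h))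
    have h2 := (ContinuousMultilinearMap.apply ℝ (fun _ : Fin i => E) F
      fun _ => h).hasFDerivAt.comp_hasDerivAt t h1
    refine h2.congr_deriv ?_
    rw [one_smul, iteratedFDeriv_succ_apply_left]
    rfl
  · have h1 : ContinuousAt (iteratedFDeriv ℝ n f) 0 :=
      (hf.iteratedFDeriv_right (m := 0) (i := n) (by simp)).continuousAt
    have h2 : ContinuousAt (fun x => iteratedFDeriv ℝ n f x fun _ => h) 0 :=
      (ContinuousMultilinearMap.apply ℝ (fun _ : Fin n => E) F
        fun _ => h).continuous.continuousAt.comp h1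
    have h3 : Filter.Tendsto (fun t : ℝ => iteratedFDeriv ℝ n f (t • h) fun _ => h) (𝓝 0)
      (𝓝 (iteratedFDeriv ℝ n f 0 fun _ => h)) := h2.tendsto.comp hline
    simpa [ContinuousAt] using h3

/-- If all derivatives of `V` at `0` up to the order `k + 1` vanish, then those of its derivative
in a fixed direction vanish up to the order `k`, and it is small along lines. -/
theorem ContDiffAt.isLittleO_fderiv_line {V : E → ℝ} {k : ℕ} (hV : ContDiffAt ℝ (k + 1) V 0)
    (h0 : ∀ j ≤ k + 1, iteratedFDeriv ℝ j V 0 = 0) (h η : E) :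
    (fun t : ℝ => fderiv ℝ V (t • h) η) =o[𝓝 0] fun t => t ^ k := by
  have h1 : ContDiffAt ℝ k (fderiv ℝ V) 0 := hV.fderiv_right le_rfl
  have h2 : ∀ i ≤ k, iteratedFDeriv ℝ i (fderiv ℝ V) 0 = 0 := fun i hi => by
    rw [← norm_eq_zero, norm_iteratedFDeriv_fderiv, h0 (i + 1) (by omega), norm_zero]
  have h3 : ∀ i ≤ k, iteratedFDeriv ℝ i (fun x => fderiv ℝ V x η) 0 = 0 := fun i hi => by
    have h4 := (ContinuousLinearMap.apply ℝ ℝ η).iteratedFDeriv_comp_left h1 (i := i)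
      (by exact_mod_cast hi)
    rw [h2 i hi] at h4
    refine h4.trans ?_
    ext
    simp
  have h5 := ContDiffAt.isLittleO_line (f := fun x => fderiv ℝ V x η) (n := k)
    (h1.clm_apply contDiffAt_const) h fun i hi => by rw [h3 i hi.le]; rfl
  rw [h3 k le_rfl] at h5
  simpa using h5

end HigherDerivatives

/-! ### Monotonicity of the conormal density in the normal derivative -/

section ConormalDensity

variable {m : ℕ}

theorem Matrix.PosDef.quadForm_inv_nonneg {γ : Matrix (Fin m) (Fin m) ℝ} (hγ : γ.PosDef)
    (d : Fin m → ℝ) : 0 ≤ ∑ a, ∑ b, γ⁻¹ a b * d a * d b := by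
  refine (hγ.inv.posSemidef.dotProduct_mulVec_nonneg d).trans_eq ?_
  simp only [star_trivial, dotProduct, Matrix.mulVec, Finset.mul_sum]
  refine Finset.sum_congr rfl fun a _ => Finset.sum_congr rfl fun b _ => ?_
  ring

theorem hasDerivAt_div_sqrt {c : ℝ} (hc : 0 < c) (x : ℝ) :
    HasDerivAt (fun x => x / √(c + x ^ 2)) (c / ((c + x ^ 2) * √(c + x ^ 2))) x := by
  have hpos : 0 < c + x ^ 2 := by positivity
  have hs : 0 < √(c + x ^ 2) := Real.sqrt_pos.2 hpos
  have hs2 : √(c + x ^ 2) ^ 2 = c + x ^ 2 := Real.sq_sqrt hpos.le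
  have h1 : HasDerivAt (fun x : ℝ => c + x ^ 2) (2 * x) x := by
    simpa using (hasDerivAt_pow 2 x).const_add c
  refine ((hasDerivAt_id x).div (h1.sqrt hpos.ne') hs.ne').congr_deriv ?_
  simp only [id]
  field_simp
  rw [hs2]
  ring

/-- Mean value inequality: the derivative c (c + x²)^(-3/2) is at least (C + B²)^(-3/2) for |x| ≤ B,
because 1 ≤ c ≤ C. The bound does not depend on c. -/
theorem le_div_sqrt_sub_div_sqrt {c C B N₁ N₂ : ℝ} (hc : 1 ≤ c) (hC : c ≤ C) (h₁ : |N₁| ≤ B)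
    (h₂ : |N₂| ≤ B) (h : N₂ ≤ N₁) :
    ((C + B ^ 2) * √(C + B ^ 2))⁻¹ * (N₁ - N₂) ≤
      N₁ / √(c + N₁ ^ 2) - N₂ / √(c + N₂ ^ 2) := by
  have hc0 : 0 < c := by linarith
  have hd := fun x => hasDerivAt_div_sqrt hc0 x
  refine (convex_Icc (-B) B).mul_sub_le_image_sub_of_le_deriv
    (f := fun x => x / √(c + x ^ 2))
    (fun x _ => (hd x).continuousAt.continuousWithinAt)
    (fun x _ => (hd x).differentiableAt.differentiableWithinAt) (fun x hx => ?_) N₂ (abs_le.1 h₂)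
    N₁ (abs_le.1 h₁) h
  rw [(hd x).deriv]
  have hx' := interior_subset hx
  have hxB : x ^ 2 ≤ B ^ 2 := sq_le_sq' hx'.1 hx'.2
  have hpos : 0 < c + x ^ 2 := by positivity
  have hle : c + x ^ 2 ≤ C + B ^ 2 := by linarith
  have h3 : (c + x ^ 2) * √(c + x ^ 2) ≤ (C + B ^ 2) * √(C + B ^ 2) :=
    mul_le_mul hle (Real.sqrt_le_sqrt hle) (Real.sqrt_nonneg _) (hpos.le.trans hle)
  have h4 : 0 < (c + x ^ 2) * √(c + x ^ 2) := mul_pos hpos (Real.sqrt_pos.2 hpos)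
  calc ((C + B ^ 2) * √(C + B ^ 2))⁻¹ ≤ ((c + x ^ 2) * √(c + x ^ 2))⁻¹ := inv_anti₀ h4 h3
    _ = 1 / ((c + x ^ 2) * √(c + x ^ 2)) := (one_div _).symm
    _ ≤ c / ((c + x ^ 2) * √(c + x ^ 2)) := by gcongr

theorem le_conormalDensity_sub {γ : Matrix (Fin m) (Fin m) ℝ} (hγ : γ.PosDef) {d : Fin m → ℝ}
    {σ C B N₁ N₂ : ℝ} (hσ : 0 ≤ σ) (hσγ : σ ≤ √γ.det)
    (hC : 1 + ∑ a, ∑ b, γ⁻¹ a b * d a * d b ≤ C) (h₁ : |N₁| ≤ B) (h₂ : |N₂| ≤ B) (h : N₂ ≤ N₁) :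
    σ * ((C + B ^ 2) * √(C + B ^ 2))⁻¹ * (N₁ - N₂) ≤
      conormalDensity γ d N₁ - conormalDensity γ d N₂ := by
  have hc : 1 ≤ 1 + ∑ a, ∑ b, γ⁻¹ a b * d a * d b := by linarith [hγ.quadForm_inv_nonneg d]
  have h3 := le_div_sqrt_sub_div_sqrt hc hC h₁ h₂ h
  have hC0 : 0 ≤ C := by linarith
  have h4 : 0 ≤ ((C + B ^ 2) * √(C + B ^ 2))⁻¹ * (N₁ - N₂) :=
    mul_nonneg (by positivity) (sub_nonneg.2 h)
  rw [conormalDensity, conormalDensity, ← mul_sub, mul_assoc]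
  exact mul_le_mul hσγ h3 h4 (hσ.trans hσγ)

/-- The quantitative bound with σ = √det γ, C = 1 + |d|² and B the larger of |N₁| and |N₂|. -/
theorem conormalDensity_lt {γ : Matrix (Fin m) (Fin m) ℝ} (hγ : γ.PosDef) {d : Fin m → ℝ}
    {N₁ N₂ : ℝ} (h : N₂ < N₁) : conormalDensity γ d N₂ < conormalDensity γ d N₁ := by
  have hs : 0 < √γ.det := Real.sqrt_pos.2 hγ.det_pos
  have hc := hγ.quadForm_inv_nonneg d
  have h1 := le_conormalDensity_sub hγ (d := d) hs.le le_rfl le_rfl (le_max_left |N₁| |N₂|)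
    (le_max_right _ _) h.le
  refine sub_pos.1 (lt_of_lt_of_le ?_ h1)
  have h2 : 0 < 1 + ∑ a, ∑ b, γ⁻¹ a b * d a * d b + max |N₁| |N₂| ^ 2 := by positivity
  have h3 := Real.sqrt_pos.2 h2
  have h4 := sub_pos.2 h
  positivity

end ConormalDensity

/-! ### Testing with nonnegative bumps -/

section Localization

open MeasureTheory

variable {m : ℕ} {M : Type*} [TopologicalSpace M] [T2Space M]
  [ChartedSpace (EuclideanSpace ℝ (Fin m)) M] [IsManifold (𝓡 m) ∞ M] {B : ChartCover (𝓡 m) M}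
  {ψ : OpenPartialHomeomorph M (EuclideanSpace ℝ (Fin m))}

theorem exists_bump_integral_pos (B : ChartCover (𝓡 m) M) {α : ℝ≥0} (hα : α ≤ 1) {q : M}
    (hq : q ∈ ψ.source) {W : Set M} (hW : W ∈ 𝓝 q) :
    ∃ η : smoothSubspace B α, (∀ p, 0 ≤ (η : HolderSpace B 2 α) p) ∧
      tsupport (η : HolderSpace B 2 α) ⊆ ψ.source ∩ W ∧
      0 < ∫ y in (ψ.extend (𝓡 m)).target, (η : HolderSpace B 2 α) ((ψ.extend (𝓡 m)).symm y) := by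
  have : CompactSpace M := B.compactSpace
  obtain ⟨η, hη0, hηq, hηs⟩ := smoothSubspace.exists_bump B hα
    (Filter.inter_mem (ψ.open_source.mem_nhds hq) hW)
  refine ⟨η, hη0, hηs, ?_⟩
  have hc : Continuous (η : HolderSpace B 2 α) := (η : HolderSpace B 2 α).mem.1.continuous
  have hint := integrableOn_mul_comp_extend_symm (ψ := ψ) (J := fun _ => 1) continuousOn_const hc
    (hηs.trans inter_subset_left)
  simp only [one_mul] at hint
  rw [setIntegral_pos_iff_support_of_nonneg_ae (Filter.Eventually.of_forall fun y => hη0 _) hint]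
  have hO : IsOpen ((ψ.extend (𝓡 m)).target ∩
      (fun y => (η : HolderSpace B 2 α) ((ψ.extend (𝓡 m)).symm y)) ⁻¹' Ioi 0) :=
    (hc.comp_continuousOn ψ.continuousOn_extend_symm).isOpen_inter_preimage
      (isOpen_extend_target_model ψ) isOpen_Ioi
  refine lt_of_lt_of_le (hO.measure_pos volume ⟨ψ.extend (𝓡 m) q,
    PartialEquiv.map_source _ (by simpa using hq), ?_⟩) (measure_mono fun y hy => ⟨?_, hy.1⟩)
  · rw [mem_preimage, PartialEquiv.left_inv _ (by simpa using hq)]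
    exact hηq
  · exact (mem_Ioi.1 hy.2).ne'

theorem mul_integral_le_integral_mul [CompactSpace M] {J : EuclideanSpace ℝ (Fin m) → ℝ}
    (hJ : ContinuousOn J (ψ.extend (𝓡 m)).target) {f : M → ℝ} (hf : Continuous f)
    (hs : tsupport f ⊆ ψ.source) (hf0 : ∀ p, 0 ≤ f p) {κ : ℝ}
    (hκ : ∀ y ∈ (ψ.extend (𝓡 m)).target, f ((ψ.extend (𝓡 m)).symm y) ≠ 0 → κ ≤ J y) :
    κ * ∫ y in (ψ.extend (𝓡 m)).target, f ((ψ.extend (𝓡 m)).symm y) ≤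
      ∫ y in (ψ.extend (𝓡 m)).target, J y * f ((ψ.extend (𝓡 m)).symm y) := by
  rw [← integral_const_mul]
  refine setIntegral_mono_on (integrableOn_mul_comp_extend_symm continuousOn_const hf hs)
    (integrableOn_mul_comp_extend_symm hJ hf hs) (isOpen_extend_target_model ψ).measurableSet
    fun y hy => ?_
  by_cases h : f ((ψ.extend (𝓡 m)).symm y) = 0
  · rw [h, mul_zero, mul_zero]
  · exact mul_le_mul_of_nonneg_right (hκ y hy h) (hf0 _)

end Localization

/-! ### Uniform monotonicity along a line of boundary values -/

section BoundaryDetermination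

open MeasureTheory

variable {m : ℕ} {S : Type*} [TopologicalSpace S] [ChartedSpace (EuclideanHalfSpace (m + 1)) S]
  [IsManifold (𝓡∂ (m + 1)) ∞ S] [T2Space S] [CompactSpace S] {M : Type*} [TopologicalSpace M]
  [ChartedSpace (EuclideanSpace ℝ (Fin m)) M] [IsManifold (𝓡 m) ∞ M]
  {ι : M → S} (hι : IsBoundaryEmbedding m ι)
  {ψ : OpenPartialHomeomorph M (EuclideanSpace ℝ (Fin m))}
  (hψ : ψ ∈ IsManifold.maximalAtlas (𝓡 m) ∞ M)
  {δ ε r : ℝ} {g : FermiMetric m S δ} {A : ChartCover (𝓡∂ (m + 1)) S} {B : ChartCover (𝓡 m) M}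
  {α : ℝ≥0} {u : smoothSubspace B α → HolderSpace A 2 α}

/-- With u_h = h on the boundary, the normal derivative is the only ingredient that is not boundary
data. -/
theorem FermiMetric.IsSolutionMap.boundaryDensity_eq (hu : g.IsSolutionMap ι A B α ε r u)
    {h : smoothSubspace B α} (hh : h ∈ Metric.ball 0 ε) (y : EuclideanSpace ℝ (Fin m)) :
    g.boundaryDensity ι ψ (u h) y =
      conormalDensity (g.boundaryCoeff ι ψ y (localRep (𝓡 m) ψ (h : HolderSpace B 2 α) y))
        (tangentialDu ψ (h : HolderSpace B 2 α) y)
        (g.normalDeriv ι (u h) ((ψ.extend (𝓡 m)).symm y)) := by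
  rw [FermiMetric.boundaryDensity, hu.comp_eq hh, hu.boundary h hh]
  rfl

theorem tangentialDu_smul (t : ℝ) (h : M → ℝ) (y : EuclideanSpace ℝ (Fin m)) (a : Fin m) :
    tangentialDu ψ (t • h) y a = t * tangentialDu ψ h y a := by
  have h1 : localRep (𝓡 m) ψ (t • h) = t • localRep (𝓡 m) ψ h := rfl
  rw [tangentialDu, h1, (𝓡 m).range_eq_univ, fderivWithin_univ, fderiv_const_smul_field,
    tangentialDu, (𝓡 m).range_eq_univ, fderivWithin_univ]
  rfl

include hι hψ in
/-- The conormal density is uniformly increasing in the normal derivative, for boundary values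
`t h` with small `t`, near a given point. -/
theorem FermiMetric.exists_le_conormalDensity_sub (g : FermiMetric m S δ) (hδ : 0 < δ) {h : M → ℝ}
    (hh : ContMDiff (𝓡 m) 𝓘(ℝ, ℝ) 1 h) {y₀ : EuclideanSpace ℝ (Fin m)}
    (hy₀ : y₀ ∈ (ψ.extend (𝓡 m)).target) (b : ℝ) :
    ∃ κ > 0, ∀ᶠ z : ℝ × EuclideanSpace ℝ (Fin m) in 𝓝 (0, y₀), ∀ N₁ N₂ : ℝ, |N₁| ≤ b → |N₂| ≤ b →
      N₂ ≤ N₁ → κ * (N₁ - N₂) ≤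
        conormalDensity (g.boundaryCoeff ι ψ z.2 (z.1 * localRep (𝓡 m) ψ h z.2))
          (fun a => z.1 * tangentialDu ψ h z.2 a) N₁ -
        conormalDensity (g.boundaryCoeff ι ψ z.2 (z.1 * localRep (𝓡 m) ψ h z.2))
          (fun a => z.1 * tangentialDu ψ h z.2 a) N₂ := by
  have h0 : (0 : ℝ) ∈ Ioo (-δ) δ := ⟨by linarith, hδ⟩
  have hTo := isOpen_extend_target_model ψ
  have hTn := hTo.mem_nhds hy₀
  have hloc : ContDiffOn ℝ 1 (localRep (𝓡 m) ψ h) (ψ.extend (𝓡 m)).target := by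
    exact_mod_cast contDiffOn_localRep (k := 1) hψ (by exact_mod_cast hh)
  have hcl : ContinuousAt (fun z : ℝ × EuclideanSpace ℝ (Fin m) =>
      z.1 * localRep (𝓡 m) ψ h z.2) (0, y₀) :=
    continuousAt_fst.mul (ContinuousAt.comp (f := Prod.snd) (x := ((0 : ℝ), y₀))
      (hloc.continuousOn.continuousAt hTn) continuousAt_snd)
  have hcd : ∀ a, ContinuousAt (fun z : ℝ × EuclideanSpace ℝ (Fin m) =>
      z.1 * tangentialDu ψ h z.2 a) (0, y₀) := by
    intro a
    have h1 : ContinuousAt (fun y => tangentialDu ψ h y a) y₀ := by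
      have h2 := ((hloc.contDiffAt hTn).continuousAt_fderiv (by simp)).clm_apply
        (continuousAt_const (y := EuclideanSpace.single a (1 : ℝ)))
      simpa only [tangentialDu, (𝓡 m).range_eq_univ, fderivWithin_univ] using h2
    exact continuousAt_fst.mul (ContinuousAt.comp (f := Prod.snd) (x := ((0 : ℝ), y₀)) h1
      continuousAt_snd)
  have hpair : ContinuousAt (fun z : ℝ × EuclideanSpace ℝ (Fin m) =>
      (z.2, z.1 * localRep (𝓡 m) ψ h z.2)) (0, y₀) := continuousAt_snd.prodMk hcl
  have hpair0 : ((y₀, (0 : ℝ) * localRep (𝓡 m) ψ h y₀) : EuclideanSpace ℝ (Fin m) × ℝ) ∈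
      (ψ.extend (𝓡 m)).target ×ˢ Ioo (-δ) δ := ⟨hy₀, by simpa using h0⟩
  have hPn := (hTo.prod isOpen_Ioo).mem_nhds hpair0
  have hcoeff : ∀ a b, ContDiffWithinAt ℝ 0
      (fun q : EuclideanSpace ℝ (Fin m) × ℝ => g.boundaryCoeff ι ψ q.1 q.2 a b) univ
      (y₀, (0 : ℝ) * localRep (𝓡 m) ψ h y₀) := fun a b =>
    (((g.contDiffOn_boundaryCoeff hι hψ a b).contDiffAt hPn).of_le (by simp)).contDiffWithinAt
  have hγ0 := g.boundaryCoeff_posDef hι hψ hy₀ hpair0.2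
  have hdet : ContinuousAt (fun z : ℝ × EuclideanSpace ℝ (Fin m) =>
      √(g.boundaryCoeff ι ψ z.2 (z.1 * localRep (𝓡 m) ψ h z.2)).det) (0, y₀) := by
    have h1 := (ContDiffWithinAt.matrix_det hcoeff).continuousWithinAt
    rw [continuousWithinAt_univ] at h1
    exact (ContinuousAt.comp (x := ((0 : ℝ), y₀)) h1 hpair).sqrt
  have hinv : ∀ a b, ContinuousAt (fun z : ℝ × EuclideanSpace ℝ (Fin m) =>
      (g.boundaryCoeff ι ψ z.2 (z.1 * localRep (𝓡 m) ψ h z.2))⁻¹ a b) (0, y₀) := by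
    intro a b
    have h1 := (ContDiffWithinAt.matrix_inv hcoeff hγ0.det_pos.ne' a b).continuousWithinAt
    rw [continuousWithinAt_univ] at h1
    exact ContinuousAt.comp (x := ((0 : ℝ), y₀)) h1 hpair
  have hquad : ContinuousAt (fun z : ℝ × EuclideanSpace ℝ (Fin m) =>
      1 + ∑ a, ∑ b, (g.boundaryCoeff ι ψ z.2 (z.1 * localRep (𝓡 m) ψ h z.2))⁻¹ a b *
        (z.1 * tangentialDu ψ h z.2 a) * (z.1 * tangentialDu ψ h z.2 b)) (0, y₀) :=
    continuousAt_const.add (tendsto_finsetSum _ fun a _ => tendsto_finsetSum _ fun b _ =>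
      ((hinv a b).mul (hcd a)).mul (hcd b))
  set σ₀ := √(g.boundaryCoeff ι ψ y₀ (0 * localRep (𝓡 m) ψ h y₀)).det with hσ₀
  have hσ₀pos : 0 < σ₀ := Real.sqrt_pos.2 hγ0.det_pos
  set c₀ := 1 + ∑ a, ∑ b, (g.boundaryCoeff ι ψ y₀ (0 * localRep (𝓡 m) ψ h y₀))⁻¹ a b *
        (0 * tangentialDu ψ h y₀ a) * (0 * tangentialDu ψ h y₀ b) with hc₀
  have hc₀1 : 1 ≤ c₀ := by
    linarith [hγ0.quadForm_inv_nonneg fun a => 0 * tangentialDu ψ h y₀ a]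
  -- By continuity √det γ exceeds σ₀ / 2 and 1 + |d|² stays below c₀ + 1 near (0, y₀). These serve
  -- as σ and C in `le_conormalDensity_sub`, with B = b.
  refine ⟨σ₀ / 2 * ((c₀ + 1 + b ^ 2) * √(c₀ + 1 + b ^ 2))⁻¹, by positivity, ?_⟩
  filter_upwards [hpair.preimage_mem_nhds hPn, hdet.eventually (lt_mem_nhds (half_lt_self hσ₀pos)),
    hquad.eventually (gt_mem_nhds (lt_add_one c₀))] with z hz1 hz2 hz3 N₁ N₂ h₁ h₂ h
  exact le_conormalDensity_sub (g.boundaryCoeff_posDef hι hψ hz1.1 hz1.2) (by positivity) hz2.le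
    hz3.le h₁ h₂ h

end BoundaryDetermination

/-! ### Comparison of two manifolds with the same boundary data -/

section BoundaryDetermination

open MeasureTheory

variable {m : ℕ} {S : Type*} [TopologicalSpace S] [ChartedSpace (EuclideanHalfSpace (m + 1)) S]
  [IsManifold (𝓡∂ (m + 1)) ∞ S] [T2Space S] [CompactSpace S] {M : Type*} [TopologicalSpace M]
  [ChartedSpace (EuclideanSpace ℝ (Fin m)) M] [IsManifold (𝓡 m) ∞ M]
  {ι : M → S} (hι : IsBoundaryEmbedding m ι)
  {ψ : OpenPartialHomeomorph M (EuclideanSpace ℝ (Fin m))}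
  (hψ : ψ ∈ IsManifold.maximalAtlas (𝓡 m) ∞ M)
  {δ ε r : ℝ} {g : FermiMetric m S δ} {A : ChartCover (𝓡∂ (m + 1)) S} {B : ChartCover (𝓡 m) M}
  {α : ℝ≥0} {u : smoothSubspace B α → HolderSpace A 2 α}

include hι in
theorem IsBoundaryEmbedding.t2Space : T2Space M := hι.isEmbedding.t2Space

include hι hψ in
theorem FermiMetric.IsSolutionMap.fderiv_volMap [T2Space M] (hu : g.IsSolutionMap ι A B α ε r u)
    (hdu : DifferentiableOn ℝ u (Metric.ball 0 ε)) (hr : r < δ) {h : smoothSubspace B α}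
    (hh : h ∈ Metric.ball 0 ε) (hV : DifferentiableAt ℝ (g.volMap u) h) {η : smoothSubspace B α}
    (hη : tsupport (η : HolderSpace B 2 α) ⊆ ψ.source) :
    fderiv ℝ (g.volMap u) h η = ∫ y in (ψ.extend (𝓡 m)).target, g.boundaryDensity ι ψ (u h) y *
        (η : HolderSpace B 2 α) ((ψ.extend (𝓡 m)).symm y) := by
  have hline : HasDerivAt (fun t : ℝ => h + t • η) η 0 := by
    simpa using ((hasDerivAt_id (0 : ℝ)).smul_const η).const_add h
  have hV' : HasFDerivAt (g.volMap u) (fderiv ℝ (g.volMap u) h) (h + (0 : ℝ) • η) := by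
    rw [zero_smul, add_zero]
    exact hV.hasFDerivAt
  exact (HasFDerivAt.comp_hasDerivAt (f := fun t : ℝ => h + t • η) (0 : ℝ) hV' hline).unique
    (hu.hasDerivAt_volMap hι hψ hdu hr hh hη)

variable {S' : Type*} [TopologicalSpace S'] [ChartedSpace (EuclideanHalfSpace (m + 1)) S']
  [IsManifold (𝓡∂ (m + 1)) ∞ S'] [T2Space S'] [CompactSpace S'] {ι' : M → S'}
  (hι' : IsBoundaryEmbedding m ι') {g' : FermiMetric m S' δ} {A' : ChartCover (𝓡∂ (m + 1)) S'}
  {u' : smoothSubspace B α → HolderSpace A' 2 α}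
  (hg : ∀ s ∈ Ioo (-δ) δ, ∀ (p : M) (v w : TangentSpace (𝓡 m) p),
      g.val s (ι p) (mfderiv (𝓡 m) (𝓡∂ (m + 1)) ι p v) (mfderiv (𝓡 m) (𝓡∂ (m + 1)) ι p w) =
      g'.val s (ι' p) (mfderiv (𝓡 m) (𝓡∂ (m + 1)) ι' p v)
        (mfderiv (𝓡 m) (𝓡∂ (m + 1)) ι' p w))
  (hu : g.IsSolutionMap ι A B α ε r u) (hdu : DifferentiableOn ℝ u (Metric.ball 0 ε))
  (hu' : g'.IsSolutionMap ι' A' B α ε r u') (hdu' : DifferentiableOn ℝ u' (Metric.ball 0 ε))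
  (hr : r < δ) (hα : α ≤ 1)

include hg in
theorem FermiMetric.boundaryCoeff_congr {s : ℝ} (hs : s ∈ Ioo (-δ) δ)
    (y : EuclideanSpace ℝ (Fin m)) : g.boundaryCoeff ι ψ y s = g'.boundaryCoeff ι' ψ y s := by
  ext a b
  exact hg s hs _ _ _

include hι hι' hg hu hdu hu' hdu' hr hα in
-- A strict reverse inequality at q would make the difference of the conormal densities positive
-- near q. A bump there would give Vol₁ - Vol₂ a positive derivative along h + tη, although it
-- vanishes on the whole ball.
theorem normalDeriv_le_of_volMap_eq
    (hV : ∀ h ∈ Metric.ball (0 : smoothSubspace B α) ε, g.volMap u h = g'.volMap u' h)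
    {h : smoothSubspace B α} (hh : h ∈ Metric.ball 0 ε) (q : M) :
    g.normalDeriv ι (u h) q ≤ g'.normalDeriv ι' (u' h) q := by
  have : T2Space M := hι.t2Space
  have : CompactSpace M := B.compactSpace
  by_contra! hlt
  set ψ := chartAt (EuclideanSpace ℝ (Fin m)) q
  have hψ : ψ ∈ IsManifold.maximalAtlas (𝓡 m) ∞ M := IsManifold.chart_mem_maximalAtlas _
  have hq : q ∈ ψ.source := mem_chart_source _ _
  have hy : ψ.extend (𝓡 m) q ∈ (ψ.extend (𝓡 m)).target :=
    PartialEquiv.map_source _ (by simpa using hq)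
  have hqq : (ψ.extend (𝓡 m)).symm (ψ.extend (𝓡 m) q) = q :=
    PartialEquiv.left_inv _ (by simpa using hq)
  have hc := g.continuousOn_boundaryDensity hι hψ (u h).mem.1 (hu.mem_Ioo hr hh)
  have hc' := g'.continuousOn_boundaryDensity hι' hψ (u' h).mem.1 (hu'.mem_Ioo hr hh)
  set D := fun y => g.boundaryDensity ι ψ (u h) y - g'.boundaryDensity ι' ψ (u' h) y with hD
  have hDc : ContinuousOn D (ψ.extend (𝓡 m)).target := hc.sub hc'
  have hhδ : localRep (𝓡 m) ψ (h : HolderSpace B 2 α) (ψ.extend (𝓡 m) q) ∈ Ioo (-δ) δ := by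
    have h1 := hu.mem_Ioo hr hh (ι q)
    rw [hu.boundary h hh] at h1
    rw [localRep, Function.comp_apply, hqq]
    exact h1
  have hDpos : 0 < D (ψ.extend (𝓡 m) q) := by
    rw [hD]
    beta_reduce
    rw [hu.boundaryDensity_eq hh, hu'.boundaryDensity_eq hh,
      FermiMetric.boundaryCoeff_congr hg hhδ, hqq, sub_pos]
    exact conormalDensity_lt (g'.boundaryCoeff_posDef hι' hψ hy hhδ) hlt
  have hW : ψ.extend (𝓡 m) ⁻¹' {y | D (ψ.extend (𝓡 m) q) / 2 < D y} ∈ 𝓝 q :=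
    (ψ.continuousAt_extend hq).preimage_mem_nhds
      ((hDc.continuousAt ((isOpen_extend_target_model ψ).mem_nhds hy)).eventually
        (lt_mem_nhds (half_lt_self hDpos)))
  obtain ⟨η, hη0, hηs, hηI⟩ := exists_bump_integral_pos B hα hq hW
  have hηψ := hηs.trans inter_subset_left
  have hηc : Continuous (η : HolderSpace B 2 α) := (η : HolderSpace B 2 α).mem.1.continuous
  have h1 := mul_integral_le_integral_mul hDc hηc hηψ hη0 (κ := D (ψ.extend (𝓡 m) q) / 2)
    fun y hy hne => by
      have h2 := (hηs (subset_tsupport _ hne)).2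
      rw [mem_preimage, PartialEquiv.right_inv _ hy] at h2
      exact le_of_lt h2
  have h2 := hu.hasDerivAt_volMap hι hψ hdu hr hh hηψ
  have h3 := hu'.hasDerivAt_volMap hι' hψ hdu' hr hh hηψ
  have h4 := h2.unique (h3.congr_of_eventuallyEq (by
    filter_upwards [FermiMetric.IsSolutionMap.eventually_mem_ball hh η] with t ht
      using hV _ ht))
  simp only [hD, sub_mul] at h1
  rw [integral_sub (integrableOn_mul_comp_extend_symm hc hηc hηψ)
    (integrableOn_mul_comp_extend_symm hc' hηc hηψ), h4, sub_self] at h1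
  have h5 : 0 < D (ψ.extend (𝓡 m) q) / 2 *
    ∫ y in (ψ.extend (𝓡 m)).target, (η : HolderSpace B 2 α) ((ψ.extend (𝓡 m)).symm y) :=
    mul_pos (half_pos hDpos) hηI
  exact absurd h1 (not_le.2 h5)

include hι hι' hψ hu hdu hu' hdu' hr in
-- Turns a pointwise gap between the densities on the support of a nonnegative η into a gap between
-- the derivatives of the two volumes.
theorem mul_integral_le_fderiv_volMap_sub [T2Space M] {h η : smoothSubspace B α}
    (hh : h ∈ Metric.ball 0 ε) (hV : DifferentiableAt ℝ (g.volMap u) h)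
    (hV' : DifferentiableAt ℝ (g'.volMap u') h)
    (hη : tsupport (η : HolderSpace B 2 α) ⊆ ψ.source) (hη0 : ∀ p, 0 ≤ (η : HolderSpace B 2 α) p)
    {κ : ℝ} (hκ : ∀ y ∈ (ψ.extend (𝓡 m)).target,
      (η : HolderSpace B 2 α) ((ψ.extend (𝓡 m)).symm y) ≠ 0 →
        κ ≤ g.boundaryDensity ι ψ (u h) y - g'.boundaryDensity ι' ψ (u' h) y) :
    κ * ∫ y in (ψ.extend (𝓡 m)).target, (η : HolderSpace B 2 α) ((ψ.extend (𝓡 m)).symm y) ≤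
      fderiv ℝ (g.volMap u) h η - fderiv ℝ (g'.volMap u') h η := by
  have : CompactSpace M := B.compactSpace
  have hc := g.continuousOn_boundaryDensity hι hψ (u h).mem.1 (hu.mem_Ioo hr hh)
  have hc' := g'.continuousOn_boundaryDensity hι' hψ (u' h).mem.1 (hu'.mem_Ioo hr hh)
  have hηc : Continuous (η : HolderSpace B 2 α) := (η : HolderSpace B 2 α).mem.1.continuous
  rw [hu.fderiv_volMap hι hψ hdu hr hh hV hη, hu'.fderiv_volMap hι' hψ hdu' hr hh hV' hη,
    ← integral_sub (integrableOn_mul_comp_extend_symm hc hηc hη)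
    (integrableOn_mul_comp_extend_symm hc' hηc hη)]
  simp only [← sub_mul]
  exact mul_integral_le_integral_mul (hc.sub hc') hηc hη hη0 hκ

variable {Λ Λ' : smoothSubspace B α → HolderSpace B 1 α} (hΛ : g.IsDNMap ι ε u Λ)
  (hΛ' : g'.IsDNMap ι' ε u' Λ') (hε : 0 < ε)

set_option maxHeartbeats 1600000 in
include hι hι' hg hu hdu hu' hdu' hr hα hΛ hΛ' hε in
/-- The lowest order term of the difference of two Dirichlet-to-Neumann maps is nonpositive if the
derivative of the difference of the volumes is small. -/
theorem iteratedFDeriv_sub_apply_nonpos {k j : ℕ} (hjk : j ≤ k)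
    (hV : ContDiffAt ℝ (k + 1) (g.volMap u) 0) (hV' : ContDiffAt ℝ (k + 1) (g'.volMap u') 0)
    (hΛd : ContDiffAt ℝ k Λ 0) (hΛd' : ContDiffAt ℝ k Λ' 0)
    (hVV : ∀ i ≤ k + 1, iteratedFDeriv ℝ i (g.volMap u) 0 = iteratedFDeriv ℝ i (g'.volMap u') 0)
    (h0 : ∀ i < j, iteratedFDeriv ℝ i (Λ - Λ') 0 = 0) (h : smoothSubspace B α) (q : M) :
    (iteratedFDeriv ℝ j (Λ - Λ') 0 fun _ => h) q ≤ 0 := by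
  have : T2Space M := hι.t2Space
  have : CompactSpace M := B.compactSpace
  have h0ball : (0 : smoothSubspace B α) ∈ Metric.ball 0 ε := Metric.mem_ball_self hε
  have hδ : 0 < δ := ((norm_nonneg _).trans (hu.norm_le 0 h0ball)).trans_lt hr
  by_contra! hpos
  set T := iteratedFDeriv ℝ j (Λ - Λ') 0 fun _ => h with hT
  set c := T q with hc
  have hTc : Continuous T := T.mem.1.continuous
  set ψ := chartAt (EuclideanSpace ℝ (Fin m)) q
  have hψ : ψ ∈ IsManifold.maximalAtlas (𝓡 m) ∞ M := IsManifold.chart_mem_maximalAtlas _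
  have hq : q ∈ ψ.source := mem_chart_source _ _
  have hy : ψ.extend (𝓡 m) q ∈ (ψ.extend (𝓡 m)).target :=
    PartialEquiv.map_source _ (by simpa using hq)
  have hline : Filter.Tendsto (fun t : ℝ => t • h) (𝓝 0) (𝓝 0) := by
    have : Continuous fun t : ℝ => t • h := by fun_prop
    simpa using this.tendsto 0
  -- the expansion of the difference of the Dirichlet-to-Neumann maps
  have hexp := ContDiffAt.isLittleO_line (f := Λ - Λ') (n := j)
    ((hΛd.sub hΛd').of_le (by exact_mod_cast hjk)) h fun i hi => by rw [h0 i hi]; rfl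
  -- Where T > c/2 the leading term is at least twice c t^j / (4 j!) for t > 0, so half of it
  -- survives this error.
  have hexp' := hexp.def (c := c / (4 * j.factorial)) (by positivity)
  -- bounds of the Dirichlet-to-Neumann maps
  set b := max (‖Λ 0‖ + 1) (‖Λ' 0‖ + 1)
  have hb : ∀ᶠ t : ℝ in 𝓝 0, ‖Λ (t • h)‖ < ‖Λ 0‖ + 1 :=
    (hΛd.continuousAt.norm.tendsto.comp hline).eventually (gt_mem_nhds (lt_add_one _))
  have hb' : ∀ᶠ t : ℝ in 𝓝 0, ‖Λ' (t • h)‖ < ‖Λ' 0‖ + 1 :=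
    (hΛd'.continuousAt.norm.tendsto.comp hline).eventually (gt_mem_nhds (lt_add_one _))
  obtain ⟨κ, hκ, hmono⟩ := g.exists_le_conormalDensity_sub hι hψ hδ
    ((h : HolderSpace B 2 α).mem.1.of_le (by norm_num)) hy b
  rw [nhds_prod_eq, Filter.eventually_prod_iff] at hmono
  obtain ⟨P, hP, Q, hQ, hPQ⟩ := hmono
  -- The neighbourhood, and hence η, is fixed before t is chosen; P and Q split the uniform estimate
  -- into a condition on t and one on the point.
  have hW : {p | c / 2 < T p} ∩ ψ.extend (𝓡 m) ⁻¹' {y | Q y} ∈ 𝓝 q :=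
    Filter.inter_mem (hTc.continuousAt.eventually (lt_mem_nhds (half_lt_self hpos)))
      ((ψ.continuousAt_extend hq).preimage_mem_nhds hQ)
  obtain ⟨η, hη0, hηs, hηI⟩ := exists_bump_integral_pos B hα hq hW
  have hηψ := hηs.trans inter_subset_left
  have hηc : Continuous (η : HolderSpace B 2 α) := (η : HolderSpace B 2 α).mem.1.continuous
  set I := ∫ y in (ψ.extend (𝓡 m)).target, (η : HolderSpace B 2 α) ((ψ.extend (𝓡 m)).symm y)
  -- the derivative of the difference of the volumes
  have hVsub := ContDiffAt.isLittleO_fderiv_line (V := g.volMap u - g'.volMap u') (hV.sub hV')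
    (fun i hi => by
      rw [iteratedFDeriv_sub_apply (hV.of_le (by exact_mod_cast hi))
        (hV'.of_le (by exact_mod_cast hi)), hVV i hi, sub_self]) h η
  set κ' := κ * (c / (4 * j.factorial)) with hκ'
  have hκ'pos : 0 < κ' := by positivity
  -- Half of the lower bound κ' I t^j obtained below from the densities.
  have hVsub' := hVsub.def (c := κ' * I / 2) (by positivity)
  have hVd := hline.eventually (hV.eventually (by simp))
  have hVd' := hline.eventually (hV'.eventually (by simp))
  have hball := hline.eventually (Metric.isOpen_ball.mem_nhds h0ball)
  -- Besides being small, t is taken in (0, 1): then t^j > 0 and t^k ≤ t^j, so an o(t^k) term is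
  -- negligible against t^j.
  obtain ⟨t, ⟨⟨⟨⟨⟨ht1, ht2⟩, ht3⟩, ht4⟩, ht5⟩, ht6⟩, htb, htP, ht0⟩ :
      ∃ t : ℝ, ((((((‖(Λ - Λ') (t • h) - (t ^ j / j.factorial) • T‖ ≤
        c / (4 * j.factorial) * ‖t ^ j‖) ∧ ‖Λ (t • h)‖ < ‖Λ 0‖ + 1) ∧
        ‖Λ' (t • h)‖ < ‖Λ' 0‖ + 1) ∧
        ‖fderiv ℝ (g.volMap u - g'.volMap u') (t • h) η‖ ≤ κ' * I / 2 * ‖t ^ k‖) ∧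
        ContDiffAt ℝ (k + 1) (g.volMap u) (t • h)) ∧
        ContDiffAt ℝ (k + 1) (g'.volMap u') (t • h)) ∧
        t • h ∈ Metric.ball 0 ε ∧ P t ∧ t ∈ Ioo 0 1 := by
    have hev := (((((((hexp'.and hb).and hb').and hVsub').and hVd).and hVd').and
      (hball.and hP)).filter_mono (nhdsWithin_le_nhds (s := Ioi 0))).and
        (Ioo_mem_nhdsGT (zero_lt_one (α := ℝ)))
    obtain ⟨t, ht⟩ := hev.exists
    exact ⟨t, ht.1.1, ht.1.2.1, ht.1.2.2, ht.2⟩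
  have htpos : 0 < t := ht0.1
  have hlow : ∀ y ∈ (ψ.extend (𝓡 m)).target,
      (η : HolderSpace B 2 α) ((ψ.extend (𝓡 m)).symm y) ≠ 0 → κ' * t ^ j ≤
        g.boundaryDensity ι ψ (u (t • h)) y - g'.boundaryDensity ι' ψ (u' (t • h)) y := by
    intro y hy hne
    have h1 := (hηs (subset_tsupport _ hne)).2
    set p := (ψ.extend (𝓡 m)).symm y with hp
    have hTp : c / 2 < T p := h1.1
    have hQy : Q y := by
      have h2 := h1.2
      rwa [mem_preimage, hp, PartialEquiv.right_inv _ hy] at h2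
    have hhδ : localRep (𝓡 m) ψ ((t • h : smoothSubspace B α) : HolderSpace B 2 α) y ∈
        Ioo (-δ) δ := by
      have h1 := hu.mem_Ioo hr htb (ι p)
      rw [hu.boundary _ htb] at h1
      exact h1
    have hsub : c / (4 * j.factorial) * t ^ j ≤ Λ (t • h) p - Λ' (t • h) p := by
      have h2 := (abs_le.1 (((Λ - Λ') (t • h) - (t ^ j / j.factorial) • T).abs_apply_le p |>.trans
        ht1)).1
      have h3 : ((Λ - Λ') (t • h) - (t ^ j / j.factorial) • T).toFun p =
        Λ (t • h) p - Λ' (t • h) p - t ^ j / j.factorial * T p := rfl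
      rw [h3, Real.norm_of_nonneg (by positivity)] at h2
      have h4 : t ^ j / j.factorial * (c / 2) ≤ t ^ j / j.factorial * T p := by gcongr
      have h5 : t ^ j / j.factorial * (c / 2) = 2 * (c / (4 * j.factorial) * t ^ j) := by
        field_simp
        ring
      linarith
    have hΛb : |Λ (t • h) p| ≤ b :=
      ((Λ (t • h)).abs_apply_le p).trans (ht2.le.trans (le_max_left _ _))
    have hΛb' : |Λ' (t • h) p| ≤ b :=
      ((Λ' (t • h)).abs_apply_le p).trans (ht3.le.trans (le_max_right _ _))
    have hle : Λ' (t • h) p ≤ Λ (t • h) p := by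
      have : 0 ≤ c / (4 * j.factorial) * t ^ j := by positivity
      linarith
    have h2 := hPQ htP hQy _ _ hΛb hΛb' hle
    have h3 : (fun a => t * tangentialDu ψ (h : HolderSpace B 2 α) y a) =
        tangentialDu ψ ((t • h : smoothSubspace B α) : HolderSpace B 2 α) y :=
      funext fun a => (tangentialDu_smul t _ y a).symm
    have h4 : t * localRep (𝓡 m) ψ (h : HolderSpace B 2 α) y =
      localRep (𝓡 m) ψ ((t • h : smoothSubspace B α) : HolderSpace B 2 α) y := rfl
    rw [hΛ _ htb, hΛ' _ htb] at h2 hsub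
    rw [hu.boundaryDensity_eq htb, hu'.boundaryDensity_eq htb,
      ← FermiMetric.boundaryCoeff_congr hg hhδ]
    dsimp only at h2
    rw [h3, h4] at h2
    refine le_trans ?_ h2
    rw [hκ', mul_assoc]
    exact mul_le_mul_of_nonneg_left hsub hκ.le
  have hd1 : DifferentiableAt ℝ (g.volMap u) (t • h) := ht5.differentiableAt (by simp)
  have hd2 : DifferentiableAt ℝ (g'.volMap u') (t • h) := ht6.differentiableAt (by simp)
  have h1 := mul_integral_le_fderiv_volMap_sub hι hψ hι' hu hdu hu' hdu' hr htb hd1 hd2 hηψ hη0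
    hlow
  rw [fderiv_sub hd1 hd2, Real.norm_of_nonneg (by positivity : 0 ≤ t ^ k)] at ht4
  have h2 := (abs_le.1 ht4).2
  have h3 : (fderiv ℝ (g.volMap u) (t • h) - fderiv ℝ (g'.volMap u') (t • h)) η =
    fderiv ℝ (g.volMap u) (t • h) η - fderiv ℝ (g'.volMap u') (t • h) η := rfl
  rw [h3] at h2
  have h4 : t ^ k ≤ t ^ j := pow_le_pow_of_le_one htpos.le ht0.2.le hjk
  have h5 : κ' * I / 2 * t ^ k ≤ κ' * I / 2 * t ^ j :=
    mul_le_mul_of_nonneg_left h4 (by positivity)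
  have h6 : 0 < κ' * I * t ^ j := by positivity
  have h7 : κ' * t ^ j * I ≤ κ' * I / 2 * t ^ j := (h1.trans h2).trans h5
  linarith

include hι hι' hg hu hdu hu' hdu' hr hα hΛ hΛ' hε in
-- Strong induction on the order. Once the lower derivatives vanish, the sign statement for (Λ, Λ')
-- and for (Λ', Λ) kills the diagonal values, and polarization does the rest.
theorem iteratedFDeriv_sub_eq_zero {k : ℕ}
    (hV : ContDiffAt ℝ (k + 1) (g.volMap u) 0) (hV' : ContDiffAt ℝ (k + 1) (g'.volMap u') 0)
    (hΛd : ContDiffAt ℝ k Λ 0) (hΛd' : ContDiffAt ℝ k Λ' 0)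
    (hVV : ∀ i ≤ k + 1, iteratedFDeriv ℝ i (g.volMap u) 0 = iteratedFDeriv ℝ i (g'.volMap u') 0)
    (j : ℕ) : j ≤ k → iteratedFDeriv ℝ j (Λ - Λ') 0 = 0 := by
  induction j using Nat.strong_induction_on with
  | _ j ih =>
    intro hjk
    have hkj : ((j : ℕ) : WithTop ℕ∞) ≤ k := by exact_mod_cast hjk
    have hneg : ∀ i ≤ k, iteratedFDeriv ℝ i (Λ' - Λ) 0 = -iteratedFDeriv ℝ i (Λ - Λ') 0 :=
      fun i _ => by rw [← neg_sub, iteratedFDeriv_neg]; rfl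
    have h0 : ∀ i < j, iteratedFDeriv ℝ i (Λ - Λ') 0 = 0 := fun i hi => ih i hi (by omega)
    refine ContDiffAt.iteratedFDeriv_eq_zero_of_diagonal ((hΛd.sub hΛd').of_le hkj) fun h => ?_
    refine Subtype.ext (funext fun q => le_antisymm ?_ ?_)
    · exact iteratedFDeriv_sub_apply_nonpos hι hι' hg hu hdu hu' hdu' hr hα hΛ hΛ' hε hjk hV hV'
        hΛd hΛd' hVV h0 h q
    · have h1 := iteratedFDeriv_sub_apply_nonpos hι' hι (fun s hs p v w => (hg s hs p v w).symm)
        hu' hdu' hu hdu hr hα hΛ' hΛ hε hjk hV' hV hΛd' hΛd (fun i hi => (hVV i hi).symm)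
        (fun i hi => by rw [hneg i (by omega), h0 i hi, neg_zero]) h q
      rw [hneg j hjk] at h1
      exact neg_nonpos.1 h1

end BoundaryDetermination

end

/-! ### The main theorem -/

theorem lemma2p3 {m : ℕ} (hm : 1 ≤ m) (α : ℝ≥0) (hα₀ : 0 < α) (hα₁ : α < 1)
    (δ ε r : ℝ) (hε : 0 < ε) (hr : r < δ)
    -- the common boundary
    {M : Type*} [TopologicalSpace M] [ChartedSpace (EuclideanSpace ℝ (Fin m)) M]
    [IsManifold (𝓡 m) ∞ M] (B : ChartCover (𝓡 m) M)
    -- two compact manifolds with this boundary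
    {S₁ : Type*} [TopologicalSpace S₁] [ChartedSpace (EuclideanHalfSpace (m + 1)) S₁]
    [IsManifold (𝓡∂ (m + 1)) ∞ S₁] [T2Space S₁] [CompactSpace S₁]
    (A₁ : ChartCover (𝓡∂ (m + 1)) S₁) (ι₁ : M → S₁) (hι₁ : IsBoundaryEmbedding m ι₁)
    {S₂ : Type*} [TopologicalSpace S₂] [ChartedSpace (EuclideanHalfSpace (m + 1)) S₂]
    [IsManifold (𝓡∂ (m + 1)) ∞ S₂] [T2Space S₂] [CompactSpace S₂]
    (A₂ : ChartCover (𝓡∂ (m + 1)) S₂) (ι₂ : M → S₂) (hι₂ : IsBoundaryEmbedding m ι₂)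
    -- the metrics `ds² + g_s`, which agree on `∂S × (-δ, δ)`
    (g₁ : FermiMetric m S₁ δ) (g₂ : FermiMetric m S₂ δ)
    (hg : ∀ s ∈ Ioo (-δ) δ, ∀ (p : M) (v w : TangentSpace (𝓡 m) p),
      g₁.val s (ι₁ p) (mfderiv (𝓡 m) (𝓡∂ (m + 1)) ι₁ p v) (mfderiv (𝓡 m) (𝓡∂ (m + 1)) ι₁ p w) =
      g₂.val s (ι₂ p) (mfderiv (𝓡 m) (𝓡∂ (m + 1)) ι₂ p v) (mfderiv (𝓡 m) (𝓡∂ (m + 1)) ι₂ p w))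
    -- well-posedness for small boundary values
    (u₁ : smoothSubspace B α → HolderSpace A₁ 2 α)
    (hu₁ : g₁.IsSolutionMap ι₁ A₁ B α ε r u₁)
    (hdu₁ : DifferentiableOn ℝ u₁ (Metric.ball 0 ε))
    (u₂ : smoothSubspace B α → HolderSpace A₂ 2 α)
    (hu₂ : g₂.IsSolutionMap ι₂ A₂ B α ε r u₂)
    (hdu₂ : DifferentiableOn ℝ u₂ (Metric.ball 0 ε)) :
    -- the volumes determine the Dirichlet-to-Neumann map
    ((∀ h ∈ Metric.ball (0 : smoothSubspace B α) ε, g₁.volMap u₁ h = g₂.volMap u₂ h) →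
      ∀ h ∈ Metric.ball (0 : smoothSubspace B α) ε, ∀ p : M,
        g₁.normalDeriv ι₁ (u₁ h) p = g₂.normalDeriv ι₂ (u₂ h) p) ∧
    -- derivatives at `0` of order `≤ k + 1` of the volume determine those of order `≤ k` of the
    -- Dirichlet-to-Neumann map
    (∀ (k : ℕ) (Λ₁ Λ₂ : smoothSubspace B α → HolderSpace B 1 α),
      g₁.IsDNMap ι₁ ε u₁ Λ₁ → g₂.IsDNMap ι₂ ε u₂ Λ₂ →
      ContDiffAt ℝ (k + 1) (g₁.volMap u₁) 0 → ContDiffAt ℝ (k + 1) (g₂.volMap u₂) 0 →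
      ContDiffAt ℝ k Λ₁ 0 → ContDiffAt ℝ k Λ₂ 0 →
      (∀ j ≤ k + 1, iteratedFDeriv ℝ j (g₁.volMap u₁) 0 = iteratedFDeriv ℝ j (g₂.volMap u₂) 0) →
      ∀ j ≤ k, iteratedFDeriv ℝ j Λ₁ 0 = iteratedFDeriv ℝ j Λ₂ 0) := by
  have hα : α ≤ 1 := hα₁.le
  refine ⟨fun hV h hh p => le_antisymm ?_ ?_, fun k Λ₁ Λ₂ hΛ₁ hΛ₂ hV₁ hV₂ hd₁ hd₂ hVV j hj => ?_⟩
  · exact normalDeriv_le_of_volMap_eq hι₁ hι₂ hg hu₁ hdu₁ hu₂ hdu₂ hr hα hV hh p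
  · exact normalDeriv_le_of_volMap_eq hι₂ hι₁ (fun s hs p v w => (hg s hs p v w).symm) hu₂ hdu₂
      hu₁ hdu₁ hr hα (fun h hh => (hV h hh).symm) hh p
  · have h := iteratedFDeriv_sub_eq_zero hι₁ hι₂ hg hu₁ hdu₁ hu₂ hdu₂ hr hα hΛ₁ hΛ₂ hε hV₁ hV₂
      hd₁ hd₂ hVV j hj
    have hkj : ((j : ℕ) : WithTop ℕ∞) ≤ k := by exact_mod_cast hj
    rw [iteratedFDeriv_sub_apply (hd₁.of_le hkj) (hd₂.of_le hkj)] at h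
    exact sub_eq_zero.1 h
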